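/- Conventions. The alphabet $\mathrm{alph}(L)$ of a language $L$ is the set of letters that occur in words of $L$. A quotient of $L$ is a language $w^{-1}L=\{x\mid wx\in L\}$ with $w\in\mathrm{alph}(L)^*$; the complexity $\kappa(L)$ is the number of distinct quotients of $L$. The syntactic semigroup of $L$ is $\mathrm{alph}(L)^+$ modulo the congruence $x\approx y\iff(\forall u,v\in \mathrm{alph}(L)^*:\ uxv\in L\Leftrightarrow uyv\in L)$. If $L$ has the set of quotients $\mathcal K$ with $|\mathcal K|=n$, an atom of $L$ is a non-empty language $A_S=\{w\in\mathrm{alph}(L)^*\mid w\in K \text{ for } K\in S,\ w\notin K\text{ for }K\in\mathcal K\setminus S\}$ with $S\subseteq \mathcal K$. A binary boolean operation is proper if it depends on both of its arguments; complements are taken relative to $(\mathrm{alph}(K)\cup\mathrm{alph}(L))^*$. An operation on two languages is restricted if both are required to have the same alphabet, and unrestricted if the alphabets may be arbitrary. For $n\ge3$ let $\mathcal D_n$ be the DFA with states $0,\dots,n-1$, initial state $0$, only final state $n-1$, and letters acting as $a\colon(0,1,\dots,n-1)$, $b\colon(0,1)$, $c\colon(n-1\to0)$ (other states fixed), $d\colon$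 identity. Let $L_n=L_n(a,b,c,d)$ be its language. $L_n(x_1,x_2,x_3,x_4)$ denotes the dialect of $L_n$ obtained by replacing $a,b,c,d$ by $x_1,x_2,x_3,x_4$ in all words, where words with a letter that is replaced by "$-$" are deleted; trailing "$-$" are omitted. **Theorem (Most complex regular languages).** For all $m,n\ge 3$, the DFA $\mathcal D_n$ is minimal, $L_n$ has complexity $n$, and so do the dialects $L_n(a)$, $L_n(a,b)$, $L_n(b,a)$, $L_n(a,b,c)$, $L_n(a,b,-,c)$, $L_n(b,a,-,d)$. The following hold, and every value below is maximal: it is an upper bound for the same measure of all regular languages $L$ of complexity $n$ (all regular languages $K,L$ of complexities $m,n$ for binary operations, with $\mathrm{alph}(K)=\mathrm{alph}(L)$ in the restricted case). 1. The syntactic semigroup of $L_n(a,b,c)$ has cardinality $n^n$; every regular language of complexity $n$ with a syntactic semigroup of cardinality $n^n$ has at least three letters in its alphabet. 2. Each quotient of $L_n(a)$ has complexity $n$. 3. The reverse of $L_n(a,b,c)$ has complexity $2^n$, and $L_n(a,b,c)$ has $2^n$ atoms. 4. For each atom $A_S$ of $L_n(a,b,c)$, $\kappa(A_S)=2^n-1$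 if $|S|\in\{0,n\}$, and $\kappa(A_S)=1+\sum_{x=1}^{|S|}\sum_{y=1}^{n-|S|}\binom nx\binom{n-x}{y}$ otherwise. (Here maximality is among the atoms $A_S$ with the same $|S|$.) 5. The star of $L_n(a,b)$ has complexity $2^{n-1}+2^{n-2}$. 6. Product. (a) Restricted: $\kappa(L_m(a,b,c)\,L_n(a,b,c))=m2^n-2^{n-1}$. (b) Unrestricted: $\kappa(L_m(a,b,-,c)\,L_n(b,a,-,d))=m2^n+2^{n-1}$. 7. Boolean operations. (a) Restricted: $\kappa(L_m(a,b)\circ L_n(b,a))=mn$ for every proper binary boolean operation $\circ$. (b) Unrestricted: $\kappa(L_m(a,b,-,c)\circ L_n(b,a,-,d))=(m+1)(n+1)$ for $\circ\in\{\cup,\oplus\}$, $\kappa(L_m(a,b,-,c)\setminus L_n(b,a))=mn+m$, and $\kappa(L_m(a,b)\cap L_n(b,a))=mn$. Moreover, at least four letters are necessary for the unrestricted bound $(m+1)(n+1)$: if $m$ and $n$ are not coprime (for instance $m=n$) and $K,L$ are regular languages of complexities $m,n$ with $\kappa(K\cup L)=(m+1)(n+1)$ or $\kappa(K\oplus L)=(m+1)(n+1)$,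 then $|\mathrm{alph}(K)\cup\mathrm{alph}(L)|\ge4$. In particular, no two streams of languages over fewer than four letters in total meet this bound for all $m,n\ge3$. -/

import Mathlib

open scoped Computability

universe u

namespace MostComplex

section General

variable {α β : Type*}

/-- The alphabet of a language: the set of letters that occur in at least one of its words. -/
def alphabet (L : Language α) : Set α := {x | ∃ w ∈ L, x ∈ w}

/-- The set of all words over the set of letters `A`. -/
def wordsOver (A : Set α) : Language α := {w | ∀ x ∈ w, x ∈ A}

/-- The (left) quotients of a language by the words over its own alphabet. -/
def quotients (L : Language α) : Set (Language α) :=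
  {K | ∃ w ∈ wordsOver (alphabet L), K = L.leftQuotient w}

/-- The (quotient/state) complexity of a language: the number of its quotients. -/
noncomputable def complexity (L : Language α) : ℕ∞ := (quotients L).encard

/-- `L` is a regular language with exactly `n` quotients. -/
def RegularOfComplexity (n : ℕ) (L : Language α) : Prop :=
  L.IsRegular ∧ complexity L = n

/-- All states are reachable and no two distinct states have the same right language. -/
def IsMinimalDFA {σ : Type*} (M : DFA α σ) : Prop :=
  (∀ q, ∃ w, M.eval w = q) ∧ ∀ p q, M.acceptsFrom p = M.acceptsFrom q → p = q

/-- The nonempty word over the alphabet of `L` represented by an element of the free semigroup. -/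
def toWord {A : Set α} (x : FreeSemigroup A) : List α := (x.head :: x.tail).map Subtype.val

theorem toWord_mul {A : Set α} (x y : FreeSemigroup A) :
    toWord (x * y) = toWord x ++ toWord y := by
  simp [toWord, FreeSemigroup.head_mul, FreeSemigroup.tail_mul]

/-- The Myhill (syntactic) congruence of `L` on the nonempty words over the alphabet of `L`. -/
def syntacticCon (L : Language α) : Con (FreeSemigroup (alphabet L)) where
  r x y := ∀ u ∈ wordsOver (alphabet L), ∀ v ∈ wordsOver (alphabet L),
    (u ++ toWord x ++ v ∈ L ↔ u ++ toWord y ++ v ∈ L)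
  iseqv :=
    { refl := fun _ _ _ _ _ => Iff.rfl
      symm := fun h u hu v hv => (h u hu v hv).symm
      trans := fun h k u hu v hv => (h u hu v hv).trans (k u hu v hv) }
  mul' := by
    intro x x' y y' h k u hu v hv
    have hw : ∀ z : FreeSemigroup (alphabet L), ∀ t ∈ toWord z, t ∈ alphabet L := by
      intro z t ht
      obtain ⟨s, -, rfl⟩ := List.mem_map.1 ht
      exact s.2
    have h1 := h u hu (toWord y ++ v) (by
      intro t ht
      rcases List.mem_append.1 ht with ht | ht
      · exact hw y t ht
      · exact hv t ht)
    have h2 := k (u ++ toWord x') (by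
      intro t ht
      rcases List.mem_append.1 ht with ht | ht
      · exact hu t ht
      · exact hw x' t ht) v hv
    simp only [toWord_mul, List.append_assoc] at h1 h2 ⊢
    exact h1.trans h2

/-- The syntactic semigroup of a language. -/
abbrev SyntacticSemigroup (L : Language α) : Type _ := (syntacticCon L).Quotient

/-- The syntactic complexity of a language: the cardinality of its syntactic semigroup. -/
noncomputable def syntacticComplexity (L : Language α) : ℕ∞ := ENat.card (SyntacticSemigroup L)

/-- The atomic intersection of `L` determined by a set `S` of quotients of `L`: the quotients in
`S` appear uncomplemented, the others complemented (relative to the words over the alphabet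
of `L`). -/
def atomicIntersection (L : Language α) (S : Set (Language α)) : Language α :=
  {w | w ∈ wordsOver (alphabet L) ∧ (∀ K ∈ S, w ∈ K) ∧ ∀ K ∈ quotients L \ S, w ∉ K}

/-- `A` is the atom of `L` determined by the set `S` of quotients of `L`, that is, it is the
corresponding atomic intersection and it is nonempty. -/
def IsAtomOf (L : Language α) (S : Set (Language α)) (A : Language α) : Prop :=
  S ⊆ quotients L ∧ A = atomicIntersection L S ∧ ∃ w, w ∈ A

/-- The set of atoms of a language. -/
def atoms (L : Language α) : Set (Language α) := {A | ∃ S, IsAtomOf L S A}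

/-- The maximal complexity of an atom in which `s` of `n` quotients appear uncomplemented. -/
def atomBound (n s : ℕ) : ℕ :=
  if s = 0 ∨ s = n then 2 ^ n - 1
  else 1 + ∑ x ∈ Finset.Icc 1 s, ∑ y ∈ Finset.Icc 1 (n - s), n.choose x * (n - x).choose y

/-- A binary boolean function (on truth values) is proper if it depends on both arguments. -/
def ProperBool (f : Prop → Prop → Prop) : Prop :=
  (∃ p p' q, ¬(f p q ↔ f p' q)) ∧ ∃ p q q', ¬(f p q ↔ f p q')

/-- The binary boolean operation on languages induced by `f`; the result is a language over the
union of the two alphabets, and complements are taken relative to that union. -/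
def boolOp (f : Prop → Prop → Prop) (K L : Language α) : Language α :=
  {w | w ∈ wordsOver (alphabet K ∪ alphabet L) ∧ f (w ∈ K) (w ∈ L)}

/-- The dialect of `L` given by a partial map `π` of letters: every letter `x` is replaced by
`π x`, and words that contain a letter at which `π` is undefined are deleted. -/
def dialect (π : α → Option β) (L : Language α) : Language β :=
  {v | ∃ w ∈ L, w.map π = v.map some}

end General

/-- The letters of the master language. -/
inductive Letter
  | a | b | c | d

/-- The DFA with states `0, …, n - 1`, initial state `0`, unique final state `n - 1`, in which `a`
acts as the cycle `(0, …, n - 1)`, `b` as the transposition `(0, 1)`, `c` sends `n - 1` to `0` and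
fixes the other states, and `d` acts as the identity. -/
def masterDFA (n : ℕ) (hn : 3 ≤ n) : DFA Letter (Fin n) where
  step q x :=
    match x with
    | .a => ⟨(q.val + 1) % n, Nat.mod_lt _ (by omega)⟩
    | .b => Equiv.swap ⟨0, by omega⟩ ⟨1, by omega⟩ q
    | .c => if q.val = n - 1 then ⟨0, by omega⟩ else q
    | .d => q
  start := ⟨0, by omega⟩
  accept := {⟨n - 1, by omega⟩}

/-- The master language `L_n(a, b, c, d)`. -/
def master (n : ℕ) (hn : 3 ≤ n) : Language Letter := (masterDFA n hn).accepts

/-- The dialect `L_n(x, y, z, t)` of the master language, obtained by replacing `a, b, c, d` by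
`x, y, z, t`, where `none` stands for an undefined value. -/
def stream (n : ℕ) (hn : 3 ≤ n) (x y z t : Option Letter) : Language Letter :=
  dialect
    (fun l : Letter =>
      match l with
      | .a => x
      | .b => y
      | .c => z
      | .d => t)
    (master n hn)

end MostComplex

open MostComplex

/-! A regular language of complexity `n` is the language of its quotient automaton, a minimal
`Presentation` on `Fin n` whose letters form exactly the alphabet (`exists_presentation`). Each
operation has a subset or pair automaton whose states determine the quotients of the result, so
counting the admissible states bounds the complexity (`complexity_le`). A word with a letter foreign
to an operand has the empty quotient there; this is an extra state `none`, and it accounts for the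
larger bounds when alphabets may differ. A lower bound needs all admissible states to be reached by
words over the alphabet of the result and to have different languages (`le_complexity`).

For a single language, the cycle and the transposition generate all permutations, and the merging
letter adds all transformations (`mem_transformations`). Hence words move states arbitrarily and
every set of states is the set accepting some word, which settles the syntactic semigroup, reversal
and atoms. The cycle alone gives minimality: `a ^ (n - 1 - p)` is accepted from `p` only. These
words also read off the set component of the star and product automata, because they are too short
to contain a further factor, except in a case where the initial state is in the set anyway.
Reachability of sets is an induction on their size: a passage through the final state adds one
element, and permutations carry it to its place.

For boolean operations and the unrestricted product, `a` and `b` exchange roles in the two operands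
(`IsCrossed`), so `aa` moves only the first component and `bb` only the second. A neutral letter
private to one operand erases the other component, and reveals the state of the operand that owns
it.

Reaching the pairs with one component `none` takes a private letter for each operand. With only one
common letter, all pairs of proper states would be reached by its powers, which forces `m` and `n`
to be coprime (`coprime_of_forall_iterate`). So there are at least four letters otherwise. -/

namespace MostComplex

/-! ### Words over a set of letters, and bounds for the number of quotients -/

section Words

variable {α : Type*} {A B : Set α} {u v w : List α} {x : α}

theorem nil_mem_wordsOver : ([] : List α) ∈ wordsOver A := fun _ h => absurd h List.not_mem_nil

theorem cons_mem_wordsOver : x :: w ∈ wordsOver A ↔ x ∈ A ∧ w ∈ wordsOver A :=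
  List.forall_mem_cons

theorem append_mem_wordsOver : u ++ v ∈ wordsOver A ↔ u ∈ wordsOver A ∧ v ∈ wordsOver A :=
  List.forall_mem_append

theorem singleton_mem_wordsOver : [x] ∈ wordsOver A ↔ x ∈ A :=
  List.forall_mem_singleton

theorem reverse_mem_wordsOver : w.reverse ∈ wordsOver A ↔ w ∈ wordsOver A :=
  ⟨fun h y hy => h y (List.mem_reverse.2 hy), fun h y hy => h y (List.mem_reverse.1 hy)⟩

theorem replicate_mem_wordsOver (k : ℕ) (h : x ∈ A) : List.replicate k x ∈ wordsOver A := by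
  intro y hy
  rw [List.eq_of_mem_replicate hy]
  exact h

theorem wordsOver_mono (h : A ⊆ B) (hw : w ∈ wordsOver A) : w ∈ wordsOver B :=
  fun y hy => h (hw y hy)

theorem mem_wordsOver_inter :
    w ∈ wordsOver (A ∩ B) ↔ w ∈ wordsOver A ∧ w ∈ wordsOver B :=
  ⟨fun h => ⟨fun y hy => (h y hy).1, fun y hy => (h y hy).2⟩, fun h y hy => ⟨h.1 y hy, h.2 y hy⟩⟩

theorem mem_wordsOver_alphabet {L : Language α} (h : w ∈ L) : w ∈ wordsOver (alphabet L) :=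
  fun _ hx => ⟨w, h, hx⟩

theorem alphabet_subset {L : Language α} (h : ∀ w ∈ L, w ∈ wordsOver A) : alphabet L ⊆ A := by
  rintro x ⟨w, hw, hx⟩
  exact h w hw x hx

theorem alphabet_leftQuotient (L : Language α) (w : List α) :
    alphabet (L.leftQuotient w) ⊆ alphabet L := by
  rintro x ⟨v, hv, hx⟩
  exact ⟨w ++ v, hv, List.mem_append_right _ hx⟩

/-- The form of all automaton upper bounds: `T` is the set of admissible states and `Φ` gives their
languages. Injectivity of `Φ` is not needed here. -/
theorem complexity_le {ι : Type*} {X : Language α} (Φ : ι → Language α) (T : Set ι)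
    (h : ∀ w ∈ wordsOver (alphabet X), ∃ t ∈ T, X.leftQuotient w = Φ t) :
    complexity X ≤ T.encard := by
  refine le_trans (Set.encard_le_encard ?_) (Set.encard_image_le Φ T)
  rintro K ⟨w, hw, rfl⟩
  obtain ⟨t, ht, e⟩ := h w hw
  exact ⟨t, ht, e.symm⟩

/-- The counterpart of `complexity_le`: reachability of the states in `T` and distinguishability.
The words have to be over the alphabet of the result itself, so later one must check which letters
really occur in it. -/
theorem le_complexity {ι : Type*} {X : Language α} (Φ : ι → Language α) (T : Set ι)
    (h : ∀ t ∈ T, ∃ w ∈ wordsOver (alphabet X), X.leftQuotient w = Φ t)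
    (inj : Set.InjOn Φ T) : T.encard ≤ complexity X := by
  rw [← inj.encard_image]
  refine Set.encard_le_encard ?_
  rintro _ ⟨t, ht, rfl⟩
  obtain ⟨w, hw, e⟩ := h t ht
  exact ⟨w, hw, e.symm⟩

end Words

/-! ### Automata on `Fin n` and the quotient automaton -/

/-- A complete deterministic automaton with `n` states over the set of letters `letters`. -/
structure Presentation (α : Type*) (n : ℕ) where
  letters : Set α
  step : Fin n → α → Fin n
  start : Fin n
  final : Set (Fin n)

namespace Presentation

variable {α : Type*} {n : ℕ} (P : Presentation α n)

/-- The state reached from `q` by reading `w`. -/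
def run (q : Fin n) (w : List α) : Fin n := w.foldl P.step q

/-- The words over the letters of `P` that lead from `q` to a final state. -/
def rightLang (q : Fin n) : Language α := {w | w ∈ wordsOver P.letters ∧ P.run q w ∈ P.final}

/-- The language of `P`. -/
def lang : Language α := P.rightLang P.start

/-- All letters occur in the language, all states are reachable, distinct states have distinct
right languages. -/
structure IsMinimal : Prop where
  alphabet_lang : alphabet P.lang = P.letters
  reach : ∀ q, ∃ w ∈ wordsOver P.letters, P.run P.start w = q
  injective : Function.Injective P.rightLang

@[simp] theorem run_nil (q : Fin n) : P.run q [] = q := rfl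

@[simp] theorem run_cons (q : Fin n) (x : α) (w : List α) :
    P.run q (x :: w) = P.run (P.step q x) w := rfl

@[simp] theorem run_append (q : Fin n) (v w : List α) :
    P.run q (v ++ w) = P.run (P.run q v) w := List.foldl_append

variable {P}

theorem mem_rightLang {q : Fin n} {w : List α} :
    w ∈ P.rightLang q ↔ w ∈ wordsOver P.letters ∧ P.run q w ∈ P.final := Iff.rfl

theorem mem_lang {w : List α} :
    w ∈ P.lang ↔ w ∈ wordsOver P.letters ∧ P.run P.start w ∈ P.final := Iff.rfl

theorem nil_mem_rightLang {q : Fin n} : [] ∈ P.rightLang q ↔ q ∈ P.final :=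
  ⟨fun h => h.2, fun h => ⟨nil_mem_wordsOver, h⟩⟩

theorem append_mem_rightLang {q : Fin n} {w v : List α} :
    w ++ v ∈ P.rightLang q ↔ w ∈ wordsOver P.letters ∧ v ∈ P.rightLang (P.run q w) := by
  simp only [mem_rightLang, append_mem_wordsOver, run_append, and_assoc]

theorem append_mem_lang {w v : List α} :
    w ++ v ∈ P.lang ↔ w ∈ wordsOver P.letters ∧ v ∈ P.rightLang (P.run P.start w) :=
  append_mem_rightLang

theorem leftQuotient_rightLang (q : Fin n) {w : List α} (hw : w ∈ wordsOver P.letters) :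
    (P.rightLang q).leftQuotient w = P.rightLang (P.run q w) := by
  ext v
  rw [Language.mem_leftQuotient, append_mem_rightLang, and_iff_right hw]

theorem leftQuotient_lang {w : List α} (hw : w ∈ wordsOver P.letters) :
    P.lang.leftQuotient w = P.rightLang (P.run P.start w) := leftQuotient_rightLang _ hw

/-- Source of the extra state in unrestricted operations: after a foreign letter no continuation is
accepted. -/
theorem leftQuotient_lang_of_notMem {w : List α} (hw : w ∉ wordsOver P.letters) :
    P.lang.leftQuotient w = 0 := by
  ext v
  rw [Language.mem_leftQuotient, lang, append_mem_rightLang]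
  simp [hw]

theorem alphabet_lang_subset : alphabet P.lang ⊆ P.letters := alphabet_subset fun _ h => h.1

theorem isRegular_lang : P.lang.IsRegular := by
  refine Language.IsRegular.of_finite_range_leftQuotient ?_
  refine (((Set.finite_range P.rightLang).insert 0)).subset ?_
  rintro _ ⟨w, rfl⟩
  by_cases hw : w ∈ wordsOver P.letters
  · exact Or.inr ⟨_, (leftQuotient_lang hw).symm⟩
  · exact Or.inl (leftQuotient_lang_of_notMem hw)

namespace IsMinimal

theorem quotients_lang (hP : P.IsMinimal) : quotients P.lang = Set.range P.rightLang := by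
  ext K
  simp only [quotients, hP.alphabet_lang, Set.mem_ofPred_eq, Set.mem_range]
  constructor
  · rintro ⟨w, hw, rfl⟩
    exact ⟨_, (leftQuotient_lang hw).symm⟩
  · rintro ⟨q, rfl⟩
    obtain ⟨w, hw, rfl⟩ := hP.reach q
    exact ⟨w, hw, (leftQuotient_lang hw).symm⟩

theorem complexity_lang (hP : P.IsMinimal) : complexity P.lang = n := by
  rw [complexity, hP.quotients_lang, ← Set.image_univ, hP.injective.encard_image,
    Set.encard_univ]
  simp

theorem regularOfComplexity (hP : P.IsMinimal) : RegularOfComplexity n P.lang :=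
  ⟨isRegular_lang, hP.complexity_lang⟩

end IsMinimal

end Presentation

-- The quotient automaton: the states are the quotients, numbered by `Fin n`, a letter `x` sends `K`
-- to its quotient by `x`, and `K` is final if it contains the empty word. The right language of a
-- state is then the quotient itself, which gives minimality.
open Classical in
theorem exists_presentation {α : Type*} {n : ℕ} {L : Language α} (h : RegularOfComplexity n L) :
    ∃ P : Presentation α n, P.IsMinimal ∧ P.lang = L := by
  have hfin : (quotients L).Finite := Set.finite_of_encard_eq_coe h.2
  have : Finite (quotients L) := hfin
  have hcard : Nat.card (quotients L) = n := by
    have := h.2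
    rw [complexity, ← hfin.cast_ncard_eq] at this
    exact_mod_cast this
  let e : quotients L ≃ Fin n := Finite.equivFinOfCardEq hcard
  have hq : ∀ K ∈ quotients L, ∀ w ∈ wordsOver (alphabet L), K.leftQuotient w ∈ quotients L := by
    rintro _ ⟨v, hv, rfl⟩ w hw
    exact ⟨v ++ w, append_mem_wordsOver.2 ⟨hv, hw⟩, (Language.leftQuotient_append _ _ _).symm⟩
  have hL : L ∈ quotients L := ⟨[], nil_mem_wordsOver, rfl⟩
  let P : Presentation α n :=
    { letters := alphabet L
      -- Letters outside the alphabet fix every state; this is a default value, since right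
      -- languages contain only words over `letters`.
      step := fun q x => if hx : x ∈ alphabet L then
        e ⟨(e.symm q).1.leftQuotient [x], hq _ (e.symm q).2 _ (singleton_mem_wordsOver.2 hx)⟩ else q
      start := e ⟨L, hL⟩
      final := {q | [] ∈ (e.symm q).1} }
  have hrun : ∀ w ∈ wordsOver (alphabet L), ∀ q,
      (e.symm (P.run q w)).1 = (e.symm q).1.leftQuotient w := by
    intro w
    induction w with
    | nil => intro _ q; rfl
    | cons x w ih =>
      intro hw q
      obtain ⟨hx, hw⟩ := cons_mem_wordsOver.1 hw
      rw [Presentation.run_cons, ih hw]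
      have : (e.symm (P.step q x)).1 = (e.symm q).1.leftQuotient [x] := by
        simp only [P, dif_pos hx, Equiv.symm_apply_apply]
      rw [this, ← Language.leftQuotient_append, List.singleton_append]
  have hright : ∀ q, P.rightLang q = (e.symm q).1 := by
    intro q
    ext w
    rw [Presentation.mem_rightLang]
    constructor
    · rintro ⟨hw, hf⟩
      have hf' : [] ∈ (e.symm (P.run q w)).1 := hf
      rw [hrun w hw, Language.mem_leftQuotient, List.append_nil] at hf'
      exact hf'
    · intro hw
      have hw' : w ∈ wordsOver (alphabet L) := by
        obtain ⟨v, hv, hK⟩ := (e.symm q).2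
        rw [hK] at hw
        exact (append_mem_wordsOver.1 (mem_wordsOver_alphabet hw)).2
      refine ⟨hw', ?_⟩
      change [] ∈ (e.symm (P.run q w)).1
      rw [hrun w hw', Language.mem_leftQuotient, List.append_nil]
      exact hw
  have hlang : P.lang = L := by
    rw [Presentation.lang, hright]
    simp [P]
  refine ⟨P, ⟨by rw [hlang], ?_, ?_⟩, hlang⟩
  · intro q
    obtain ⟨v, hv, hK⟩ := (e.symm q).2
    refine ⟨v, hv, e.symm.injective (Subtype.ext ?_)⟩
    rw [hrun v hv, hK]
    simp [P]
  · intro p q hpq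
    rw [hright, hright] at hpq
    exact e.symm.injective (Subtype.ext hpq)

/-! ### The letters of the witnesses and the transformations they generate -/

namespace Presentation

variable {α : Type*} {n : ℕ} (P : Presentation α n)

/-- The initial state is `0` and the only final state is `n - 1`. -/
structure IsStandard : Prop where
  start_val : P.start.val = 0
  mem_final : ∀ q, q ∈ P.final ↔ q.val + 1 = n

/-- The letter `x` acts as the cycle `(0, …, n - 1)`. -/
structure IsCycle (x : α) : Prop where
  mem : x ∈ P.letters
  val_step : ∀ q, (P.step q x).val = (q.val + 1) % n

/-- The letter `x` acts as the transposition `(0, 1)`. -/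
structure IsSwap (x : α) : Prop where
  mem : x ∈ P.letters
  val_step : ∀ q, (P.step q x).val = if q.val = 0 then 1 else if q.val = 1 then 0 else q.val

/-- The letter `x` sends `n - 1` to `0` and fixes the other states. -/
structure IsMerge (x : α) : Prop where
  mem : x ∈ P.letters
  val_step : ∀ q, (P.step q x).val = if q.val + 1 = n then 0 else q.val

/-- The letter `x` acts as the identity. -/
structure IsNeutral (x : α) : Prop where
  mem : x ∈ P.letters
  step_eq : ∀ q, P.step q x = q

variable {P} {a b c : α}

namespace IsCycle

theorem val_run (ha : P.IsCycle a) (q : Fin n) (k : ℕ) :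
    (P.run q (List.replicate k a)).val = (q.val + k) % n := by
  induction k generalizing q with
  | zero => simp [Nat.mod_eq_of_lt q.2]
  | succ k ih =>
    rw [List.replicate_succ, run_cons, ih, ha.val_step, Nat.mod_add_mod]
    congr 1
    omega

theorem exists_run_eq (ha : P.IsCycle a) (p q : Fin n) :
    ∃ k, P.run p (List.replicate k a) = q := by
  -- The summand `n` keeps the truncated subtraction exact.
  refine ⟨q.val + n - p.val, Fin.ext ?_⟩
  have := p.2
  rw [ha.val_run, show p.val + (q.val + n - p.val) = q.val + n by omega, Nat.add_mod_right,
    Nat.mod_eq_of_lt q.2]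

theorem injective_run (ha : P.IsCycle a) (k : ℕ) :
    Function.Injective fun q => P.run q (List.replicate k a) := by
  intro p q h
  have h' : (p.val + k) % n = (q.val + k) % n := by
    rw [← ha.val_run, ← ha.val_run]
    exact congrArg Fin.val h
  have h'' := Nat.ModEq.add_right_cancel' k h'
  rw [Nat.ModEq, Nat.mod_eq_of_lt p.2, Nat.mod_eq_of_lt q.2] at h''
  exact Fin.ext h''

theorem injective_step (ha : P.IsCycle a) : Function.Injective fun q => P.step q a :=
  ha.injective_run 1

theorem replicate_mem (ha : P.IsCycle a) (k : ℕ) : List.replicate k a ∈ wordsOver P.letters :=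
  replicate_mem_wordsOver k ha.mem

theorem replicate_mem_rightLang (ha : P.IsCycle a) (hP : ∀ q, q ∈ P.final ↔ q.val + 1 = n)
    {q : Fin n} {k : ℕ} :
    List.replicate k a ∈ P.rightLang q ↔ (q.val + k) % n + 1 = n := by
  rw [mem_rightLang, and_iff_right (ha.replicate_mem k), hP, ha.val_run]

/-- The word `a ^ (n - 1 - p)` is accepted from `p` and from no other state. -/
theorem replicate_sub_mem_rightLang (ha : P.IsCycle a) (hP : ∀ q, q ∈ P.final ↔ q.val + 1 = n)
    {p q : Fin n} :
    List.replicate (n - 1 - p.val) a ∈ P.rightLang q ↔ q = p := by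
  rw [ha.replicate_mem_rightLang hP]
  have hp := p.2
  have hq := q.2
  constructor
  · intro h
    apply Fin.ext
    rcases lt_or_ge (q.val + (n - 1 - p.val)) n with h' | h'
    · rw [Nat.mod_eq_of_lt h'] at h
      omega
    · rw [Nat.mod_eq_sub_mod h', Nat.mod_eq_of_lt (by omega)] at h
      omega
  · rintro rfl
    rw [Nat.mod_eq_of_lt (by omega)]
    omega

/-- One cyclic letter suffices: its powers reach every state from the initial one and separate any
two states. Any other letter `x` occurs in an accepted word, as it can be followed by a power of `a`
leading to the final state. -/
theorem isMinimal (ha : P.IsCycle a) (hP : ∀ q, q ∈ P.final ↔ q.val + 1 = n) : P.IsMinimal where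
  alphabet_lang := by
    refine alphabet_lang_subset.antisymm fun x hx => ?_
    refine ⟨[x] ++ List.replicate (n - 1 - (P.step P.start x).val) a, ?_, by simp⟩
    rw [lang, append_mem_rightLang, singleton_mem_wordsOver]
    exact ⟨hx, (ha.replicate_sub_mem_rightLang hP).2 rfl⟩
  reach q := by
    obtain ⟨k, hk⟩ := ha.exists_run_eq P.start q
    exact ⟨_, ha.replicate_mem k, hk⟩
  injective p q h := by
    have := (ha.replicate_sub_mem_rightLang hP (p := p) (q := p)).2 rfl
    rw [h, ha.replicate_sub_mem_rightLang hP] at this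
    exact this.symm

end IsCycle

theorem IsSwap.step_step (hb : P.IsSwap b) (q : Fin n) :
    P.step (P.step q b) b = q := by
  have h1 := hb.val_step q
  have h2 := hb.val_step (P.step q b)
  apply Fin.ext
  split_ifs at h1 h2 <;> omega

theorem IsSwap.injective_step (hb : P.IsSwap b) :
    Function.Injective fun q => P.step q b :=
  Function.LeftInverse.injective (g := fun q => P.step q b) hb.step_step

/-- The transformations of the states induced by words. -/
def transformations (P : Presentation α n) : Set (Fin n → Fin n) :=
  {f | ∃ w ∈ wordsOver P.letters, ∀ q, P.run q w = f q}

theorem id_mem_transformations : id ∈ P.transformations := ⟨[], nil_mem_wordsOver, fun _ => rfl⟩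

theorem comp_mem_transformations {f g : Fin n → Fin n} (hf : f ∈ P.transformations)
    (hg : g ∈ P.transformations) : g ∘ f ∈ P.transformations := by
  obtain ⟨v, hv, hf⟩ := hf
  obtain ⟨w, hw, hg⟩ := hg
  exact ⟨v ++ w, append_mem_wordsOver.2 ⟨hv, hw⟩, fun q => by
    rw [run_append, hf, hg, Function.comp_apply]⟩

theorem step_mem_transformations {x : α} (hx : x ∈ P.letters) :
    (fun q => P.step q x) ∈ P.transformations :=
  ⟨[x], singleton_mem_wordsOver.2 hx, fun _ => rfl⟩

/-- A full cycle and an adjacent transposition generate the symmetric group. Words only give a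
submonoid, but in a finite group the inverse is a power. -/
theorem perm_mem_transformations (hn : 3 ≤ n) (ha : P.IsCycle a) (hb : P.IsSwap b)
    (σ : Equiv.Perm (Fin n)) : ⇑σ ∈ P.transformations := by
  have hrot : ∀ q : Fin n, (finRotate n q).val = (q.val + 1) % n := by
    obtain ⟨k, rfl⟩ : ∃ k, n = k + 1 := ⟨n - 1, by omega⟩
    intro q
    rw [finRotate_apply, Fin.val_add]
    simp
  have key : σ ∈ Subgroup.closure
      ({finRotate n, Equiv.swap ⟨0, by omega⟩ (finRotate n ⟨0, by omega⟩)} :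
        Set (Equiv.Perm (Fin n))) := by
    rw [Equiv.Perm.closure_cycle_adjacent_swap (isCycle_finRotate_of_le (by omega))
      (support_finRotate_of_le (by omega))]
    trivial
  have hpow : ∀ τ : Equiv.Perm (Fin n), ⇑τ ∈ P.transformations →
      ∀ k : ℕ, ⇑(τ ^ k) ∈ P.transformations := by
    intro τ hτ k
    induction k with
    | zero => exact id_mem_transformations
    | succ k ih =>
      rw [pow_succ, Equiv.Perm.coe_mul]
      exact comp_mem_transformations hτ ih
  induction key using Subgroup.closure_induction with
  | mem τ hτ =>
    rcases hτ with rfl | rfl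
    · convert step_mem_transformations ha.mem using 2 with q
      exact Fin.ext (by rw [hrot, ha.val_step])
    · convert step_mem_transformations hb.mem using 2 with q
      have h1 : finRotate n ⟨0, by omega⟩ = ⟨1, by omega⟩ := Fin.ext (by
        rw [hrot]; exact Nat.mod_eq_of_lt (show 0 + 1 < n by omega))
      rw [h1, Equiv.swap_apply_def]
      apply Fin.ext
      rw [hb.val_step]
      simp only [Fin.ext_iff]
      split_ifs <;> rfl
  | one => exact id_mem_transformations
  | mul τ τ' _ _ h h' =>
    rw [Equiv.Perm.coe_mul]
    exact comp_mem_transformations h' h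
  | inv τ _ h =>
    have : τ⁻¹ = τ ^ (orderOf τ - 1) := by
      rw [eq_comm]
      apply eq_inv_of_mul_eq_one_left
      rw [← pow_succ, Nat.sub_add_cancel (orderOf_pos τ), pow_orderOf_eq_one]
    rw [this]
    exact hpow τ h _

/-- The merge `n - 1 → 0` conjugated by a permutation that carries `i` to `n - 1` and `j` to `0`. -/
theorem update_mem_transformations (hn : 3 ≤ n) (ha : P.IsCycle a) (hb : P.IsSwap b)
    (hc : P.IsMerge c) {i j : Fin n} (hij : i ≠ j) :
    Function.update id i j ∈ P.transformations := by
  have h0 : (⟨n - 1, by omega⟩ : Fin n) ≠ ⟨0, by omega⟩ := by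
    simp only [ne_eq, Fin.mk.injEq]; omega
  obtain ⟨σ, hσi, hσj⟩ : ∃ σ : Equiv.Perm (Fin n),
      σ i = ⟨n - 1, by omega⟩ ∧ σ j = ⟨0, by omega⟩ := by
    set τ := Equiv.swap i (⟨n - 1, by omega⟩ : Fin n)
    -- First bring `i` to `n - 1`, then correct the image of `j`; the second swap does not touch `n
    -- - 1`, because neither `τ j` nor `0` equals it.
    refine ⟨Equiv.swap (τ j) ⟨0, by omega⟩ * τ, ?_, ?_⟩
    · have h1 : τ i = ⟨n - 1, by omega⟩ := Equiv.swap_apply_left _ _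
      rw [Equiv.Perm.mul_apply, h1, Equiv.swap_apply_of_ne_of_ne _ h0]
      rw [← h1]
      exact fun h => hij (τ.injective h)
    · rw [Equiv.Perm.mul_apply, Equiv.swap_apply_left]
  have := comp_mem_transformations (comp_mem_transformations
    (perm_mem_transformations hn ha hb σ) (step_mem_transformations hc.mem))
    (perm_mem_transformations hn ha hb σ⁻¹)
  convert this using 1
  funext q
  simp only [Function.comp_apply, Function.update_apply, id]
  rw [Equiv.Perm.eq_inv_iff_eq]
  apply Fin.ext
  rw [hc.val_step]
  split_ifs with h h' h'
  · rw [hσj]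
  · rw [h, hσi] at h'
    exact absurd (Nat.sub_add_cancel (by omega : 1 ≤ n)) h'
  · refine absurd (σ.injective ?_) h
    rw [hσi]
    exact Fin.ext (by simp only; omega)
  · rfl

/-- Induction on the number of missing values. If `f i = f j` and `y` is missed, then `f` is the
merge of `i` into `j` followed by `f` with its value at `i` changed to `y`, and the latter has one
more value. -/
theorem mem_transformations (hn : 3 ≤ n) (ha : P.IsCycle a) (hb : P.IsSwap b)
    (hc : P.IsMerge c) (f : Fin n → Fin n) : f ∈ P.transformations := by
  induction hk : n - (Finset.univ.image f).card using Nat.strong_induction_on generalizing f with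
  | _ k ih =>
    by_cases hf : Function.Injective f
    · exact perm_mem_transformations hn ha hb
        (Equiv.ofBijective f (Finite.injective_iff_bijective.1 hf))
    · have hs : ¬Function.Surjective f := fun h => hf (Finite.injective_iff_surjective.2 h)
      simp only [Function.Injective, Function.Surjective, not_forall, not_exists] at hf hs
      obtain ⟨i, j, hij, hne⟩ := hf
      obtain ⟨y, hy⟩ := hs
      have hcomp : f = Function.update f i y ∘ Function.update id i j := by
        funext q
        by_cases hq : q = i
        · subst hq
          simp [Function.update_of_ne (Ne.symm hne), hij]
        · simp [Function.update_of_ne hq]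
      have himg : Finset.univ.image (Function.update f i y) = insert y (Finset.univ.image f) := by
        ext z
        simp only [Finset.mem_image, Finset.mem_univ, true_and, Finset.mem_insert]
        constructor
        · rintro ⟨q, rfl⟩
          by_cases hq : q = i
          · subst hq
            simp
          · exact Or.inr ⟨q, by simp [hq]⟩
        · rintro (rfl | ⟨q, rfl⟩)
          · exact ⟨i, by simp⟩
          · by_cases hq : q = i
            · subst hq
              exact ⟨j, by simp [Function.update_of_ne (Ne.symm hne), hij]⟩
            · exact ⟨q, by simp [hq]⟩
      have hcard : (Finset.univ.image (Function.update f i y)).card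
          = (Finset.univ.image f).card + 1 := by
        rw [himg, Finset.card_insert_of_notMem]
        simpa using hy
      have hle : (Finset.univ.image (Function.update f i y)).card ≤ n := by
        simpa using Finset.card_le_univ (Finset.univ.image (Function.update f i y))
      rw [hcomp]
      exact comp_mem_transformations (update_mem_transformations hn ha hb hc hne)
        (ih _ (by omega) _ rfl)

/-- Every transformation of the states is induced by a nonempty word. -/
theorem exists_run_eq (hn : 3 ≤ n) (ha : P.IsCycle a) (hb : P.IsSwap b) (hc : P.IsMerge c)
    (f : Fin n → Fin n) : ∃ w ∈ wordsOver P.letters, w ≠ [] ∧ ∀ q, P.run q w = f q := by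
  obtain ⟨w, hw, h⟩ := mem_transformations hn ha hb hc f
  -- The prefix `a ^ n` acts as the identity and only makes the word nonempty, as the syntactic
  -- semigroup requires.
  refine ⟨List.replicate n a ++ w, append_mem_wordsOver.2 ⟨ha.replicate_mem n, hw⟩, ?_, fun q => ?_⟩
  · intro h
    have := congrArg List.length h
    simp at this
    omega
  · rw [run_append, ← h]
    congr 1
    exact Fin.ext (by rw [ha.val_run, Nat.add_mod_right, Nat.mod_eq_of_lt q.2])

end Presentation

/-! ### The master automaton and its dialects -/

/-- The presentation of the dialect of the master language in which the letter `y` acts as the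
letter `ρ y`. -/
def masterPresentation (n : ℕ) (hn : 3 ≤ n) (ρ : Letter → Option Letter) :
    Presentation Letter n where
  letters := {y | ρ y ≠ none}
  step q y := (ρ y).elim q ((masterDFA n hn).step q)
  start := ⟨0, by omega⟩
  final := {⟨n - 1, by omega⟩}

section Master

variable {n : ℕ} {hn : 3 ≤ n} {ρ : Letter → Option Letter} {x : Letter}

theorem isStandard_masterPresentation : (masterPresentation n hn ρ).IsStandard where
  start_val := rfl
  mem_final q := by
    simp only [masterPresentation, Set.mem_singleton_iff, Fin.ext_iff]
    omega

theorem isCycle_masterPresentation (h : ρ x = some .a) :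
    (masterPresentation n hn ρ).IsCycle x where
  mem := by simp [masterPresentation, h]
  val_step q := by simp [masterPresentation, h, masterDFA]

theorem isSwap_masterPresentation (h : ρ x = some .b) :
    (masterPresentation n hn ρ).IsSwap x where
  mem := by simp [masterPresentation, h]
  val_step q := by
    simp only [masterPresentation, h, masterDFA, Option.elim, Equiv.swap_apply_def, Fin.ext_iff]
    split_ifs <;> rfl

theorem isMerge_masterPresentation (h : ρ x = some .c) :
    (masterPresentation n hn ρ).IsMerge x where
  mem := by simp [masterPresentation, h]
  val_step q := by
    have : q.val = n - 1 ↔ q.val + 1 = n := by omega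
    simp only [masterPresentation, h, masterDFA, Option.elim, this]
    split_ifs <;> rfl

theorem isNeutral_masterPresentation (h : ρ x = some .d) :
    (masterPresentation n hn ρ).IsNeutral x where
  mem := by simp [masterPresentation, h]
  step_eq q := by simp [masterPresentation, h, masterDFA]

theorem run_masterPresentation {v w : List Letter} (h : v.map ρ = w.map some) (q : Fin n) :
    (masterPresentation n hn ρ).run q v = (masterDFA n hn).evalFrom q w := by
  induction v generalizing w q with
  | nil =>
    obtain rfl : w = [] := by simpa using h.symm
    rfl
  | cons y v ih =>
    cases w with
    | nil => simp at h
    | cons l w =>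
      simp only [List.map_cons, List.cons.injEq] at h
      rw [Presentation.run_cons, DFA.evalFrom_cons, ← ih h.2]
      simp [masterPresentation, h.1]

/-- The hypothesis says that `π` and `ρ` are mutually inverse partial injections, so relabelling
words by `π` amounts to letting each new letter act as its preimage. -/
theorem dialect_master {π : Letter → Option Letter} (h : ∀ l y, π l = some y ↔ ρ y = some l) :
    dialect π (master n hn) = (masterPresentation n hn ρ).lang := by
  have hswap : ∀ v w : List Letter, w.map π = v.map some ↔ v.map ρ = w.map some := by
    intro v
    induction v with
    | nil => intro w; cases w <;> simp
    | cons y v ih => intro w; cases w <;> simp [ih, h]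
  ext v
  rw [Presentation.mem_lang]
  constructor
  · rintro ⟨w, hw, e⟩
    rw [hswap] at e
    refine ⟨fun y hy => ?_, ?_⟩
    · have := List.mem_map_of_mem (f := ρ) hy
      rw [e] at this
      obtain ⟨l, -, hl⟩ := List.mem_map.1 this
      simp [masterPresentation, ← hl]
    · rw [run_masterPresentation e]
      exact hw
  · rintro ⟨hv, hf⟩
    have : ∃ w : List Letter, v.map ρ = w.map some := by
      clear hf
      induction v with
      | nil => exact ⟨[], rfl⟩
      | cons y v ih =>
        obtain ⟨hy, hv⟩ := cons_mem_wordsOver.1 hv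
        obtain ⟨w, hw⟩ := ih hv
        obtain ⟨l, hl⟩ := Option.ne_none_iff_exists'.1 hy
        exact ⟨l :: w, by simp [hw, hl]⟩
    obtain ⟨w, e⟩ := this
    refine ⟨w, ?_, (hswap v w).2 e⟩
    rw [run_masterPresentation e] at hf
    exact hf

end Master

theorem isMinimalDFA_masterDFA (n : ℕ) (hn : 3 ≤ n) : IsMinimalDFA (masterDFA n hn) := by
  set P := masterPresentation n hn some
  have ha : P.IsCycle .a := isCycle_masterPresentation rfl
  have hP : P.IsStandard := isStandard_masterPresentation
  have hrun : ∀ q w, P.run q w = (masterDFA n hn).evalFrom q w := fun q w =>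
    run_masterPresentation rfl q
  have hall : ∀ w, w ∈ wordsOver P.letters := fun w y _ => by simp [P, masterPresentation]
  constructor
  · intro q
    obtain ⟨w, -, h⟩ := (ha.isMinimal hP.mem_final).reach q
    exact ⟨w, by rw [← h, hrun]; rfl⟩
  · intro p q h
    refine (ha.isMinimal hP.mem_final).injective ?_
    have : ∀ q, P.rightLang q = (masterDFA n hn).acceptsFrom q := by
      intro q
      ext w
      rw [Presentation.mem_rightLang, hrun, and_iff_right (hall w)]
      rfl
    rw [this, this, h]

/-! ### Syntactic semigroup -/

theorem toWord_mem {α : Type*} {A : Set α} (x : FreeSemigroup A) : toWord x ∈ wordsOver A := by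
  intro t ht
  obtain ⟨s, -, rfl⟩ := List.mem_map.1 ht
  exact s.2

theorem exists_toWord_eq {α : Type*} {A : Set α} {w : List α} (hw : w ∈ wordsOver A)
    (h : w ≠ []) : ∃ x : FreeSemigroup A, toWord x = w := by
  obtain ⟨y, v, rfl⟩ := List.exists_cons_of_ne_nil h
  obtain ⟨hy, hv⟩ := cons_mem_wordsOver.1 hw
  lift v to List A using hv
  exact ⟨⟨⟨y, hy⟩, v⟩, rfl⟩

theorem append_comm_of_subsingleton {α : Type*} {A : Set α} (hA : A.Subsingleton) {v w : List α}
    (hv : v ∈ wordsOver A) (hw : w ∈ wordsOver A) : v ++ w = w ++ v := by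
  refine List.ext_getElem (by simp [add_comm]) fun i h h' => hA ?_ ?_
  · exact append_mem_wordsOver.2 ⟨hv, hw⟩ _ (List.getElem_mem h)
  · exact append_mem_wordsOver.2 ⟨hw, hv⟩ _ (List.getElem_mem h')

namespace Presentation

variable {α : Type*} {n : ℕ} {P : Presentation α n} {a b c : α}

theorem IsMinimal.run_eq_of_rightLang (hP : P.IsMinimal) {v w : List α}
    (hv : v ∈ wordsOver P.letters) (hw : w ∈ wordsOver P.letters) (q : Fin n)
    (h : ∀ z ∈ wordsOver P.letters, v ++ z ∈ P.rightLang q ↔ w ++ z ∈ P.rightLang q) :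
    P.run q v = P.run q w := by
  refine hP.injective ?_
  ext z
  by_cases hz : z ∈ wordsOver P.letters
  · have := h z hz
    rwa [append_mem_rightLang, append_mem_rightLang, and_iff_right hv, and_iff_right hw] at this
  · exact ⟨fun h => absurd h.1 hz, fun h => absurd h.1 hz⟩

/-- Left contexts reach every state and right contexts separate states, so congruent words are those
inducing the same transformation. Thus the syntactic semigroup embeds into the `n ^ n` self-maps. -/
theorem IsMinimal.syntacticCon_iff (hP : P.IsMinimal) (x y : FreeSemigroup (alphabet P.lang)) :
    syntacticCon P.lang x y ↔ ∀ q, P.run q (toWord x) = P.run q (toWord y) := by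
  have hA : ∀ u, u ∈ wordsOver (alphabet P.lang) ↔ u ∈ wordsOver P.letters := fun u => by
    rw [hP.alphabet_lang]
  have hx := (hA _).1 (toWord_mem x)
  have hy := (hA _).1 (toWord_mem y)
  change (∀ u ∈ wordsOver (alphabet P.lang), ∀ v ∈ wordsOver (alphabet P.lang),
    (u ++ toWord x ++ v ∈ P.lang ↔ u ++ toWord y ++ v ∈ P.lang)) ↔ _
  constructor
  · intro h q
    obtain ⟨u, hu, rfl⟩ := hP.reach q
    refine hP.run_eq_of_rightLang hx hy _ fun z hz => ?_
    have := h u ((hA u).2 hu) z ((hA z).2 hz)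
    rwa [List.append_assoc, List.append_assoc, append_mem_lang, append_mem_lang,
      and_iff_right hu, and_iff_right hu] at this
  · intro h u hu v hv
    rw [List.append_assoc, List.append_assoc, append_mem_lang, append_mem_lang,
      append_mem_rightLang, append_mem_rightLang, h, and_iff_right hx, and_iff_right hy]

/-- The action of the syntactic semigroup on the states. -/
def IsMinimal.syntacticAction (hP : P.IsMinimal) : SyntacticSemigroup P.lang → (Fin n → Fin n) :=
  fun s => Con.liftOn s (fun x q => P.run q (toWord x)) fun x y h =>
    funext ((hP.syntacticCon_iff x y).1 h)

theorem IsMinimal.syntacticAction_injective (hP : P.IsMinimal) :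
    Function.Injective hP.syntacticAction := by
  intro s t h
  induction s using Con.induction_on with | _ x
  induction t using Con.induction_on with | _ y
  exact (Con.eq _).2 ((hP.syntacticCon_iff x y).2 fun q => congrFun h q)

theorem IsMinimal.syntacticComplexity_le (hP : P.IsMinimal) :
    syntacticComplexity P.lang ≤ ((n ^ n : ℕ) : ℕ∞) := by
  have := ENat.card_le_card_of_injective hP.syntacticAction_injective
  simpa [syntacticComplexity] using this

/-- An injection of the syntactic semigroup into the finite set of self-maps, with equal
cardinality, is onto. -/
theorem IsMinimal.exists_run_eq (hP : P.IsMinimal)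
    (h : syntacticComplexity P.lang = ((n ^ n : ℕ) : ℕ∞)) (f : Fin n → Fin n) :
    ∃ w ∈ wordsOver P.letters, ∀ q, P.run q w = f q := by
  have hr : Set.range hP.syntacticAction = Set.univ := by
    refine Set.Finite.eq_of_subset_of_encard_le' Set.finite_univ (Set.subset_univ _) ?_
    rw [← Set.image_univ, hP.syntacticAction_injective.encard_image, Set.encard_univ,
      Set.encard_univ]
    have : ENat.card (SyntacticSemigroup P.lang) = ((n ^ n : ℕ) : ℕ∞) := h
    rw [this]
    simp
  obtain ⟨s, hs⟩ : f ∈ Set.range hP.syntacticAction := hr ▸ Set.mem_univ f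
  induction s using Con.induction_on with | _ x
  exact ⟨toWord x, hP.alphabet_lang ▸ toWord_mem x, fun q => congrFun hs q⟩

theorem IsMinimal.syntacticComplexity_eq (hP : P.IsMinimal)
    (h : ∀ f : Fin n → Fin n, ∃ w ∈ wordsOver P.letters, w ≠ [] ∧ ∀ q, P.run q w = f q) :
    syntacticComplexity P.lang = ((n ^ n : ℕ) : ℕ∞) := by
  have hs : Function.Surjective hP.syntacticAction := by
    intro f
    obtain ⟨w, hw, hne, hf⟩ := h f
    rw [← hP.alphabet_lang] at hw
    obtain ⟨x, rfl⟩ := exists_toWord_eq hw hne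
    exact ⟨(x : SyntacticSemigroup P.lang), funext hf⟩
  have := ENat.card_congr (Equiv.ofBijective _ ⟨hP.syntacticAction_injective, hs⟩)
  rw [syntacticComplexity, this]
  simp

theorem injective_step_of_injective_run {w : List α} (h : Function.Injective fun q => P.run q w) :
    ∀ x ∈ w, Function.Injective fun q => P.step q x := by
  induction w with
  | nil => simp
  | cons y w ih =>
    have hc : (fun q => P.run q (y :: w)) = (fun q => P.run q w) ∘ fun q => P.step q y := rfl
    rw [hc] at h
    have hy : Function.Injective fun q => P.step q y := h.of_comp
    have hw := h.of_comp_right (Finite.injective_iff_surjective.1 hy)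
    rintro x (_ | ⟨_, hx⟩)
    · exact hy
    · exact ih hw x hx

/-- The full transformation monoid on at least three points is not generated by two elements. -/
theorem three_le_encard_letters (hn : 3 ≤ n)
    (h : ∀ f : Fin n → Fin n, ∃ w ∈ wordsOver P.letters, ∀ q, P.run q w = f q) :
    3 ≤ P.letters.encard := by
  by_contra! hlt
  -- Constant maps are not injective, so some letter is not injective either.
  obtain ⟨x, hx, hxi⟩ : ∃ x ∈ P.letters, ¬Function.Injective fun q => P.step q x := by
    by_contra! hall
    obtain ⟨w, hw, hf⟩ := h fun _ => ⟨0, by omega⟩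
    have hinj : ∀ w ∈ wordsOver P.letters, Function.Injective fun q => P.run q w := by
      intro w
      induction w with
      | nil => exact fun _ _ _ h => h
      | cons y w ih =>
        intro hw
        obtain ⟨hy, hw⟩ := cons_mem_wordsOver.1 hw
        exact (ih hw).comp (hall y hy)
    have := @hinj w hw ⟨0, by omega⟩ ⟨1, by omega⟩ (by simp only [hf])
    simp at this
  have hsub : (P.letters \ {x}).Subsingleton := by
    rw [← Set.encard_le_one_iff_subsingleton]
    have h1 := Set.encard_sdiff_singleton_add_one hx
    have h2 : (P.letters \ {x}).encard + 1 < 2 + 1 := by rw [h1]; exact hlt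
    have h3 : (P.letters \ {x}).encard < 1 + 1 := lt_of_add_lt_add_right h2
    exact Order.le_of_lt_add_one h3
  -- A word acting as a permutation cannot use `x`, so it is a power of the at most one remaining
  -- letter; any two such words commute.
  have hmem : ∀ w ∈ wordsOver P.letters, (Function.Injective fun q => P.run q w) →
      w ∈ wordsOver (P.letters \ {x}) := by
    intro w hw hi y hy
    refine ⟨hw y hy, ?_⟩
    rintro rfl
    exact hxi (injective_step_of_injective_run hi _ hy)
  let i0 : Fin n := ⟨0, by omega⟩
  let i1 : Fin n := ⟨1, by omega⟩
  let i2 : Fin n := ⟨2, by omega⟩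
  -- The transpositions `(0, 1)` and `(1, 2)` do not commute: they send `0` to different states in
  -- the two orders.
  obtain ⟨v, hv, hvf⟩ := h (Equiv.swap i0 i1)
  obtain ⟨w, hw, hwf⟩ := h (Equiv.swap i1 i2)
  have hvi : Function.Injective fun q => P.run q v := by
    simpa only [hvf] using (Equiv.swap i0 i1).injective
  have hwi : Function.Injective fun q => P.run q w := by
    simpa only [hwf] using (Equiv.swap i1 i2).injective
  have hcomm := append_comm_of_subsingleton hsub (hmem v hv hvi) (hmem w hw hwi)
  have := congrArg (P.run i0) hcomm
  rw [run_append, run_append, hvf, hwf, hwf, hvf, Equiv.swap_apply_left, Equiv.swap_apply_left,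
    Equiv.swap_apply_of_ne_of_ne (a := i1) (b := i2) (x := i0) (by simp [i0, i1])
      (by simp [i0, i2]), Equiv.swap_apply_left] at this
  simp [i1, i2] at this

theorem IsCycle.complexity_of_mem_quotients (ha : P.IsCycle a)
    (hP : ∀ q, q ∈ P.final ↔ q.val + 1 = n) {K : Language α} (hK : K ∈ quotients P.lang) :
    complexity K = n := by
  rw [(ha.isMinimal hP).quotients_lang] at hK
  obtain ⟨q, rfl⟩ := hK
  let Q : Presentation α n := { P with start := q }
  have hQ : Q.IsCycle a := ⟨ha.mem, ha.val_step⟩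
  exact (hQ.isMinimal hP).complexity_lang

/-! ### Reversal -/

theorem encard_univ_set (n : ℕ) : (Set.univ : Set (Set (Fin n))).encard = ((2 ^ n : ℕ) : ℕ∞) := by
  rw [Set.encard_univ, ENat.card_eq_coe_fintype_card, Fintype.card_set, Fintype.card_fin]

/-- The words whose reverse leads from the initial state into `T`. -/
def reverseLang (P : Presentation α n) (T : Set (Fin n)) : Language α :=
  {v | v ∈ wordsOver P.letters ∧ P.run P.start v.reverse ∈ T}

theorem leftQuotient_reverse {w : List α} (hw : w ∈ wordsOver P.letters) :
    P.lang.reverse.leftQuotient w = P.reverseLang {q | P.run q w.reverse ∈ P.final} := by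
  ext v
  rw [Language.mem_leftQuotient, Language.mem_reverse, List.reverse_append, mem_lang,
    append_mem_wordsOver, reverse_mem_wordsOver, reverse_mem_wordsOver, run_append]
  exact ⟨fun h => ⟨h.1.1, h.2⟩, fun h => ⟨⟨h.1, hw⟩, h.2⟩⟩

theorem alphabet_reverse (L : Language α) : alphabet L.reverse = alphabet L := by
  have : ∀ L : Language α, alphabet L ⊆ alphabet L.reverse := by
    rintro L x ⟨w, hw, hx⟩
    exact ⟨w.reverse, by simpa using hw, by simpa using hx⟩
  refine (this L).antisymm' ?_
  simpa using this L.reverse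

theorem IsMinimal.complexity_reverse_le (hP : P.IsMinimal) :
    complexity P.lang.reverse ≤ ((2 ^ n : ℕ) : ℕ∞) := by
  rw [← encard_univ_set]
  refine complexity_le P.reverseLang _ fun w hw => ?_
  rw [alphabet_reverse, hP.alphabet_lang] at hw
  exact ⟨_, Set.mem_univ _, leftQuotient_reverse hw⟩

/-- All transformations of the states are induced by nonempty words. -/
def IsFull (P : Presentation α n) : Prop :=
  ∀ f : Fin n → Fin n, ∃ w ∈ wordsOver P.letters, w ≠ [] ∧ ∀ q, P.run q w = f q

/-- Send `T` to the final state `n - 1` and everything else to `0`. This is the source of all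
separating words for reversal and atoms. -/
theorem IsFull.exists_run_mem_final_iff (hf : P.IsFull) (hn : 3 ≤ n) (hS : P.IsStandard)
    (T : Set (Fin n)) : ∃ w ∈ wordsOver P.letters, ∀ q, P.run q w ∈ P.final ↔ q ∈ T := by
  classical
  obtain ⟨w, hw, -, h⟩ := hf fun q => if q ∈ T then ⟨n - 1, by omega⟩ else ⟨0, by omega⟩
  refine ⟨w, hw, fun q => ?_⟩
  rw [h, hS.mem_final]
  split_ifs with hq
  · simp only [hq, iff_true]
    omega
  · simp only [hq, iff_false]
    omega

/-- A quotient of the reverse is given by the set of states from which a word is accepted, and every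
set arises so. Different sets differ at a state `q`, and the reversal of a word leading to `q` tells
them apart. -/
theorem IsMinimal.complexity_reverse (hP : P.IsMinimal) (hn : 3 ≤ n) (hS : P.IsStandard)
    (hf : P.IsFull) : complexity P.lang.reverse = ((2 ^ n : ℕ) : ℕ∞) := by
  refine le_antisymm hP.complexity_reverse_le ?_
  rw [← encard_univ_set]
  refine le_complexity P.reverseLang _ (fun T _ => ?_) ?_
  · obtain ⟨w, hw, h⟩ := hf.exists_run_mem_final_iff hn hS T
    refine ⟨w.reverse, ?_, ?_⟩
    · rwa [alphabet_reverse, hP.alphabet_lang, reverse_mem_wordsOver]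
    · rw [leftQuotient_reverse (reverse_mem_wordsOver.2 hw), List.reverse_reverse]
      congr 1
      ext q
      exact h q
  · intro T _ T' _ h
    ext q
    obtain ⟨w, hw, rfl⟩ := hP.reach q
    have : ∀ T, w.reverse ∈ P.reverseLang T ↔ P.run P.start w ∈ T := by
      intro T
      change _ ∧ _ ↔ _
      rw [reverse_mem_wordsOver, and_iff_right hw, List.reverse_reverse]
    rw [← this, ← this, h]

end Presentation

theorem complexity_le_of_mem_quotients {α : Type*} {L K : Language α} (hK : K ∈ quotients L) :
    complexity K ≤ complexity L := by
  obtain ⟨v, hv, rfl⟩ := hK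
  refine Set.encard_le_encard ?_
  rintro _ ⟨w, hw, rfl⟩
  refine ⟨v ++ w, append_mem_wordsOver.2 ⟨hv, wordsOver_mono (alphabet_leftQuotient L v) hw⟩, ?_⟩
  rw [Language.leftQuotient_append]

/-! ### Atoms: counting pairs of sets, and the complexity of atoms -/

section Counting

variable {n : ℕ}

/-- The pairs of disjoint subsets with at least one and at most `k`, respectively `n - k`,
elements. -/
def disjointPairs (n k : ℕ) : Finset (Finset (Fin n) × Finset (Fin n)) :=
  Finset.univ.filter fun p => Disjoint p.1 p.2 ∧ p.1.card ∈ Finset.Icc 1 k ∧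
    p.2.card ∈ Finset.Icc 1 (n - k)

theorem mem_disjointPairs {k : ℕ} {p : Finset (Fin n) × Finset (Fin n)} :
    p ∈ disjointPairs n k ↔ Disjoint p.1 p.2 ∧ p.1.card ∈ Finset.Icc 1 k ∧
      p.2.card ∈ Finset.Icc 1 (n - k) := by
  simp [disjointPairs]

theorem card_disjoint_card_eq (n x y : ℕ) :
    (Finset.univ.filter fun p : Finset (Fin n) × Finset (Fin n) =>
      Disjoint p.1 p.2 ∧ p.1.card = x ∧ p.2.card = y).card
      = n.choose x * (n - x).choose y := by
  have : ((Finset.powersetCard x (Finset.univ : Finset (Fin n))).sigma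
      fun X => Finset.powersetCard y Xᶜ).card = n.choose x * (n - x).choose y := by
    rw [Finset.card_sigma, Finset.sum_congr rfl (g := fun _ => (n - x).choose y)]
    · simp
    · intro X hX
      rw [Finset.card_powersetCard, Finset.card_compl, Fintype.card_fin,
        (Finset.mem_powersetCard.1 hX).2]
  rw [← this]
  refine Finset.card_nbij' (fun p => ⟨p.1, p.2⟩) (fun p => (p.1, p.2)) ?_ ?_ ?_ ?_
  · intro p hp
    simp only [Finset.coe_filter, Finset.mem_univ, true_and, Set.mem_ofPred_eq] at hp
    simp only [Finset.coe_sigma, Set.mem_sigma_iff, Finset.mem_coe, Finset.mem_powersetCard,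
      Finset.subset_univ, true_and]
    exact ⟨hp.2.1, (Finset.subset_compl_iff_disjoint_left).2 hp.1, hp.2.2⟩
  · intro p hp
    simp only [Finset.coe_sigma, Set.mem_sigma_iff, Finset.mem_coe, Finset.mem_powersetCard,
      Finset.subset_univ, true_and] at hp
    simp only [Finset.coe_filter, Finset.mem_univ, true_and, Set.mem_ofPred_eq]
    exact ⟨(Finset.subset_compl_iff_disjoint_left).1 hp.2.1, hp.1, hp.2.2⟩
  · intro p _; rfl
  · intro p _; rfl

theorem card_disjointPairs (n k : ℕ) : (disjointPairs n k).card =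
    ∑ x ∈ Finset.Icc 1 k, ∑ y ∈ Finset.Icc 1 (n - k), n.choose x * (n - x).choose y := by
  rw [Finset.card_eq_sum_card_fiberwise (f := fun p => p.1.card) (t := Finset.Icc 1 k)
    fun p hp => (mem_disjointPairs.1 hp).2.1]
  refine Finset.sum_congr rfl fun x hx => ?_
  rw [Finset.card_eq_sum_card_fiberwise (f := fun p => p.2.card) (t := Finset.Icc 1 (n - k))
    fun p hp => (mem_disjointPairs.1 (Finset.mem_filter.1 hp).1).2.2]
  refine Finset.sum_congr rfl fun y hy => ?_
  rw [← card_disjoint_card_eq]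
  congr 1
  ext p
  simp only [Finset.mem_filter, mem_disjointPairs, Finset.mem_univ, true_and]
  constructor
  · rintro ⟨⟨⟨h, -⟩, rfl⟩, rfl⟩
    exact ⟨h, rfl, rfl⟩
  · rintro ⟨h, rfl, rfl⟩
    exact ⟨⟨⟨h, hx, hy⟩, rfl⟩, rfl⟩

/-- The pairs of sets of states that describe the quotients of an atom in which `S` is the set of
uncomplemented quotients; the pair `(univ, univ)` stands for the empty quotient. -/
def atomPairs (S : Finset (Fin n)) : Finset (Finset (Fin n) × Finset (Fin n)) :=
  if S = ∅ then (Finset.univ.erase ∅).image (Prod.mk ∅)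
  else if S = Finset.univ then
    (Finset.univ.erase ∅).image fun X => (X, ∅)
  else insert (Finset.univ, Finset.univ) (disjointPairs n S.card)

theorem card_atomPairs (hn : 3 ≤ n) (S : Finset (Fin n)) :
    (atomPairs S).card = atomBound n S.card := by
  have hpow : ((Finset.univ : Finset (Finset (Fin n))).erase ∅).card = 2 ^ n - 1 := by
    rw [Finset.card_erase_of_mem (Finset.mem_univ _)]
    simp
  have hu : S = Finset.univ ↔ S.card = n := by
    rw [← Finset.card_eq_iff_eq_univ, Fintype.card_fin]
  simp only [atomPairs, atomBound, Finset.card_eq_zero, ← hu]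
  split_ifs with h h' h' h' h'
  · rw [Finset.card_image_of_injective _ (Prod.mk_right_injective _), hpow]
  · exact absurd (Or.inl h) h'
  · rw [Finset.card_image_of_injective _ (Prod.mk_left_injective _), hpow]
  · exact absurd (Or.inr (by assumption)) h'
  · tauto
  · rw [Finset.card_insert_of_notMem, card_disjointPairs, add_comm]
    intro hmem
    have := (mem_disjointPairs.1 hmem).1
    simp only [disjoint_self, Finset.bot_eq_empty, Finset.univ_eq_empty_iff] at this
    exact this.false ⟨0, by omega⟩

end Counting

namespace Presentation

variable {α : Type*} {n : ℕ} {P : Presentation α n} {a b c : α}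

/-- The words that lead exactly the states in `S` to final states. -/
def atom (P : Presentation α n) (S : Finset (Fin n)) : Language α :=
  {w | w ∈ wordsOver P.letters ∧ ∀ q, P.run q w ∈ P.final ↔ q ∈ S}

/-- The words that lead all states in `p.1` and no state in `p.2` to final states. -/
def separatingLang (P : Presentation α n) (p : Finset (Fin n) × Finset (Fin n)) : Language α :=
  {w | w ∈ wordsOver P.letters ∧ (∀ q ∈ p.1, P.run q w ∈ P.final) ∧ ∀ q ∈ p.2, P.run q w ∉ P.final}

-- Under the bijection between states and quotients, an atomic intersection collects the words whose
-- set of accepting states is exactly `S'`.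
open Classical in
theorem IsMinimal.atomicIntersection_eq (hP : P.IsMinimal) {S : Set (Language α)}
    (hS : S ⊆ quotients P.lang) : ∃ S' : Finset (Fin n), P.rightLang '' S' = S ∧
      atomicIntersection P.lang S = P.atom S' ∧ S'.card = S.ncard := by
  rw [hP.quotients_lang] at hS
  refine ⟨Finset.univ.filter fun q => P.rightLang q ∈ S, ?_⟩
  have h1 : P.rightLang '' (Finset.univ.filter fun q => P.rightLang q ∈ S : Finset (Fin n)) =
      S := by
    ext K
    simp only [Finset.coe_filter, Finset.mem_univ, true_and, Set.mem_image, Set.mem_ofPred_eq]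
    constructor
    · rintro ⟨q, hq, rfl⟩
      exact hq
    · intro hK
      obtain ⟨q, rfl⟩ := hS hK
      exact ⟨q, hK, rfl⟩
  refine ⟨h1, ?_, ?_⟩
  · ext w
    change (w ∈ wordsOver (alphabet P.lang) ∧ (∀ K ∈ S, w ∈ K) ∧
      ∀ K ∈ quotients P.lang \ S, w ∉ K) ↔ (w ∈ wordsOver P.letters ∧ _)
    rw [hP.alphabet_lang, hP.quotients_lang]
    refine and_congr_right fun hw => ?_
    simp only [Finset.mem_filter, Finset.mem_univ, true_and]
    constructor
    · rintro ⟨hs, ht⟩ q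
      constructor
      · intro hf
        by_contra hq
        exact ht _ ⟨⟨q, rfl⟩, hq⟩ ⟨hw, hf⟩
      · exact fun hq => (hs _ hq).2
    · intro h
      constructor
      · intro K hK
        obtain ⟨q, rfl⟩ := hS hK
        exact ⟨hw, (h q).2 hK⟩
      · rintro _ ⟨⟨q, rfl⟩, hq⟩ hm
        exact hq ((h q).1 hm.2)
  · conv_rhs => rw [← h1]
    rw [Set.ncard_image_of_injective _ hP.injective, Set.ncard_coe_finset]

theorem IsMinimal.encard_atoms_le (hP : P.IsMinimal) :
    (atoms P.lang).encard ≤ ((2 ^ n : ℕ) : ℕ∞) := by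
  have : atoms P.lang ⊆ P.atom '' Set.univ := by
    rintro A ⟨S, hS, rfl, -⟩
    obtain ⟨S', -, h, -⟩ := hP.atomicIntersection_eq hS
    exact ⟨S', trivial, h.symm⟩
  refine (Set.encard_le_encard this).trans ((Set.encard_image_le _ _).trans ?_)
  simp [Set.encard_univ]

theorem IsMinimal.encard_atoms (hP : P.IsMinimal) (hn : 3 ≤ n) (hS : P.IsStandard)
    (hf : P.IsFull) : (atoms P.lang).encard = ((2 ^ n : ℕ) : ℕ∞) := by
  refine le_antisymm hP.encard_atoms_le ?_
  have hne : ∀ T : Finset (Fin n), ∃ w, w ∈ P.atom T := fun T => by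
    obtain ⟨w, hw, h⟩ := hf.exists_run_mem_final_iff hn hS T
    exact ⟨w, hw, h⟩
  have hinj : Function.Injective P.atom := by
    intro T T' h
    obtain ⟨w, hw⟩ := hne T
    have hw' := hw
    rw [h] at hw'
    ext q
    rw [← hw.2, ← hw'.2]
  have hsub : P.atom '' Set.univ ⊆ atoms P.lang := by
    rintro _ ⟨T, -, rfl⟩
    have hq : P.rightLang '' T ⊆ quotients P.lang := by
      rw [hP.quotients_lang]
      exact Set.image_subset_range _ _
    refine ⟨P.rightLang '' T, hq, ?_, hne T⟩
    obtain ⟨T', h1, h2, -⟩ := hP.atomicIntersection_eq hq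
    rw [h2, Finset.coe_injective (hP.injective.image_injective h1)]
  refine le_trans (le_of_eq ?_) (Set.encard_le_encard hsub)
  rw [hinj.encard_image, Set.encard_univ]
  simp

/-- Reading `w` pushes `S` and its complement forward; a continuation must be accepted from the
first image everywhere and from the second one nowhere. -/
theorem leftQuotient_atom (S : Finset (Fin n)) {w : List α} (hw : w ∈ wordsOver P.letters) :
    (P.atom S).leftQuotient w = P.separatingLang
      (S.image fun q => P.run q w, Sᶜ.image fun q => P.run q w) := by
  ext v
  rw [Language.mem_leftQuotient]
  change (_ ∧ _) ↔ (_ ∧ _ ∧ _)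
  simp only [append_mem_wordsOver, and_iff_right hw, run_append, Finset.forall_mem_image,
    Finset.mem_compl, ← forall_and]
  refine and_congr_right fun _ => forall_congr' fun q => ?_
  tauto

theorem separatingLang_of_not_disjoint {p : Finset (Fin n) × Finset (Fin n)}
    (h : ¬Disjoint p.1 p.2) : P.separatingLang p = 0 := by
  rw [Finset.not_disjoint_iff] at h
  obtain ⟨q, h1, h2⟩ := h
  ext w
  exact ⟨fun hw => absurd (hw.2.1 q h1) (hw.2.2 q h2), fun hw => absurd hw (Language.notMem_zero w)⟩

theorem alphabet_atom_subset (S : Finset (Fin n)) : alphabet (P.atom S) ⊆ P.letters :=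
  alphabet_subset fun _ h => h.1

/-- Images of `S` and of its complement do not grow, and nonempty sets stay nonempty. If the images
meet, the quotient is empty, which is the one extra pair `(univ, univ)`. -/
theorem complexity_atom_le (hn : 3 ≤ n) (S : Finset (Fin n)) :
    complexity (P.atom S) ≤ (atomBound n S.card : ℕ∞) := by
  rw [← card_atomPairs hn, ← Set.encard_coe_eq_coe_finsetCard]
  refine complexity_le P.separatingLang _ fun w hw => ?_
  replace hw := wordsOver_mono (alphabet_atom_subset S) hw
  rw [leftQuotient_atom S hw, atomPairs]
  split_ifs with h h'
  · subst h
    refine ⟨_, ?_, rfl⟩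
    simp only [Finset.image_empty, Finset.compl_empty, Finset.coe_image, Set.mem_image,
      Finset.mem_coe, Prod.mk.injEq, true_and, exists_eq_right,
      Finset.mem_erase, Finset.mem_univ, and_true, ne_eq, Finset.image_eq_empty]
    exact fun h => Finset.notMem_empty _ (h ▸ Finset.mem_univ (⟨0, by omega⟩ : Fin n))
  · subst h'
    refine ⟨_, ?_, rfl⟩
    simp only [Finset.image_empty, Finset.compl_univ, Finset.coe_image, Set.mem_image,
      Finset.mem_coe, Prod.mk.injEq, and_true, exists_eq_right,
      Finset.mem_erase, Finset.mem_univ, ne_eq, Finset.image_eq_empty]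
    exact h
  · by_cases hd : Disjoint (S.image fun q => P.run q w) (Sᶜ.image fun q => P.run q w)
    · refine ⟨_, ?_, rfl⟩
      rw [Finset.coe_insert, Set.mem_insert_iff, Finset.mem_coe, mem_disjointPairs]
      refine Or.inr ⟨hd, ?_, ?_⟩
      · rw [Finset.mem_Icc, Nat.one_le_iff_ne_zero, ne_eq, Finset.card_eq_zero,
          Finset.image_eq_empty]
        exact ⟨h, Finset.card_image_le⟩
      · rw [Finset.mem_Icc, Nat.one_le_iff_ne_zero, ne_eq, Finset.card_eq_zero,
          Finset.image_eq_empty, Finset.compl_eq_empty_iff]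
        refine ⟨h', Finset.card_image_le.trans ?_⟩
        rw [Finset.card_compl, Fintype.card_fin]
    · refine ⟨(Finset.univ, Finset.univ), by simp, ?_⟩
      rw [separatingLang_of_not_disjoint hd, separatingLang_of_not_disjoint]
      rw [disjoint_self, Finset.bot_eq_empty]
      exact fun (h : (Finset.univ : Finset (Fin n)) = ∅) =>
        Finset.notMem_empty _ (h ▸ Finset.mem_univ (⟨0, by omega⟩ : Fin n))

theorem exists_image_eq {S X : Finset (Fin n)} (hX : X.Nonempty) (h : X.card ≤ S.card) :
    ∃ f : Fin n → Fin n, S.image f = X := by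
  classical
  obtain ⟨S', hS', hc⟩ := Finset.exists_subset_card_eq h
  obtain ⟨x, hx⟩ := hX
  let e := Finset.equivOfCardEq hc
  refine ⟨fun q => if hq : q ∈ S' then e ⟨q, hq⟩ else x, ?_⟩
  ext y
  simp only [Finset.mem_image]
  constructor
  · rintro ⟨q, -, rfl⟩
    split_ifs with hq
    · exact (e ⟨q, hq⟩).2
    · exact hx
  · intro hy
    refine ⟨e.symm ⟨y, hy⟩, hS' (e.symm ⟨y, hy⟩).2, ?_⟩
    simp

theorem exists_image_eq_image_compl_eq {S X Y : Finset (Fin n)} (hX : X.card ≤ S.card)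
    (hY : Y.card ≤ Sᶜ.card) (hX' : X = ∅ ↔ S = ∅) (hY' : Y = ∅ ↔ Sᶜ = ∅) :
    ∃ f : Fin n → Fin n, S.image f = X ∧ Sᶜ.image f = Y := by
  classical
  have key : ∀ {S X : Finset (Fin n)}, X.card ≤ S.card → (X = ∅ ↔ S = ∅) →
      ∃ f : Fin n → Fin n, S.image f = X := by
    intro S X h h'
    rcases X.eq_empty_or_nonempty with rfl | hne
    · exact ⟨id, by simp [h'.1 rfl]⟩
    · exact exists_image_eq hne h
  obtain ⟨f, hf⟩ := key hX hX'
  obtain ⟨g, hg⟩ := key hY hY'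
  refine ⟨fun q => if q ∈ S then f q else g q, ?_, ?_⟩
  · rw [← hf]
    exact Finset.image_congr fun q hq => by simp only [if_pos (Finset.mem_coe.1 hq)]
  · rw [← hg]
    exact Finset.image_congr fun q hq => by
      simp only [if_neg (Finset.mem_compl.1 (Finset.mem_coe.1 hq))]

/-- The alphabet of an atom could be smaller than that of the language. If `x` separates `p` from
`q`, then a word sending `S` to `p` and the rest to `q`, then `x`, then a word accepted from `p · x`
only, lies in the atom. -/
theorem IsFull.alphabet_atom (hf : P.IsFull) (hn : 3 ≤ n) (hS : P.IsStandard)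
    (hx : ∀ x ∈ P.letters, ∃ p q, P.step p x ≠ P.step q x) (S : Finset (Fin n)) :
    alphabet (P.atom S) = P.letters := by
  refine (alphabet_atom_subset S).antisymm fun x hxl => ?_
  obtain ⟨p, q, hpq⟩ := hx x hxl
  obtain ⟨u, hu, -, huf⟩ := hf fun r => if r ∈ S then p else q
  obtain ⟨v, hv, hvf⟩ := hf.exists_run_mem_final_iff hn hS {P.step p x}
  refine ⟨u ++ x :: v, ⟨append_mem_wordsOver.2 ⟨hu, cons_mem_wordsOver.2 ⟨hxl, hv⟩⟩,
    fun r => ?_⟩, by simp⟩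
  rw [run_append, run_cons, hvf, huf, Set.mem_singleton_iff]
  split_ifs with hr
  · simp [hr]
  · simp [hr, hpq.symm]

/-- A word accepted exactly from the first set bounds the other first set, and a word rejected
exactly from the second set bounds the other second set. Disjointness puts both words into the
language. -/
theorem IsFull.separatingLang_injOn (hf : P.IsFull) (hn : 3 ≤ n) (hS : P.IsStandard) :
    Set.InjOn P.separatingLang {p | Disjoint p.1 p.2} := by
  have key : ∀ p p' : Finset (Fin n) × Finset (Fin n), Disjoint p.1 p.2 →
      P.separatingLang p = P.separatingLang p' → p'.1 ⊆ p.1 ∧ p'.2 ⊆ p.2 := by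
    intro p p' hd h
    constructor
    · obtain ⟨w, hw, hwf⟩ := hf.exists_run_mem_final_iff hn hS p.1
      have hm : w ∈ P.separatingLang p := ⟨hw, fun q hq => (hwf q).2 hq, fun q hq hq' =>
        Finset.disjoint_left.1 hd ((hwf q).1 hq') hq⟩
      rw [h] at hm
      exact fun q hq => (hwf q).1 (hm.2.1 q hq)
    · obtain ⟨w, hw, hwf⟩ := hf.exists_run_mem_final_iff hn hS (p.2 : Set (Fin n))ᶜ
      have hm : w ∈ P.separatingLang p := ⟨hw, fun q hq => (hwf q).2 fun hq' =>
        Finset.disjoint_left.1 hd hq hq', fun q hq hq' => (hwf q).1 hq' hq⟩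
      rw [h] at hm
      intro q hq
      by_contra hq'
      exact hm.2.2 q hq ((hwf q).2 hq')
  intro p hp p' hp' h
  obtain ⟨h1, h2⟩ := key p p' hp h
  obtain ⟨h3, h4⟩ := key p' p hp' h.symm
  exact Prod.ext (h3.antisymm h1) (h4.antisymm h2)

theorem IsFull.separatingLang_ne_zero (hf : P.IsFull) (hn : 3 ≤ n) (hS : P.IsStandard)
    {p : Finset (Fin n) × Finset (Fin n)} (hd : Disjoint p.1 p.2) : P.separatingLang p ≠ 0 := by
  intro h
  obtain ⟨w, hw, hwf⟩ := hf.exists_run_mem_final_iff hn hS p.1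
  have hm : w ∈ P.separatingLang p := ⟨hw, fun q hq => (hwf q).2 hq, fun q hq hq' =>
    Finset.disjoint_left.1 hd ((hwf q).1 hq') hq⟩
  rw [h] at hm
  exact Language.notMem_zero w hm

theorem IsFull.complexity_atom (hf : P.IsFull) (hn : 3 ≤ n) (hS : P.IsStandard)
    (hx : ∀ x ∈ P.letters, ∃ p q, P.step p x ≠ P.step q x) (S : Finset (Fin n)) :
    complexity (P.atom S) = (atomBound n S.card : ℕ∞) := by
  refine le_antisymm (complexity_atom_le hn S) ?_
  rw [← card_atomPairs hn, ← Set.encard_coe_eq_coe_finsetCard]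
  have huniv : (Finset.univ : Finset (Fin n)) ≠ ∅ :=
    fun h => Finset.notMem_empty _ (h ▸ Finset.mem_univ (⟨0, by omega⟩ : Fin n))
  have hcompl : Sᶜ.card = n - S.card := by rw [Finset.card_compl, Fintype.card_fin]
  have hreach : ∀ X Y : Finset (Fin n), X.card ≤ S.card → Y.card ≤ Sᶜ.card → (X = ∅ ↔ S = ∅) →
      (Y = ∅ ↔ Sᶜ = ∅) → ∃ w ∈ wordsOver (alphabet (P.atom S)),
        (P.atom S).leftQuotient w = P.separatingLang (X, Y) := by
    intro X Y h1 h2 h3 h4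
    obtain ⟨f, hX, hY⟩ := exists_image_eq_image_compl_eq h1 h2 h3 h4
    obtain ⟨w, hw, -, hwf⟩ := hf f
    refine ⟨w, by rwa [hf.alphabet_atom hn hS hx], ?_⟩
    rw [leftQuotient_atom S hw]
    simp only [hwf, hX, hY]
  refine le_complexity P.separatingLang _ ?_ ?_
  · rintro ⟨X, Y⟩ hp
    rw [Finset.mem_coe, atomPairs] at hp
    split_ifs at hp with h h'
    · simp only [Finset.mem_image, Finset.mem_erase, Finset.mem_univ, and_true,
        Prod.mk.injEq] at hp
      obtain ⟨Z, hZ, rfl, rfl⟩ := hp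
      subst h
      refine hreach _ _ (by simp) (by simpa using Finset.card_le_univ Z) (by simp) ?_
      simp only [Finset.compl_empty, huniv, iff_false]
      exact hZ
    · simp only [Finset.mem_image, Finset.mem_erase, Finset.mem_univ, and_true,
        Prod.mk.injEq] at hp
      obtain ⟨Z, hZ, rfl, rfl⟩ := hp
      subst h'
      refine hreach _ _ (Finset.card_le_univ Z) (by simp) ?_ (by simp)
      simp only [huniv, iff_false]
      exact hZ
    · have hc : Sᶜ ≠ ∅ := by rwa [ne_eq, Finset.compl_eq_empty_iff]
      rcases Finset.mem_insert.1 hp with hp | hp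
      · obtain ⟨rfl, rfl⟩ := Prod.mk.inj hp
        -- Collapsing all states to `0` makes the two images meet, which yields the empty quotient.
        obtain ⟨w, hw, hq⟩ := hreach {⟨0, by omega⟩} {⟨0, by omega⟩}
          (by simpa [Nat.one_le_iff_ne_zero] using h)
          (by rw [Finset.card_singleton, Nat.one_le_iff_ne_zero, ne_eq, Finset.card_eq_zero]
              exact hc)
          (by simp [h]) (by simp only [hc, iff_false]; simp)
        refine ⟨w, hw, ?_⟩
        rw [hq, separatingLang_of_not_disjoint (by simp), separatingLang_of_not_disjoint]
        rwa [disjoint_self, Finset.bot_eq_empty]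
      · obtain ⟨-, hX, hY⟩ := mem_disjointPairs.1 hp
        rw [Finset.mem_Icc] at hX hY
        refine hreach X Y hX.2 (hcompl ▸ hY.2) ?_ ?_
        · simp only [h, iff_false]
          rintro rfl
          simp at hX
        · simp only [hc, iff_false]
          rintro rfl
          simp at hY
  · rw [atomPairs]
    split_ifs with h h'
    · refine (hf.separatingLang_injOn hn hS).mono ?_
      rintro _ hp
      obtain ⟨Z, -, rfl⟩ := Finset.mem_image.1 (Finset.mem_coe.1 hp)
      exact Finset.disjoint_empty_left _
    · refine (hf.separatingLang_injOn hn hS).mono ?_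
      rintro _ hp
      obtain ⟨Z, -, rfl⟩ := Finset.mem_image.1 (Finset.mem_coe.1 hp)
      exact Finset.disjoint_empty_right _
    · have hd : ∀ p ∈ disjointPairs n S.card, Disjoint p.1 p.2 := fun p hp =>
        (mem_disjointPairs.1 hp).1
      have h0 : P.separatingLang (Finset.univ, Finset.univ) = 0 := by
        refine separatingLang_of_not_disjoint ?_
        rwa [disjoint_self, Finset.bot_eq_empty]
      intro p hp p' hp' he
      rcases Finset.mem_insert.1 (Finset.mem_coe.1 hp) with rfl | hp <;>
        rcases Finset.mem_insert.1 (Finset.mem_coe.1 hp') with rfl | hp'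
      · rfl
      · rw [h0] at he
        exact absurd he.symm (hf.separatingLang_ne_zero hn hS (hd _ hp'))
      · rw [h0] at he
        exact absurd he (hf.separatingLang_ne_zero hn hS (hd _ hp))
      · exact hf.separatingLang_injOn hn hS (hd _ hp) (hd _ hp') he

end Presentation

/-! ### Star -/

section Counting

variable {n : ℕ}

theorem encard_powerset_fin (A : Set (Fin n)) : (𝒫 A).encard = ((2 ^ A.ncard : ℕ) : ℕ∞) := by
  classical
  have : Fintype A := Fintype.ofFinite A
  rw [Set.encard, ENat.card_congr (Equiv.Set.powerset A), ENat.card_eq_coe_fintype_card,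
    Fintype.card_set, ← Nat.card_eq_fintype_card]
  rfl

theorem encard_setOf_mem (s : Fin n) : {S : Set (Fin n) | s ∈ S}.encard
    = ((2 ^ (n - 1) : ℕ) : ℕ∞) := by
  have h : {S : Set (Fin n) | s ∈ S} = compl '' 𝒫 {s}ᶜ := by
    ext S
    simp only [Set.mem_ofPred_eq, Set.mem_image, Set.mem_powerset_iff]
    constructor
    · intro h
      exact ⟨Sᶜ, by simpa using h, compl_compl S⟩
    · rintro ⟨T, h, rfl⟩
      exact fun hs => h hs rfl
  rw [h, compl_injective.encard_image, encard_powerset_fin, Set.ncard_compl, Set.ncard_singleton,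
    Nat.card_eq_fintype_card, Fintype.card_fin]

/-- Either `s` belongs to the set, or both `s` and `f` are missing. The empty set is counted; it
will stand for the star itself, the quotient by the empty word. -/
theorem encard_setOf_mem_imp {s f : Fin n} (hsf : f ≠ s) :
    {S : Set (Fin n) | f ∈ S → s ∈ S}.encard = ((2 ^ (n - 1) + 2 ^ (n - 2) : ℕ) : ℕ∞) := by
  have h : {S : Set (Fin n) | f ∈ S → s ∈ S} = {S | s ∈ S} ∪ 𝒫 ({f, s} : Set (Fin n))ᶜ := by
    ext S
    have : S ⊆ ({f, s} : Set (Fin n))ᶜ ↔ f ∉ S ∧ s ∉ S := by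
      rw [Set.subset_compl_comm, Set.insert_subset_iff, Set.singleton_subset_iff]
      rfl
    simp only [Set.mem_ofPred_eq, Set.mem_union, Set.mem_powerset_iff, this]
    tauto
  rw [h, Set.encard_union_eq, encard_setOf_mem, encard_powerset_fin, Set.ncard_compl,
    Set.ncard_pair hsf, Nat.card_eq_fintype_card, Fintype.card_fin]
  · norm_cast
  · rw [Set.disjoint_left]
    intro S hs hS
    exact hS hs (Or.inr rfl)

end Counting

theorem append_mem_kstar {α : Type*} {L : Language α} {u v : List α} (hu : u ∈ L∗) (hv : v ∈ L) :
    u ++ v ∈ L∗ := by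
  obtain ⟨l, rfl, hl⟩ := Language.mem_kstar.1 hu
  refine Language.mem_kstar.2 ⟨l ++ [v], by simp, fun y hy => ?_⟩
  rcases List.mem_append.1 hy with h | h
  · exact hl y h
  · exact List.mem_singleton.1 h ▸ hv

theorem append_mem_kstar_of_mem {α : Type*} {L : Language α} {u v : List α} (hu : u ∈ L∗)
    (hv : v ∈ L∗) : u ++ v ∈ L∗ := by
  obtain ⟨l, rfl, hl⟩ := Language.mem_kstar.1 hu
  obtain ⟨m, rfl, hm⟩ := Language.mem_kstar.1 hv
  refine Language.mem_kstar.2 ⟨l ++ m, by simp, fun y hy => ?_⟩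
  rcases List.mem_append.1 hy with h | h
  · exact hl y h
  · exact hm y h

theorem mem_kstar_of_mem {α : Type*} {L : Language α} {v : List α} (hv : v ∈ L) : v ∈ L∗ :=
  append_mem_kstar (Language.nil_mem_kstar L) hv

/-- A cut of a word in `L∗` after a nonempty prefix cuts one of the factors, possibly at its
end. -/
theorem exists_of_append_mem_kstar {α : Type*} {L : Language α} {w x : List α} (hw : w ≠ [])
    (h : w ++ x ∈ L∗) : ∃ u v y z, w = u ++ v ∧ v ≠ [] ∧ x = y ++ z ∧ u ∈ L∗ ∧ v ++ y ∈ L ∧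
      z ∈ L∗ := by
  obtain ⟨l, hl, hm⟩ := Language.mem_kstar.1 h
  clear h
  induction l generalizing w with
  | nil => simp [hw] at hl
  | cons v l ih =>
    rw [List.flatten_cons, List.append_eq_append_iff] at hl
    have hv : v ∈ L := hm v List.mem_cons_self
    have hl' : ∀ y ∈ l, y ∈ L := fun y hy => hm y (List.mem_cons_of_mem _ hy)
    rcases hl with ⟨y, rfl, rfl⟩ | ⟨w', rfl, hx⟩
    · exact ⟨[], w, y, l.flatten, rfl, hw, rfl, Language.nil_mem_kstar L, hv,
        Language.join_mem_kstar hl'⟩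
    · rcases eq_or_ne w' [] with rfl | hne
      · refine ⟨[], v, [], x, by simp, by simpa using hw, rfl, Language.nil_mem_kstar L,
          by simpa using hv, ?_⟩
        rw [List.nil_append] at hx
        exact hx ▸ Language.join_mem_kstar hl'
      · obtain ⟨u, v', y, z, rfl, hv', rfl, hu, hvy, hz⟩ := ih hne hx.symm hl'
        exact ⟨v ++ u, v', y, z, by simp, hv', rfl,
          append_mem_kstar_of_mem (mem_kstar_of_mem hv) hu, hvy, hz⟩

theorem alphabet_kstar {α : Type*} (L : Language α) : alphabet L∗ = alphabet L := by
  refine Set.Subset.antisymm ?_ ?_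
  · rintro x ⟨w, hw, hx⟩
    obtain ⟨l, rfl, hl⟩ := Language.mem_kstar.1 hw
    obtain ⟨v, hv, hxv⟩ := List.mem_flatten.1 hx
    exact ⟨v, hl v hv, hxv⟩
  · rintro x ⟨w, hw, hx⟩
    exact ⟨w, mem_kstar_of_mem hw, hx⟩

namespace Presentation

variable {α : Type*} {n : ℕ} {P : Presentation α n} {a b c : α}

/-- The states of the star automaton after reading `w`. -/
def starStates (P : Presentation α n) (w : List α) : Set (Fin n) :=
  {q | ∃ u v, w = u ++ v ∧ u ∈ P.lang∗ ∧ v ∈ wordsOver P.letters ∧ P.run P.start v = q}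

/-- The words accepted by the star automaton from the set of states `S`. -/
def starLang (P : Presentation α n) (S : Set (Fin n)) : Language α :=
  {x | ∃ q ∈ S, x ∈ P.rightLang q * P.lang∗}

/-- A set of states together with the initial state if it contains a final state. -/
def starClose (P : Presentation α n) (S : Set (Fin n)) : Set (Fin n) :=
  S ∪ {q | q = P.start ∧ ∃ f ∈ S, f ∈ P.final}

/-- The empty word is excluded because the star accepts it even if the initial state is not final.
-/
theorem leftQuotient_kstar {w : List α} (hw : w ∈ wordsOver P.letters) (hne : w ≠ []) :
    P.lang∗.leftQuotient w = P.starLang (P.starStates w) := by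
  ext x
  rw [Language.mem_leftQuotient]
  constructor
  · intro h
    obtain ⟨u, v, y, z, rfl, -, rfl, hu, hvy, hz⟩ := exists_of_append_mem_kstar hne h
    refine ⟨_, ⟨u, v, rfl, hu, (append_mem_wordsOver.1 hw).2, rfl⟩, ?_⟩
    exact Language.append_mem_mul (append_mem_lang.1 hvy).2 hz
  · rintro ⟨_, ⟨u, v, rfl, hu, hv, rfl⟩, hx⟩
    obtain ⟨y, hy, z, hz, rfl⟩ := Language.mem_mul.1 hx
    rw [← List.append_assoc]
    refine append_mem_kstar_of_mem ?_ hz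
    rw [List.append_assoc]
    exact append_mem_kstar hu (append_mem_lang.2 ⟨hv, hy⟩)

theorem starStates_nil : P.starStates [] = {P.start} := by
  ext q
  constructor
  · rintro ⟨u, v, h, -, -, rfl⟩
    obtain ⟨rfl, rfl⟩ := List.append_eq_nil_iff.1 h.symm
    rfl
  · rintro rfl
    exact ⟨[], [], rfl, Language.nil_mem_kstar _, nil_mem_wordsOver, rfl⟩

/-- The subset construction: after the step, reaching a final state completes a factor, so the
initial state is added. -/
theorem starStates_concat (w : List α) {x : α} (hx : x ∈ P.letters) :
    P.starStates (w ++ [x]) = P.starClose ((fun q => P.step q x) '' P.starStates w) := by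
  ext q
  constructor
  · rintro ⟨u, v, h, hu, hv, rfl⟩
    rcases List.eq_nil_or_concat v with rfl | ⟨v, y, rfl⟩
    · rw [List.append_nil] at h
      subst h
      obtain ⟨u, v, y, z, h, hne, hyz, hu', hvy, hz⟩ :=
        exists_of_append_mem_kstar (w := w ++ [x]) (x := []) (by simp) (by simpa using hu)
      obtain ⟨rfl, rfl⟩ := List.append_eq_nil_iff.1 hyz.symm
      rw [List.append_nil] at hvy
      obtain ⟨v, y, rfl⟩ := (List.eq_nil_or_concat v).resolve_left hne
      rw [List.concat_eq_append, ← List.append_assoc] at h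
      obtain ⟨rfl, hxy⟩ := List.append_inj' h rfl
      obtain rfl : x = y := by simpa using hxy
      rw [List.concat_eq_append] at hvy
      refine Or.inr ⟨rfl, _, ⟨_, ⟨u, v, rfl, hu', (append_mem_wordsOver.1 hvy.1).1, rfl⟩, rfl⟩, ?_⟩
      have := hvy.2
      rwa [run_append] at this
    · rw [List.concat_eq_append, ← List.append_assoc] at h
      obtain ⟨rfl, hxy⟩ := List.append_inj' h rfl
      obtain rfl : x = y := by simpa using hxy
      rw [List.concat_eq_append] at hv ⊢
      refine Or.inl ⟨_, ⟨u, v, rfl, hu, (append_mem_wordsOver.1 hv).1, rfl⟩, ?_⟩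
      rw [run_append]
      rfl
  · rintro (⟨_, ⟨u, v, rfl, hu, hv, rfl⟩, rfl⟩ |
      ⟨rfl, _, ⟨_, ⟨u, v, rfl, hu, hv, rfl⟩, rfl⟩, hf⟩)
    · refine ⟨u, v ++ [x], by simp, hu,
        append_mem_wordsOver.2 ⟨hv, singleton_mem_wordsOver.2 hx⟩, ?_⟩
      rw [run_append]
      rfl
    · refine ⟨u ++ v ++ [x], [], by simp, ?_, nil_mem_wordsOver, rfl⟩
      rw [List.append_assoc]
      refine append_mem_kstar hu ⟨append_mem_wordsOver.2 ⟨hv, singleton_mem_wordsOver.2 hx⟩, ?_⟩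
      rw [run_append]
      exact hf

theorem start_mem_starStates {w : List α} {f : Fin n} (hf : f ∈ P.final)
    (h : f ∈ P.starStates w) : P.start ∈ P.starStates w := by
  obtain ⟨u, v, rfl, hu, hv, rfl⟩ := h
  exact ⟨u ++ v, [], by simp, append_mem_kstar hu ⟨hv, hf⟩, nil_mem_wordsOver, rfl⟩

theorem starStates_nonempty {w : List α} (hw : w ∈ wordsOver P.letters) :
    (P.starStates w).Nonempty :=
  ⟨_, [], w, rfl, Language.nil_mem_kstar _, hw, rfl⟩

open Classical in
/-- The quotient of the star described by `S`; the empty set stands for the star itself. -/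
noncomputable def starQuotient (P : Presentation α n) (S : Set (Fin n)) : Language α :=
  if S = ∅ then P.lang∗ else P.starLang S

theorem starQuotient_empty : P.starQuotient ∅ = P.lang∗ := if_pos rfl

theorem starQuotient_of_nonempty {S : Set (Fin n)} (h : S.Nonempty) :
    P.starQuotient S = P.starLang S := if_neg h.ne_empty

theorem IsMinimal.complexity_kstar_le (hP : P.IsMinimal) (hn : 3 ≤ n) :
    complexity P.lang∗ ≤ ((2 ^ (n - 1) + 2 ^ (n - 2) : ℕ) : ℕ∞) := by
  by_cases h : ∃ f ∈ P.final, f ≠ P.start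
  · obtain ⟨f, hf, hne⟩ := h
    rw [← encard_setOf_mem_imp hne]
    refine complexity_le P.starQuotient _ fun w hw => ?_
    rw [alphabet_kstar, hP.alphabet_lang] at hw
    rcases eq_or_ne w [] with rfl | hw'
    · exact ⟨∅, fun h => absurd h (Set.notMem_empty _), by
        rw [starQuotient_empty, Language.leftQuotient_nil]⟩
    · exact ⟨P.starStates w, start_mem_starStates hf, by
        rw [leftQuotient_kstar hw hw', starQuotient_of_nonempty (starStates_nonempty hw)]⟩
  -- Here no state other than the initial one is final. It must be final, since otherwise all right
  -- languages would be empty; then the language is its own star, and `n` is below the bound.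
  · push Not at h
    have hs : P.start ∈ P.final := by
      by_contra hs
      have h0 : ∀ q, q ∉ P.final := fun q hq => hs (h q hq ▸ hq)
      have := hP.injective (a₁ := ⟨0, by omega⟩) (a₂ := ⟨1, by omega⟩) (by
        ext w
        exact ⟨fun hw => absurd hw.2 (h0 _), fun hw => absurd hw.2 (h0 _)⟩)
      simp at this
    have hstar : P.lang∗ = P.lang := by
      ext w
      refine ⟨fun hw => ?_, mem_kstar_of_mem⟩
      obtain ⟨l, rfl, hl⟩ := Language.mem_kstar.1 hw
      clear hw
      induction l with
      | nil => exact ⟨nil_mem_wordsOver, hs⟩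
      | cons v l ih =>
        have hv := hl v List.mem_cons_self
        have := ih fun y hy => hl y (List.mem_cons_of_mem _ hy)
        rw [List.flatten_cons, append_mem_lang, h _ hv.2]
        exact ⟨hv.1, this⟩
    rw [hstar, hP.complexity_lang]
    have : n - 1 < 2 ^ (n - 1) := Nat.lt_two_pow_self
    have : 0 < 2 ^ (n - 2) := by positivity
    exact_mod_cast (by omega : n ≤ 2 ^ (n - 1) + 2 ^ (n - 2))

/-- The set `S` of states of the star automaton is reached by a nonempty word. -/
def StarReachable (P : Presentation α n) (S : Set (Fin n)) : Prop :=
  ∃ w ∈ wordsOver P.letters, w ≠ [] ∧ P.starStates w = S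

theorem StarReachable.step {S : Set (Fin n)} (h : P.StarReachable S) {x : α}
    (hx : x ∈ P.letters) : P.StarReachable (P.starClose ((fun q => P.step q x) '' S)) := by
  obtain ⟨w, hw, -, rfl⟩ := h
  exact ⟨w ++ [x], append_mem_wordsOver.2 ⟨hw, singleton_mem_wordsOver.2 hx⟩, by simp,
    starStates_concat w hx⟩

theorem starClose_eq_self {S : Set (Fin n)} (h : ∀ f ∈ S, f ∈ P.final → P.start ∈ S) :
    P.starClose S = S := by
  refine Set.union_eq_self_of_subset_right ?_
  rintro _ ⟨rfl, f, hf, hf'⟩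
  exact h f hf hf'

theorem StarReachable.of_preimage {S : Set (Fin n)} {x : α} (hx : x ∈ P.letters)
    (hinj : Function.Injective fun q => P.step q x)
    (h : P.StarReachable ((fun q => P.step q x) ⁻¹' S))
    (hS : ∀ f ∈ S, f ∈ P.final → P.start ∈ S) : P.StarReachable S := by
  have := h.step hx
  rwa [Set.image_preimage_eq _ (Finite.injective_iff_surjective.1 hinj), starClose_eq_self hS]
    at this

/-- The smaller set without the initial state suffices, since the closure puts the initial state
back as soon as the final state `f` is present. -/
theorem StarReachable.of_preimage_diff {S : Set (Fin n)} {x : α} (hx : x ∈ P.letters)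
    (hinj : Function.Injective fun q => P.step q x)
    (h : P.StarReachable ((fun q => P.step q x) ⁻¹' (S \ {P.start}))) (hs : P.start ∈ S)
    {f : Fin n} (hf : f ∈ P.final) (hfS : f ∈ S) (hfs : f ≠ P.start) : P.StarReachable S := by
  have := h.step hx
  rw [Set.image_preimage_eq _ (Finite.injective_iff_surjective.1 hinj)] at this
  convert this using 1
  ext q
  constructor
  · intro hq
    by_cases hqs : q = P.start
    · exact Or.inr ⟨hqs, f, ⟨hfS, hfs⟩, hf⟩
    · exact Or.inl ⟨hq, hqs⟩
  · rintro (hq | ⟨rfl, -⟩)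
    · exact hq.1
    · exact hs

theorem starReachable (hn : 3 ≤ n) (hP : P.IsStandard) (ha : P.IsCycle a) (hb : P.IsSwap b)
    (S : Set (Fin n)) (hne : S.Nonempty) (hS : ∀ f ∈ S, f ∈ P.final → P.start ∈ S) :
    P.StarReachable S := by
  have h0 := hP.start_val
  have hfin := hP.mem_final
  have hva := ha.val_step
  have hvb := hb.val_step
  have heq : ∀ q : Fin n, q.val = 0 → q = P.start := fun q hq => Fin.ext (hq.trans h0.symm)
  have hlast : ∀ q, q ∈ P.final → (P.step q a) = P.start := fun q hq => heq _ (by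
    rw [hva, (hfin q).1 hq, Nat.mod_self])
  have hval : ∀ q, q ∉ P.final → (P.step q a).val = q.val + 1 := fun q hq => by
    rw [hva, Nat.mod_eq_of_lt]
    rw [hfin] at hq
    have := q.2
    omega
  induction hk : S.ncard using Nat.strong_induction_on generalizing S with
  | _ k ih =>
    have hpre : ∀ T : Set (Fin n), ((fun q => P.step q a) ⁻¹' T).ncard = T.ncard := fun T => by
      rw [← Set.ncard_image_of_injective _ ha.injective_step, Set.image_preimage_eq _
        (Finite.injective_iff_surjective.1 ha.injective_step)]
    -- A set containing the final state is obtained by `a` from a set with one element less: the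
    -- initial state is supplied by the closure.
    have hfinal : ∀ T : Set (Fin n), T.ncard = k → (∀ f ∈ T, f ∈ P.final → P.start ∈ T) →
        ∀ f ∈ T, f ∈ P.final → P.StarReachable T := by
      intro T hTk hT f hf hff
      have hs := hT f hf hff
      have hfs : f ≠ P.start := by
        rintro rfl
        rw [hfin] at hff
        omega
      refine StarReachable.of_preimage_diff ha.mem ha.injective_step ?_ hs hff hf hfs
      refine ih _ ?_ _ ?_ ?_ rfl
      · rw [hpre, ← hTk]
        exact Set.ncard_sdiff_singleton_lt_of_mem hs
      · obtain ⟨p, hp⟩ := Finite.injective_iff_surjective.1 ha.injective_step f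
        exact ⟨p, show (fun q => P.step q a) p ∈ T \ {P.start} from hp ▸ ⟨hf, hfs⟩⟩
      · intro p hp hpf
        exact absurd (hlast p hpf) hp.2
    -- Sets without the final state: inner induction on an upper bound `N` of the elements.
    have hmain : ∀ N : ℕ, ∀ T : Set (Fin n), T.ncard = k → T.Nonempty →
        (∀ f ∈ T, f ∉ P.final) → (∀ q ∈ T, q.val ≤ N) → P.StarReachable T := by
      intro N
      induction N with
      | zero =>
        intro T _ hTne hTf hTN
        have hT : T = {P.start} := Set.eq_singleton_iff_nonempty_unique_mem.2
          ⟨hTne, fun q hq => heq q (Nat.le_zero.1 (hTN q hq))⟩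
        subst hT
        have hs : (P.step P.start a).val = 1 := by
          rw [hva, h0]
          exact Nat.mod_eq_of_lt (by omega)
        have h1 : P.starStates ([] ++ [a]) = {P.step P.start a} := by
          rw [starStates_concat _ ha.mem, starStates_nil, Set.image_singleton]
          refine starClose_eq_self ?_
          rintro f rfl hf
          rw [hfin] at hf
          omega
        -- The set `{0}` has to come from a nonempty word; `ab` leads `0 → 1 → 0`.
        have h2 : P.starStates ([] ++ [a] ++ [b]) = {P.start} := by
          have hsb : P.step (P.step P.start a) b = P.start := heq _ (by
            rw [hvb, hs]; rfl)
          rw [starStates_concat _ hb.mem, h1, Set.image_singleton, hsb]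
          exact starClose_eq_self fun f hf _ => rfl
        refine ⟨_, ?_, ?_, h2⟩
        · exact cons_mem_wordsOver.2 ⟨ha.mem, singleton_mem_wordsOver.2 hb.mem⟩
        · simp
      | succ N ihN =>
        intro T hTk hTne hTf hTN
        have hT : ∀ f ∈ T, f ∈ P.final → P.start ∈ T := fun f hf hf' => absurd hf' (hTf f hf)
        have hpne : ∀ T : Set (Fin n), T.Nonempty → ((fun q => P.step q a) ⁻¹' T).Nonempty :=
          fun T hT => hT.preimage (Finite.injective_iff_surjective.1 ha.injective_step)
        by_cases hs : P.start ∈ T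
        -- If `0` and `1` are in the set, its preimage under `a` contains `n - 1` and `0`, so the
        -- case of a set with a final state applies. If only `0` is, pull back by `b` to trade `0`
        -- for `1`, then by `a`, which lowers the bound.
        · by_cases h1 : P.step P.start a ∈ T
          · refine StarReachable.of_preimage ha.mem ha.injective_step ?_ hT
            have hlast' : (⟨n - 1, by omega⟩ : Fin n) ∈ P.final := (hfin _).2
              (Nat.sub_add_cancel (by omega))
            refine hfinal _ ((hpre _).trans hTk) (fun f _ _ => h1) ⟨n - 1, by omega⟩ ?_ hlast'
            rw [Set.mem_preimage, hlast _ hlast']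
            exact hs
          · have hs1 : (P.step P.start a).val = 1 := by
              rw [hva, h0]
              exact Nat.mod_eq_of_lt (by omega)
            have hsb : P.step P.start b = P.step P.start a := Fin.ext (by
              rw [hs1, hvb, if_pos h0])
            have hswap : ∀ q, q ∈ P.final → P.step q b = q := fun q hq => Fin.ext (by
              rw [hfin] at hq
              rw [hvb, if_neg (by omega), if_neg (by omega)])
            have hbs := Finite.injective_iff_surjective.1 hb.injective_step
            refine StarReachable.of_preimage hb.mem hb.injective_step ?_ hT
            refine StarReachable.of_preimage ha.mem ha.injective_step ?_ ?_
            · refine ihN _ ?_ ?_ ?_ ?_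
              · rw [hpre, ← Set.ncard_image_of_injective _ hb.injective_step,
                  Set.image_preimage_eq _ hbs, hTk]
              · exact hpne _ (hTne.preimage hbs)
              · intro f hf hff
                rw [Set.mem_preimage, Set.mem_preimage, hlast f hff, hsb] at hf
                exact h1 hf
              · intro q hq
                rw [Set.mem_preimage, Set.mem_preimage] at hq
                have hqN : (P.step (P.step q a) b).val ≤ N + 1 := hTN _ hq
                have hqf : q ∉ P.final := fun hqf => h1 (by rwa [hlast q hqf, hsb] at hq)
                have h3 := hvb (P.step q a)
                rw [hval q hqf, if_neg (Nat.succ_ne_zero _)] at h3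
                split_ifs at h3 <;> omega
            · intro f hf hff
              rw [Set.mem_preimage, hswap f hff] at hf
              exact absurd hff (hTf f hf)
        · refine StarReachable.of_preimage ha.mem ha.injective_step ?_ hT
          have hnf : ∀ f ∈ (fun q => P.step q a) ⁻¹' T, f ∉ P.final := fun f hf hff =>
            hs (by rwa [Set.mem_preimage, hlast f hff] at hf)
          refine ihN _ ((hpre _).trans hTk) (hpne T hTne) hnf fun q hq => ?_
          have : (P.step q a).val ≤ N + 1 := hTN _ hq
          rw [hval q (hnf q hq)] at this
          omega
    by_cases hf : ∃ f ∈ S, f ∈ P.final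
    · obtain ⟨f, hf, hff⟩ := hf
      exact hfinal S hk hS f hf hff
    · push Not at hf
      exact hmain n S hk hne hf fun q _ => q.2.le

theorem IsCycle.le_length_of_mem_kstar (ha : P.IsCycle a) (hP : P.IsStandard) {z : List α}
    (hz : z ∈ P.lang∗) (hne : z ≠ []) (h : ∀ x ∈ z, x = a) : n - 1 ≤ z.length := by
  obtain ⟨u, v, y, z', rfl, hv, hyz, -, hvy, -⟩ :=
    exists_of_append_mem_kstar (x := []) hne (by simpa using hz)
  obtain ⟨rfl, rfl⟩ := List.append_eq_nil_iff.1 hyz.symm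
  rw [List.append_nil] at hvy
  have hva : v = List.replicate v.length a := List.eq_replicate_of_mem fun x hx =>
    h x (List.mem_append_right _ hx)
  rw [hva, lang, ha.replicate_mem_rightLang hP.mem_final, hP.start_val, zero_add] at hvy
  have := Nat.mod_le v.length n
  rw [List.length_append]
  omega

/-- A nonempty power of `a` in the star has length at least `n - 1`, so `a ^ (n - 1 - q)` can use a
new factor only if `q = 0` and the current factor is already complete. Then the set contains a final
state, hence the initial one. -/
theorem IsCycle.replicate_mem_starLang (ha : P.IsCycle a) (hn : 3 ≤ n) (hP : P.IsStandard)
    {S : Set (Fin n)} (hS : ∀ f ∈ S, f ∈ P.final → P.start ∈ S) (q : Fin n) :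
    List.replicate (n - 1 - q.val) a ∈ P.starLang S ↔ q ∈ S := by
  constructor
  · rintro ⟨p, hp, hx⟩
    obtain ⟨y, hy, z, hz, hyz⟩ := Language.mem_mul.1 hx
    rcases eq_or_ne z [] with rfl | hne
    · rw [List.append_nil] at hyz
      rw [hyz, ha.replicate_sub_mem_rightLang hP.mem_final] at hy
      exact hy ▸ hp
    · have hlen := congrArg List.length hyz
      rw [List.length_append, List.length_replicate] at hlen
      have := ha.le_length_of_mem_kstar hP hz hne fun x hx =>
        List.eq_of_mem_replicate (hyz ▸ List.mem_append_right y hx)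
      obtain rfl : y = [] := List.length_eq_zero_iff.1 (by omega)
      have hq : q = P.start := Fin.ext (by rw [hP.start_val]; omega)
      exact hq ▸ hS p hp (nil_mem_rightLang.1 hy)
  · intro hq
    refine ⟨q, hq, ?_⟩
    rw [← List.append_nil (List.replicate _ a)]
    exact Language.append_mem_mul ((ha.replicate_sub_mem_rightLang hP.mem_final).2 rfl)
      (Language.nil_mem_kstar _)

theorem IsCycle.starLang_injOn (ha : P.IsCycle a) (hn : 3 ≤ n) (hP : P.IsStandard) :
    Set.InjOn P.starLang {S | ∀ f ∈ S, f ∈ P.final → P.start ∈ S} := by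
  intro S hS T hT h
  ext q
  rw [← ha.replicate_mem_starLang hn hP hS, h, ha.replicate_mem_starLang hn hP hT]

/-- Equality would put a final state `f ≠ 0` into the set, by the empty word. After reading `a`, the
star is in `{1}` only, while the set also contains the image of `f`, and `a` is injective. -/
theorem IsCycle.kstar_ne_starLang (ha : P.IsCycle a) (hn : 3 ≤ n) (hP : P.IsStandard)
    {S : Set (Fin n)} (hS : P.StarReachable S) : P.lang∗ ≠ P.starLang S := by
  intro h
  obtain ⟨w, hw, hne, rfl⟩ := hS
  have hfinal : ∃ f ∈ P.starStates w, f ∈ P.final := by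
    have : [] ∈ P.starLang (P.starStates w) := h ▸ Language.nil_mem_kstar _
    obtain ⟨p, hp, hx⟩ := this
    obtain ⟨y, hy, z, hz, hyz⟩ := Language.mem_mul.1 hx
    obtain ⟨rfl, rfl⟩ := List.append_eq_nil_iff.1 hyz
    exact ⟨p, hp, nil_mem_rightLang.1 hy⟩
  obtain ⟨f, hf, hff⟩ := hfinal
  have ha' : [a] ∈ wordsOver P.letters := singleton_mem_wordsOver.2 ha.mem
  have hq := congrArg (fun L => Language.leftQuotient L [a]) h
  rw [← leftQuotient_kstar hw hne, ← Language.leftQuotient_append,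
    leftQuotient_kstar ha' (by simp),
    leftQuotient_kstar (append_mem_wordsOver.2 ⟨hw, ha'⟩) (by simp)] at hq
  have hset := ha.starLang_injOn hn hP (fun f hf hf' => start_mem_starStates hf' hf)
    (fun f hf hf' => start_mem_starStates hf' hf) hq
  have hmem : P.step f a ∈ P.starStates (w ++ [a]) := by
    rw [starStates_concat w ha.mem]
    exact Or.inl ⟨f, hf, rfl⟩
  have hs : (P.step P.start a).val = 1 := by
    rw [ha.val_step, hP.start_val]
    exact Nat.mod_eq_of_lt (by omega)
  rw [← hset, ← List.nil_append [a], starStates_concat _ ha.mem, starStates_nil,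
    Set.image_singleton, starClose_eq_self] at hmem
  · have := ha.injective_step hmem
    rw [this, hP.mem_final, hP.start_val] at hff
    omega
  · rintro f rfl hf
    rw [hP.mem_final] at hf
    omega

theorem complexity_kstar (hn : 3 ≤ n) (hP : P.IsStandard) (ha : P.IsCycle a) (hb : P.IsSwap b) :
    complexity P.lang∗ = ((2 ^ (n - 1) + 2 ^ (n - 2) : ℕ) : ℕ∞) := by
  have hmin := ha.isMinimal hP.mem_final
  refine le_antisymm (hmin.complexity_kstar_le hn) ?_
  obtain ⟨f, hff, huniq⟩ : ∃ f ∈ P.final, ∀ g ∈ P.final, g = f := by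
    refine ⟨⟨n - 1, by omega⟩, (hP.mem_final _).2 (Nat.sub_add_cancel (by omega)), fun g hg => ?_⟩
    rw [hP.mem_final] at hg
    exact Fin.ext (by simp only; omega)
  have hfs : f ≠ P.start := by
    rintro rfl
    rw [hP.mem_final, hP.start_val] at hff
    omega
  rw [← encard_setOf_mem_imp hfs]
  have hclosed : ∀ S : Set (Fin n), (f ∈ S → P.start ∈ S) →
      ∀ g ∈ S, g ∈ P.final → P.start ∈ S := fun S hS g hg hgf => hS (huniq g hgf ▸ hg)
  have hreach : ∀ S : Set (Fin n), S.Nonempty → (f ∈ S → P.start ∈ S) → P.StarReachable S :=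
    fun S hne hS => starReachable hn hP ha hb S hne (hclosed S hS)
  refine le_complexity P.starQuotient _ (fun S hS => ?_) fun S hS T hT h => ?_
  · rw [alphabet_kstar, hmin.alphabet_lang]
    rcases S.eq_empty_or_nonempty with rfl | hne
    · exact ⟨[], nil_mem_wordsOver, by rw [starQuotient_empty, Language.leftQuotient_nil]⟩
    · obtain ⟨w, hw, hw', rfl⟩ := hreach S hne hS
      exact ⟨w, hw, by rw [leftQuotient_kstar hw hw', starQuotient_of_nonempty hne]⟩
  · rcases S.eq_empty_or_nonempty with rfl | hne <;> rcases T.eq_empty_or_nonempty with rfl | hne'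
    · rfl
    · rw [starQuotient_empty, starQuotient_of_nonempty hne'] at h
      exact absurd h (ha.kstar_ne_starLang hn hP (hreach T hne' hT))
    · rw [starQuotient_empty, starQuotient_of_nonempty hne] at h
      exact absurd h.symm (ha.kstar_ne_starLang hn hP (hreach S hne hS))
    · rw [starQuotient_of_nonempty hne, starQuotient_of_nonempty hne'] at h
      exact ha.starLang_injOn hn hP (hclosed S hS) (hclosed T hT) h

end Presentation

/-! ### Product: the automaton and upper bounds -/

theorem encard_setOf_fst_eq_imp {ι : Type*} [Fintype ι] {n : ℕ} (f : ι) (s : Fin n) :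
    {x : ι × Set (Fin n) | x.1 = f → s ∈ x.2}.encard
      = ((Fintype.card ι * 2 ^ n - 2 ^ (n - 1) : ℕ) : ℕ∞) := by
  have h : {x : ι × Set (Fin n) | x.1 = f → s ∈ x.2}
      = ({f} ×ˢ {S | s ∈ S}) ∪ ({f}ᶜ ×ˢ Set.univ) := by
    ext x
    simp only [Set.mem_ofPred_eq, Set.mem_union, Set.mem_prod, Set.mem_singleton_iff,
      Set.mem_compl_iff, Set.mem_univ, and_true]
    tauto
  have hι : 0 < Fintype.card ι := Fintype.card_pos_iff.2 ⟨f⟩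
  have hc : ({f}ᶜ : Set ι).encard = ((Fintype.card ι - 1 : ℕ) : ℕ∞) := by
    rw [← Set.Finite.cast_ncard_eq (Set.toFinite _), Set.ncard_compl, Set.ncard_singleton,
      Nat.card_eq_fintype_card]
  rw [h, Set.encard_union_eq, Set.encard_prod, Set.encard_prod, Set.encard_singleton,
    encard_setOf_mem, hc, Presentation.encard_univ_set, one_mul]
  · norm_cast
    have hn : 0 < n := s.pos
    have h2 : 2 ^ n = 2 * 2 ^ (n - 1) := by
      rw [← pow_succ', Nat.sub_add_cancel hn]
    obtain ⟨k, hk⟩ : ∃ k, Fintype.card ι = k + 1 := ⟨_, (Nat.sub_add_cancel hι).symm⟩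
    rw [hk, Nat.add_sub_cancel, add_mul, one_mul]
    omega
  · rw [Set.disjoint_left]
    rintro x hx hx'
    exact hx'.1 hx.1

theorem alphabet_mul {α : Type*} {K L : Language α} (hK : ∃ w, w ∈ K) (hL : ∃ w, w ∈ L) :
    alphabet (K * L) = alphabet K ∪ alphabet L := by
  obtain ⟨v, hv⟩ := hK
  obtain ⟨w, hw⟩ := hL
  refine Set.Subset.antisymm ?_ ?_
  · rintro x ⟨z, hz, hx⟩
    obtain ⟨y, hy, z, hz', rfl⟩ := Language.mem_mul.1 hz
    rcases List.mem_append.1 hx with h | h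
    · exact Or.inl ⟨y, hy, h⟩
    · exact Or.inr ⟨z, hz', h⟩
  · rintro x (⟨y, hy, hx⟩ | ⟨z, hz, hx⟩)
    · exact ⟨y ++ w, Language.append_mem_mul hy hw, List.mem_append_left _ hx⟩
    · exact ⟨v ++ z, Language.append_mem_mul hv hz, List.mem_append_right _ hx⟩

namespace Presentation

variable {α : Type*} {m n : ℕ} {P : Presentation α m} {Q : Presentation α n} {a b c d : α}

open Classical in
/-- The state reached by `w`, undefined if `w` has a letter that `P` does not have. -/
noncomputable def run? (P : Presentation α n) (w : List α) : Option (Fin n) :=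
  if w ∈ wordsOver P.letters then some (P.run P.start w) else none

/-- The right language of a state, empty if the state is undefined. -/
def rightLang? (P : Presentation α n) (q : Option (Fin n)) : Language α := q.elim 0 P.rightLang

theorem run?_of_mem {w : List α} (hw : w ∈ wordsOver P.letters) :
    P.run? w = some (P.run P.start w) := if_pos hw

theorem run?_of_notMem {w : List α} (hw : w ∉ wordsOver P.letters) : P.run? w = none := if_neg hw

theorem run?_eq_some_iff {w : List α} {p : Fin m} :
    P.run? w = some p ↔ w ∈ wordsOver P.letters ∧ P.run P.start w = p := by
  by_cases hw : w ∈ wordsOver P.letters <;> simp [run?, hw]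

theorem leftQuotient_lang_eq (w : List α) : P.lang.leftQuotient w = P.rightLang? (P.run? w) := by
  by_cases hw : w ∈ wordsOver P.letters
  · rw [leftQuotient_lang hw, run?_of_mem hw]
    rfl
  · rw [leftQuotient_lang_of_notMem hw, run?_of_notMem hw]
    rfl

theorem append_mem_lang_iff {w x : List α} : w ++ x ∈ P.lang ↔ x ∈ P.rightLang? (P.run? w) := by
  rw [← leftQuotient_lang_eq]
  rfl

theorem nil_mem_rightLang? {q : Option (Fin m)} :
    [] ∈ P.rightLang? q ↔ ∃ f ∈ P.final, q = some f := by
  cases q with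
  | none => simp [rightLang?]
  | some q => simp [rightLang?, nil_mem_rightLang]

theorem mem_lang_iff_run? {w : List α} : w ∈ P.lang ↔ ∃ f ∈ P.final, P.run? w = some f := by
  rw [← nil_mem_rightLang?, ← append_mem_lang_iff, List.append_nil]

/-- The states of the second component of the product automaton after reading `w`. -/
def mulStates (P : Presentation α m) (Q : Presentation α n) (w : List α) : Set (Fin n) :=
  {q | ∃ u v, w = u ++ v ∧ u ∈ P.lang ∧ v ∈ wordsOver Q.letters ∧ Q.run Q.start v = q}

/-- The words accepted by the product automaton from the state `(p, S)`. -/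
def mulLang (P : Presentation α m) (Q : Presentation α n) (p : Option (Fin m)) (S : Set (Fin n)) :
    Language α :=
  {x | x ∈ P.rightLang? p * Q.lang ∨ ∃ q ∈ S, x ∈ Q.rightLang q}

/-- The cut between the factors falls either within `w`, which is recorded by the set of states of
`Q`, or after it, which is recorded by the state of `P`. -/
theorem leftQuotient_mul (w : List α) :
    (P.lang * Q.lang).leftQuotient w = P.mulLang Q (P.run? w) (P.mulStates Q w) := by
  ext x
  rw [Language.mem_leftQuotient]
  constructor
  · intro h
    obtain ⟨y, hy, z, hz, hyz⟩ := Language.mem_mul.1 h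
    rcases List.append_eq_append_iff.1 hyz with ⟨v, rfl, rfl⟩ | ⟨u, rfl, rfl⟩
    · rw [append_mem_lang] at hz
      exact Or.inr ⟨_, ⟨y, v, rfl, hy, hz.1, rfl⟩, hz.2⟩
    · exact Or.inl (Language.append_mem_mul (append_mem_lang_iff.1 hy) hz)
  · rintro (h | ⟨_, ⟨u, v, rfl, hu, hv, rfl⟩, hx⟩)
    · obtain ⟨y, hy, z, hz, rfl⟩ := Language.mem_mul.1 h
      rw [← List.append_assoc]
      exact Language.append_mem_mul (append_mem_lang_iff.2 hy) hz
    · rw [List.append_assoc]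
      exact Language.append_mem_mul hu (append_mem_lang.2 ⟨hv, hx⟩)

theorem start_mem_mulStates {w : List α} {f : Fin m} (hf : f ∈ P.final) (h : P.run? w = some f) :
    Q.start ∈ P.mulStates Q w :=
  ⟨w, [], by simp, mem_lang_iff_run?.2 ⟨f, hf, h⟩, nil_mem_wordsOver, rfl⟩

/-- A letter foreign to `Q` erases all old states, and only the initial state can be present
afterwards. This is what a private letter of the first operand exploits. -/
theorem mem_mulStates_concat {w : List α} {x : α} {q : Fin n} :
    q ∈ P.mulStates Q (w ++ [x]) ↔ (x ∈ Q.letters ∧ ∃ r ∈ P.mulStates Q w, Q.step r x = q) ∨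
      (q = Q.start ∧ w ++ [x] ∈ P.lang) := by
  constructor
  · rintro ⟨u, v, h, hu, hv, rfl⟩
    rcases List.eq_nil_or_concat v with rfl | ⟨v, y, rfl⟩
    · rw [List.append_nil] at h
      subst h
      exact Or.inr ⟨rfl, hu⟩
    · rw [List.concat_eq_append, ← List.append_assoc] at h
      obtain ⟨rfl, hxy⟩ := List.append_inj' h rfl
      obtain rfl : x = y := by simpa using hxy
      rw [List.concat_eq_append] at hv ⊢
      obtain ⟨hv, hx⟩ := append_mem_wordsOver.1 hv
      refine Or.inl ⟨singleton_mem_wordsOver.1 hx, _, ⟨u, v, rfl, hu, hv, rfl⟩, ?_⟩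
      rw [run_append]
      rfl
  · rintro (⟨hx, _, ⟨u, v, rfl, hu, hv, rfl⟩, rfl⟩ | ⟨rfl, h⟩)
    · refine ⟨u, v ++ [x], by simp, hu,
        append_mem_wordsOver.2 ⟨hv, singleton_mem_wordsOver.2 hx⟩, ?_⟩
      rw [run_append]
      rfl
    · exact ⟨w ++ [x], [], by simp, h, nil_mem_wordsOver, rfl⟩

theorem run?_concat {w : List α} {x : α} {p : Fin m} (h : P.run? w = some p)
    (hx : x ∈ P.letters) : P.run? (w ++ [x]) = some (P.step p x) := by
  rw [run?_eq_some_iff] at h ⊢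
  refine ⟨append_mem_wordsOver.2 ⟨h.1, singleton_mem_wordsOver.2 hx⟩, ?_⟩
  rw [run_append, h.2]
  rfl

theorem run?_append_of_notMem {v w : List α} (h : w ∉ wordsOver P.letters) :
    P.run? (v ++ w) = none :=
  run?_of_notMem fun hw => h (append_mem_wordsOver.1 hw).2

theorem IsMinimal.exists_mem_final (hP : P.IsMinimal) (hm : 3 ≤ m) : ∃ f, f ∈ P.final := by
  by_contra! h
  have := hP.injective (a₁ := ⟨0, by omega⟩) (a₂ := ⟨1, by omega⟩) (by
    ext w
    exact ⟨fun hw => absurd hw.2 (h _), fun hw => absurd hw.2 (h _)⟩)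
  simp at this

theorem alphabet_mul_subset : alphabet (P.lang * Q.lang) ⊆ P.letters ∪ Q.letters := by
  rintro x ⟨z, hz, hx⟩
  obtain ⟨y, hy, z, hz', rfl⟩ := Language.mem_mul.1 hz
  rcases List.mem_append.1 hx with h | h
  · exact Or.inl (hy.1 x h)
  · exact Or.inr (hz'.1 x h)

theorem IsMinimal.complexity_mul_le_of_letters_eq (hP : P.IsMinimal) (hm : 3 ≤ m)
    (h : P.letters = Q.letters) :
    complexity (P.lang * Q.lang) ≤ ((m * 2 ^ n - 2 ^ (n - 1) : ℕ) : ℕ∞) := by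
  obtain ⟨f, hf⟩ := hP.exists_mem_final hm
  have hc := encard_setOf_fst_eq_imp f Q.start
  rw [Fintype.card_fin] at hc
  rw [← hc]
  refine complexity_le (fun x => P.mulLang Q (some x.1) x.2) _ fun w hw => ?_
  replace hw : w ∈ wordsOver P.letters :=
    wordsOver_mono (by simpa [h] using alphabet_mul_subset (P := P) (Q := Q)) hw
  refine ⟨(P.run P.start w, P.mulStates Q w), fun hr => ?_, ?_⟩
  · exact start_mem_mulStates hf (run?_eq_some_iff.2 ⟨hw, hr⟩)
  · rw [leftQuotient_mul, run?_of_mem hw]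

/-- The restricted count with `m + 1` first components: `(m + 1) * 2 ^ n - 2 ^ (n - 1)`. -/
theorem encard_option_fin (f : Fin m) (s : Fin n) :
    {x : Option (Fin m) × Set (Fin n) | x.1 = some f → s ∈ x.2}.encard
      = ((m * 2 ^ n + 2 ^ (n - 1) : ℕ) : ℕ∞) := by
  rw [encard_setOf_fst_eq_imp, Fintype.card_option, Fintype.card_fin]
  congr 1
  have h2 : 2 ^ n = 2 * 2 ^ (n - 1) := by
    rw [← pow_succ', Nat.sub_add_cancel s.pos]
  rw [add_mul, one_mul]
  omega

theorem IsMinimal.complexity_mul_le (hP : P.IsMinimal) (hm : 3 ≤ m) :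
    complexity (P.lang * Q.lang) ≤ ((m * 2 ^ n + 2 ^ (n - 1) : ℕ) : ℕ∞) := by
  obtain ⟨f, hf⟩ := hP.exists_mem_final hm
  rw [← encard_option_fin f Q.start]
  exact complexity_le (fun x => P.mulLang Q x.1 x.2) _ fun w _ =>
    ⟨(P.run? w, P.mulStates Q w), start_mem_mulStates hf, leftQuotient_mul w⟩

/-- The state `(p, S)` of the product automaton is reachable. -/
def MulReachable (P : Presentation α m) (Q : Presentation α n) (p : Option (Fin m))
    (S : Set (Fin n)) : Prop :=
  ∃ w ∈ wordsOver (P.letters ∪ Q.letters), P.run? w = p ∧ P.mulStates Q w = S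

/-- Some state `(p, S)` of the product automaton with `p = i` is reachable. -/
def MulReachableAt (P : Presentation α m) (Q : Presentation α n) (i : ℕ) (S : Set (Fin n)) : Prop :=
  ∃ p : Fin m, p.val = i ∧ P.MulReachable Q (some p) S

theorem MulReachable.step {p : Fin m} {S : Set (Fin n)} (h : P.MulReachable Q (some p) S) {x : α}
    (hxP : x ∈ P.letters) (hxQ : x ∈ Q.letters) (hf : P.step p x ∉ P.final) :
    P.MulReachable Q (some (P.step p x)) ((fun q => Q.step q x) '' S) := by
  obtain ⟨w, hw, hp, rfl⟩ := h
  have hr := run?_concat hp hxP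
  refine ⟨w ++ [x], append_mem_wordsOver.2 ⟨hw, singleton_mem_wordsOver.2 (Or.inl hxP)⟩, hr, ?_⟩
  ext q
  rw [mem_mulStates_concat, mem_lang_iff_run?, hr]
  simp [hxQ, hf]

theorem MulReachable.step_final {p : Fin m} {S : Set (Fin n)} (h : P.MulReachable Q (some p) S)
    {x : α} (hxP : x ∈ P.letters) (hxQ : x ∈ Q.letters) (hf : P.step p x ∈ P.final) :
    P.MulReachable Q (some (P.step p x)) (insert Q.start ((fun q => Q.step q x) '' S)) := by
  obtain ⟨w, hw, hp, rfl⟩ := h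
  have hr := run?_concat hp hxP
  refine ⟨w ++ [x], append_mem_wordsOver.2 ⟨hw, singleton_mem_wordsOver.2 (Or.inl hxP)⟩, hr, ?_⟩
  ext q
  rw [mem_mulStates_concat, mem_lang_iff_run?, hr]
  simp [hxQ, hf, or_comm]

theorem MulReachable.step_none {p : Option (Fin m)} {S : Set (Fin n)} (h : P.MulReachable Q p S)
    {x : α} (hxP : x ∉ P.letters) (hxQ : x ∈ Q.letters) :
    P.MulReachable Q none ((fun q => Q.step q x) '' S) := by
  obtain ⟨w, hw, -, rfl⟩ := h
  have hr : P.run? (w ++ [x]) = none :=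
    run?_append_of_notMem fun h => hxP (singleton_mem_wordsOver.1 h)
  refine ⟨w ++ [x], append_mem_wordsOver.2 ⟨hw, singleton_mem_wordsOver.2 (Or.inr hxQ)⟩, hr, ?_⟩
  ext q
  rw [mem_mulStates_concat, mem_lang_iff_run?, hr]
  simp [hxQ]

theorem mulReachableAt_zero_empty (hm : 3 ≤ m) (hP : P.IsStandard) :
    P.MulReachableAt Q 0 ∅ := by
  refine ⟨P.start, hP.start_val, [], nil_mem_wordsOver, run?_of_mem nil_mem_wordsOver, ?_⟩
  rw [Set.eq_empty_iff_forall_notMem]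
  rintro q ⟨u, v, h, hu, -, -⟩
  obtain ⟨rfl, rfl⟩ := List.append_eq_nil_iff.1 h.symm
  have := hu.2
  rw [run_nil, hP.mem_final, hP.start_val] at this
  omega

theorem MulReachableAt.iterate (hP : P.IsStandard) (ha : P.IsCycle a)
    (haQ : a ∈ Q.letters) {i : ℕ} {S : Set (Fin n)} (h : P.MulReachableAt Q i S) (k : ℕ)
    (hk : i + k + 1 < m) : P.MulReachableAt Q (i + k) ((fun q => Q.step q a)^[k] '' S) := by
  induction k with
  | zero => simpa using h
  | succ k ih =>
    obtain ⟨p, hp, hr⟩ := ih (by omega)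
    have hv : (P.step p a).val = i + k + 1 := by
      rw [ha.val_step, hp, Nat.mod_eq_of_lt (by omega)]
    refine ⟨P.step p a, hv, ?_⟩
    rw [Function.iterate_succ', Set.image_comp]
    refine hr.step ha.mem haQ ?_
    rw [hP.mem_final, hv]
    omega

theorem MulReachableAt.iterate_final (hP : P.IsStandard) (ha : P.IsCycle a)
    (haQ : a ∈ Q.letters) {i : ℕ} {S : Set (Fin n)} (h : P.MulReachableAt Q i S) (k : ℕ)
    (hk : i + k + 2 = m) : P.MulReachableAt Q (m - 1)
      (insert Q.start ((fun q => Q.step q a)^[k + 1] '' S)) := by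
  obtain ⟨p, hp, hr⟩ := h.iterate hP ha haQ k (by omega)
  have hv : (P.step p a).val = m - 1 := by
    rw [ha.val_step, hp, Nat.mod_eq_of_lt (by omega)]
    omega
  refine ⟨P.step p a, hv, ?_⟩
  rw [Function.iterate_succ', Set.image_comp]
  refine hr.step_final ha.mem haQ ?_
  rw [hP.mem_final, hv]
  omega

theorem MulReachableAt.step_last (hm : 3 ≤ m) (hP : P.IsStandard) (ha : P.IsCycle a)
    (haQ : a ∈ Q.letters) {S : Set (Fin n)} (h : P.MulReachableAt Q (m - 1) S) :
    P.MulReachableAt Q 0 ((fun q => Q.step q a) '' S) := by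
  obtain ⟨p, hp, hr⟩ := h
  have hv : (P.step p a).val = 0 := by
    rw [ha.val_step, hp, Nat.sub_add_cancel (by omega), Nat.mod_self]
  refine ⟨P.step p a, hv, hr.step ha.mem haQ ?_⟩
  rw [hP.mem_final, hv]
  omega

theorem MulReachableAt.swap (hm : 3 ≤ m) (hP : P.IsStandard) {i j : ℕ} {S : Set (Fin n)}
    (h : P.MulReachableAt Q i S)
    (hb : P.IsSwap b) (hbQ : b ∈ Q.letters) (hij : i = 0 ∧ j = 1 ∨ i = 1 ∧ j = 0) :
    P.MulReachableAt Q j ((fun q => Q.step q b) '' S) := by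
  obtain ⟨p, hp, hr⟩ := h
  have hv : (P.step p b).val = j := by
    rw [hb.val_step]
    split_ifs <;> omega
  refine ⟨P.step p b, hv, hr.step hb.mem hbQ ?_⟩
  rw [hP.mem_final, hv]
  omega

/-- The powers of `a` recover the set `S`. A power of `a` lies in the second language only from
length `n - 1` on, so the other way of being accepted needs `q = 0` and a final first component;
then the initial state is in `S` by assumption. -/
theorem IsCycle.replicate_mem_mulLang (ha : Q.IsCycle a) (hQ : Q.IsStandard)
    {p : Option (Fin m)} {S : Set (Fin n)} (hS : ∀ f ∈ P.final, p = some f → Q.start ∈ S)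
    (q : Fin n) : List.replicate (n - 1 - q.val) a ∈ P.mulLang Q p S ↔ q ∈ S := by
  constructor
  · rintro (hx | ⟨r, hr, hx⟩)
    · obtain ⟨y, hy, z, hz, hyz⟩ := Language.mem_mul.1 hx
      have hza : z = List.replicate z.length a := List.eq_replicate_of_mem fun x hx =>
        List.eq_of_mem_replicate (hyz ▸ List.mem_append_right y hx)
      rw [hza, lang, ha.replicate_mem_rightLang hQ.mem_final, hQ.start_val, zero_add] at hz
      have hlen := congrArg List.length hyz
      rw [List.length_append, List.length_replicate] at hlen
      have := Nat.mod_le z.length n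
      obtain rfl : y = [] := List.length_eq_zero_iff.1 (by omega)
      have hq : q = Q.start := Fin.ext (by rw [hQ.start_val]; omega)
      obtain ⟨f, hf, hpf⟩ := nil_mem_rightLang?.1 hy
      exact hq ▸ hS f hf hpf
    · rw [ha.replicate_sub_mem_rightLang hQ.mem_final] at hx
      exact hx ▸ hr
  · intro hq
    exact Or.inr ⟨q, hq, (ha.replicate_sub_mem_rightLang hQ.mem_final).2 rfl⟩

/-- Words with the same quotient lead to the same set of states, also when they are extended. -/
theorem IsCycle.mulStates_append_eq (ha : Q.IsCycle a) (hQ : Q.IsStandard)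
    {v w : List α} (h : (P.lang * Q.lang).leftQuotient v = (P.lang * Q.lang).leftQuotient w)
    (x : List α) : P.mulStates Q (v ++ x) = P.mulStates Q (w ++ x) := by
  have h' := congrArg (fun L => Language.leftQuotient L x) h
  rw [← Language.leftQuotient_append, ← Language.leftQuotient_append, leftQuotient_mul,
    leftQuotient_mul] at h'
  ext q
  rw [← ha.replicate_mem_mulLang hQ fun f hf hr => start_mem_mulStates hf hr, h',
    ha.replicate_mem_mulLang hQ fun f hf hr => start_mem_mulStates hf hr]

end Presentation

/-! ### Product: reachable and distinguishable states -/

namespace Presentation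

variable {α : Type*} {m n : ℕ} {P : Presentation α m} {Q : Presentation α n} {a b c d : α}

/-- Going once around the cycle of the first component adds `1` to the set of states. -/
theorem MulReachableAt.around (hm : 3 ≤ m) (hP : P.IsStandard) (ha : P.IsCycle a)
    (haQ : a ∈ Q.letters) {S : Set (Fin n)} (h : P.MulReachableAt Q 0 S) :
    P.MulReachableAt Q 0
      (insert (Q.step Q.start a) ((fun q => Q.step q a)^[m] '' S)) := by
  have := (h.iterate_final hP ha haQ (m - 2) (by omega)).step_last hm hP ha haQ
  rwa [Set.image_insert_eq, ← Set.image_comp, ← Function.iterate_succ',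
    show (m - 2 + 1).succ = m by omega] at this

theorem mulReachableAt_zero (hm : 3 ≤ m) (hn : 3 ≤ n) (hP : P.IsStandard) (hQ : Q.IsStandard)
    (ha : P.IsCycle a) (ha' : Q.IsCycle a) (hb : P.IsSwap b) (hb' : Q.IsSwap b)
    (hc : P.IsMerge c) (hc' : Q.IsMerge c) (S : Set (Fin n)) : P.MulReachableAt Q 0 S := by
  have hs0 := hQ.start_val
  have hs1 : (Q.step Q.start a).val = 1 := by
    rw [ha'.val_step, hs0]
    exact Nat.mod_eq_of_lt (by omega)
  have hsurja := Finite.injective_iff_surjective.1 ha'.injective_step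
  have hsurjb := Finite.injective_iff_surjective.1 hb'.injective_step
  -- The word `ab` returns the first component from `0` to `0` and acts on the second one by a
  -- permutation that sends `t + 1` to `t + 2` below `n`.
  have hrot : ∀ S : Set (Fin n), P.MulReachableAt Q 0
      ((fun q => Q.step q a) ⁻¹' ((fun q => Q.step q b) ⁻¹' S)) → P.MulReachableAt Q 0 S := by
    intro S h
    have := (h.iterate hP ha ha'.mem 1 (by omega)).swap hm hP (j := 0) hb hb'.mem (by omega)
    rwa [Function.iterate_one, Set.image_preimage_eq _ hsurja, Set.image_preimage_eq _ hsurjb]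
      at this
  induction hk : S.ncard using Nat.strong_induction_on generalizing S with
  | _ k ih =>
    rcases S.eq_empty_or_nonempty with rfl | hne
    · exact mulReachableAt_zero_empty hm hP
    -- A set with `1` comes from one with an element less, by going once around; `hpos` carries any
    -- positive element back to `1` with `hrot`.
    have hone : ∀ T : Set (Fin n), T.ncard = k → Q.step Q.start a ∈ T →
        P.MulReachableAt Q 0 T := by
      intro T hT h1
      have hinj := ha'.injective_step.iterate m
      have hsurj := Finite.injective_iff_surjective.1 hinj
      have hrec := (ih (((fun q => Q.step q a)^[m] ⁻¹' (T \ {Q.step Q.start a})).ncard) (by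
        rw [← Set.ncard_image_of_injective _ hinj, Set.image_preimage_eq _ hsurj, ← hT]
        exact Set.ncard_sdiff_singleton_lt_of_mem h1) _ rfl).around hm hP ha ha'.mem
      rwa [Set.image_preimage_eq _ hsurj, Set.insert_sdiff_singleton, Set.insert_eq_of_mem h1]
        at hrec
    have hpos : ∀ t : ℕ, ∀ T : Set (Fin n), T.ncard = k → ∀ q ∈ T, q.val = t + 1 →
        P.MulReachableAt Q 0 T := by
      intro t
      induction t with
      | zero =>
        intro T hT q hq hq1
        exact hone T hT (by rwa [← Fin.ext (hq1.trans hs1.symm)])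
      | succ t iht =>
        intro T hT q hq hqt
        refine hrot T (iht _ ?_ ⟨t + 1, by omega⟩ ?_ rfl)
        · rw [← Set.ncard_image_of_injective _ ha'.injective_step,
            Set.image_preimage_eq _ hsurja, ← Set.ncard_image_of_injective _ hb'.injective_step,
            Set.image_preimage_eq _ hsurjb, hT]
        · have hv : (Q.step ⟨t + 1, by omega⟩ a).val = t + 1 + 1 := by
            rw [ha'.val_step]
            exact Nat.mod_eq_of_lt (show t + 1 + 1 < n by omega)
          have : Q.step (Q.step ⟨t + 1, by omega⟩ a) b = q := Fin.ext (by
            rw [hb'.val_step, hv, if_neg (by omega), if_neg (by omega), hqt])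
          rw [Set.mem_preimage, Set.mem_preimage, this]
          exact hq
    by_cases hex : ∃ q ∈ S, q ≠ Q.start
    · obtain ⟨q, hq, hq0⟩ := hex
      have : q.val ≠ 0 := fun h => hq0 (Fin.ext (h.trans hs0.symm))
      exact hpos (q.val - 1) S hk q hq (by omega)
    · push Not at hex
      obtain rfl : S = {Q.start} := Set.eq_singleton_iff_nonempty_unique_mem.2 ⟨hne, hex⟩
      -- The remaining set `{0}`: `a ^ (m - 1)` leads to `(m - 1, {0})`, and `c` resets the first
      -- component while fixing `0` in the second.
      have h1 := (mulReachableAt_zero_empty (Q := Q) hm hP).iterate_final hP ha ha'.mem (m - 2)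
        (by omega)
      rw [Set.image_empty] at h1
      obtain ⟨p, hp, hr⟩ := h1
      have hv : (P.step p c).val = 0 := by
        rw [hc.val_step, if_pos (by omega)]
      have hsc : Q.step Q.start c = Q.start := Fin.ext (by
        rw [hc'.val_step, hs0, if_neg (by omega)])
      have := hr.step hc.mem hc'.mem (by rw [hP.mem_final, hv]; omega)
      rw [Set.image_insert_eq, Set.image_empty, hsc, insert_empty_eq] at this
      exact ⟨_, hv, this⟩

/-- If all sets are reachable at a nonfinal state `i` of the first component, then they are
reachable at all later states, with the restriction for the final state. -/
theorem mulReachable_of_le (hP : P.IsStandard) (ha : P.IsCycle a)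
    (haQ : a ∈ Q.letters) (hinj : Function.Injective fun q => Q.step q a) {i : ℕ} (hi : i + 2 ≤ m)
    (h : ∀ S, P.MulReachableAt Q i S) {p : Fin m} (hp : i ≤ p.val) {S : Set (Fin n)}
    (hS : p ∈ P.final → Q.start ∈ S) : P.MulReachable Q (some p) S := by
  have hsurj : ∀ k, Function.Surjective (fun q => Q.step q a)^[k] := fun k =>
    Finite.injective_iff_surjective.1 (hinj.iterate k)
  by_cases hf : p ∈ P.final
  · have hpv := (hP.mem_final p).1 hf
    obtain ⟨q, hq, hr⟩ := (h ((fun q => Q.step q a)^[m - 2 - i + 1] ⁻¹' S)).iterate_final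
      hP ha haQ (m - 2 - i) (by omega)
    obtain rfl : q = p := Fin.ext (by omega)
    rwa [Set.image_preimage_eq _ (hsurj _), Set.insert_eq_of_mem (hS hf)] at hr
  · rw [hP.mem_final] at hf
    have := p.2
    obtain ⟨q, hq, hr⟩ := (h ((fun q => Q.step q a)^[p.val - i] ⁻¹' S)).iterate
      hP ha haQ (p.val - i) (by omega)
    obtain rfl : q = p := Fin.ext (by omega)
    rwa [Set.image_preimage_eq _ (hsurj _)] at hr

theorem IsStandard.exists_final (hP : P.IsStandard) (hm : 3 ≤ m) :
    ∃ f ∈ P.final, ∀ g ∈ P.final, g = f := by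
  refine ⟨⟨m - 1, by omega⟩, (hP.mem_final _).2 (Nat.sub_add_cancel (by omega)), fun g hg => ?_⟩
  rw [hP.mem_final] at hg
  exact Fin.ext (by simp only; omega)

theorem IsCycle.exists_mem_lang (ha : P.IsCycle a) (hP : P.IsStandard) : ∃ w, w ∈ P.lang :=
  ⟨_, (ha.replicate_sub_mem_rightLang hP.mem_final).2 rfl⟩

theorem start_mem_mulStates_concat_iff {w : List α} {x : α} (hx : x ∈ Q.letters) :
    Q.start ∈ P.mulStates Q (w ++ [x]) ↔ (∃ r ∈ P.mulStates Q w, Q.step r x = Q.start) ∨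
      w ++ [x] ∈ P.lang := by
  rw [mem_mulStates_concat]
  simp [hx]

/-- A power of `a` brings `p` to `m - 2`, and then `ca` is read. The letter `c` empties state `n -
1` of the second component, so the old states cannot produce `0` under `a`; hence `0` is present
only if the first component has just become final, which `ca` achieves from `m - 2` alone. -/
theorem eq_of_leftQuotient_mul_eq (hm : 3 ≤ m) (hn : 3 ≤ n) (hP : P.IsStandard)
    (hQ : Q.IsStandard) (ha : P.IsCycle a) (ha' : Q.IsCycle a) (hc : P.IsMerge c)
    (hc' : Q.IsMerge c) {v w : List α} {p q : Fin m} (hv : P.run? v = some p)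
    (hw : P.run? w = some q)
    (h : (P.lang * Q.lang).leftQuotient v = (P.lang * Q.lang).leftQuotient w) : p = q := by
  by_contra hne
  obtain ⟨k, hk⟩ := ha.exists_run_eq p ⟨m - 2, by omega⟩
  have hrun : ∀ {u r}, P.run? u = some r →
      P.run? (u ++ List.replicate k a) = some (P.run r (List.replicate k a)) := by
    intro u r hu
    rw [run?_eq_some_iff] at hu ⊢
    exact ⟨append_mem_wordsOver.2 ⟨hu.1, ha.replicate_mem k⟩, by rw [run_append, hu.2]⟩
  have hv' := hrun hv
  have hw' := hrun hw
  have hne' : P.run p (List.replicate k a) ≠ P.run q (List.replicate k a) :=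
    fun h => hne (ha.injective_run k h)
  set p' := P.run p (List.replicate k a)
  set q' := P.run q (List.replicate k a)
  have hp' : p'.val = m - 2 := congrArg Fin.val hk
  have hq' : q'.val ≠ m - 2 := fun h => hne' (Fin.ext (hp'.trans h.symm))
  have hq2 := q'.2
  have hpc := hc.val_step p'
  rw [if_neg (by omega)] at hpc
  have hpa := ha.val_step (P.step p' c)
  rw [hpc, hp', Nat.mod_eq_of_lt (by omega)] at hpa
  have hqc := hc.val_step q'
  have hqa := ha.val_step (P.step q' c)
  have heq := ha'.mulStates_append_eq hQ h (List.replicate k a ++ [c] ++ [a])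
  simp only [← List.append_assoc] at heq
  have hmem : Q.start ∈ P.mulStates Q (v ++ List.replicate k a ++ [c] ++ [a]) := by
    refine start_mem_mulStates (f := P.step (P.step p' c) a) ?_
      (run?_concat (run?_concat hv' hc.mem) ha.mem)
    rw [hP.mem_final, hpa]
    omega
  rw [heq, start_mem_mulStates_concat_iff ha'.mem] at hmem
  rcases hmem with ⟨r, hr, hra⟩ | hl
  · have hrv := ha'.val_step r
    rw [hra, hQ.start_val] at hrv
    have hr2 := r.2
    have hrn : r.val + 1 = n := by
      rcases lt_or_ge (r.val + 1) n with h | h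
      · rw [Nat.mod_eq_of_lt h] at hrv
        omega
      · omega
    rcases mem_mulStates_concat.1 hr with ⟨-, t, -, htr⟩ | ⟨hrs, -⟩
    · have := hc'.val_step t
      rw [htr] at this
      split_ifs at this <;> omega
    · rw [hrs, hQ.start_val] at hrn
      omega
  · obtain ⟨f, hf, hr⟩ := mem_lang_iff_run?.1 hl
    rw [run?_concat (run?_concat hw' hc.mem) ha.mem, Option.some.injEq] at hr
    rw [hP.mem_final, ← hr, hqa] at hf
    split_ifs at hqc with h1
    · rw [hqc, Nat.mod_eq_of_lt (by omega)] at hf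
      omega
    · rw [hqc, Nat.mod_eq_of_lt (by omega)] at hf
      omega

theorem complexity_mul_of_letters_eq (hm : 3 ≤ m) (hn : 3 ≤ n) (hP : P.IsStandard)
    (hQ : Q.IsStandard) (hPQ : P.letters = Q.letters)
    (ha : P.IsCycle a) (ha' : Q.IsCycle a) (hb : P.IsSwap b) (hb' : Q.IsSwap b)
    (hc : P.IsMerge c) (hc' : Q.IsMerge c) :
    complexity (P.lang * Q.lang) = ((m * 2 ^ n - 2 ^ (n - 1) : ℕ) : ℕ∞) := by
  have hPm := ha.isMinimal hP.mem_final
  have hQm := ha'.isMinimal hQ.mem_final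
  refine le_antisymm (hPm.complexity_mul_le_of_letters_eq hm hPQ) ?_
  obtain ⟨f, hf, huniq⟩ := hP.exists_final hm
  have hcount := encard_setOf_fst_eq_imp f Q.start
  rw [Fintype.card_fin] at hcount
  rw [← hcount]
  have hreach : ∀ x : Fin m × Set (Fin n), (x.1 = f → Q.start ∈ x.2) →
      P.MulReachable Q (some x.1) x.2 := fun x hx =>
    mulReachable_of_le hP ha ha'.mem ha'.injective_step (i := 0) (by omega)
      (mulReachableAt_zero hm hn hP hQ ha ha' hb hb' hc hc') (Nat.zero_le _)
      fun hx1 => hx (huniq _ hx1)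
  refine le_complexity (fun x : Fin m × Set (Fin n) => P.mulLang Q (some x.1) x.2) _
    (fun x hx => ?_) fun x hx y hy h => ?_
  · obtain ⟨w, hw, h1, h2⟩ := hreach x hx
    rw [alphabet_mul (ha.exists_mem_lang hP) (ha'.exists_mem_lang hQ), hPm.alphabet_lang,
      hQm.alphabet_lang]
    exact ⟨w, hw, by rw [leftQuotient_mul, h1, h2]⟩
  · obtain ⟨v, -, h1, h2⟩ := hreach x hx
    obtain ⟨w, -, h3, h4⟩ := hreach y hy
    have h' : (P.lang * Q.lang).leftQuotient v = (P.lang * Q.lang).leftQuotient w := by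
      rw [leftQuotient_mul, leftQuotient_mul, h1, h2, h3, h4]
      exact h
    have hsets := ha'.mulStates_append_eq hQ h' []
    rw [List.append_nil, List.append_nil, h2, h4] at hsets
    exact Prod.ext (eq_of_leftQuotient_mul_eq hm hn hP hQ ha ha' hc hc' h1 h3 h') hsets

/-- If `a` and `b` act as a cycle and a transposition on the first component and the other way
around on the second one, all sets are reachable at the states `0` and `1`. -/
theorem mulReachableAt_le_one (hm : 3 ≤ m) (hn : 3 ≤ n) (hP : P.IsStandard) (hQ : Q.IsStandard)
    (ha : P.IsCycle a) (ha' : Q.IsSwap a) (hb : P.IsSwap b) (hb' : Q.IsCycle b)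
    (S : Set (Fin n)) : ∀ i < 2, P.MulReachableAt Q i S := by
  have hs0 := hQ.start_val
  have hs1 : (Q.step Q.start a).val = 1 := by rw [ha'.val_step, if_pos hs0]
  have hs2 : Q.step (Q.step Q.start a) a = Q.start := ha'.step_step _
  have hsurja := Finite.injective_iff_surjective.1 ha'.injective_step
  have hbit : ∀ j : ℕ, Function.Injective (fun q => Q.step q b)^[j] := fun j =>
    hb'.injective_step.iterate j
  have hval : ∀ (j : ℕ) (q : Fin n), ((fun q => Q.step q b)^[j] q).val = (q.val + j) % n := by
    intro j q
    induction j with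
    | zero => simp [Nat.mod_eq_of_lt q.2]
    | succ j ih =>
      rw [Function.iterate_succ', Function.comp_apply, hb'.val_step, ih, Nat.mod_add_mod, add_assoc]
  -- The letter `b` exchanges `0` and `1` in the first component while it rotates the second.
  have hrot : ∀ (j i : ℕ) (T : Set (Fin n)), i < 2 → P.MulReachableAt Q i T →
      P.MulReachableAt Q ((i + j) % 2) ((fun q => Q.step q b)^[j] '' T) := by
    intro j i T hi h
    induction j with
    | zero => simpa [Nat.mod_eq_of_lt hi] using h
    | succ j ih =>
      rw [Function.iterate_succ', Set.image_comp]
      exact ih.swap hm hP hb hb'.mem (by omega)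
  induction hk : S.ncard using Nat.strong_induction_on generalizing S with
  | _ k ih =>
    rcases S.eq_empty_or_nonempty with rfl | ⟨t, ht⟩
    · intro i hi
      have h0 := mulReachableAt_zero_empty (Q := Q) hm hP
      have := hrot i 0 ∅ (by omega) h0
      rwa [Set.image_empty, zero_add, Nat.mod_eq_of_lt hi] at this
    have hpre : ∀ {g : Fin n → Fin n}, Function.Injective g → ∀ T : Set (Fin n),
        (g ⁻¹' T).ncard = T.ncard := fun {g} hg T => by
      rw [← Set.ncard_image_of_injective _ hg, Set.image_preimage_eq _
        (Finite.injective_iff_surjective.1 hg)]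
    -- Reading `a ^ m` from state `1` passes the final state, which adds `0`; the two remaining
    -- letters swap it to `1` and back.
    have hzero : ∀ T : Set (Fin n), T.ncard = k → Q.start ∈ T → P.MulReachableAt Q 1 T := by
      intro T hT hs
      have hinj := ha'.injective_step.iterate m
      have hsurj := Finite.injective_iff_surjective.1 hinj
      have hrec := ih (((fun q => Q.step q a)^[m] ⁻¹' (T \ {Q.start})).ncard) (by
        rw [hpre hinj, ← hT]
        exact Set.ncard_sdiff_singleton_lt_of_mem hs) _ rfl 1 (by omega)
      have := ((hrec.iterate_final hP ha ha'.mem (m - 3) (by omega)).step_last hm hP ha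
        ha'.mem).iterate hP ha ha'.mem 1 (by omega)
      rwa [Function.iterate_one, Set.image_insert_eq, Set.image_insert_eq, ← Set.image_comp,
        ← Set.image_comp, Function.comp_assoc, ← Function.iterate_succ',
        ← Function.iterate_succ', show (m - 3 + 1).succ.succ = m by omega,
        Set.image_preimage_eq _ hsurj, hs2, Set.insert_sdiff_singleton, Set.insert_eq_of_mem hs]
        at this
    -- Rotating by `j` ties the state of the first component to the parity of `j`. For the other
    -- parity, an odd `n` allows an extra full turn.
    have hshift : ∀ (j : ℕ) (T : Set (Fin n)), T.ncard = k → (∃ q ∈ T, q.val = j % n) →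
        P.MulReachableAt Q ((1 + j) % 2) T := by
      rintro j T hT ⟨q, hq, hqj⟩
      have := hrot j 1 _ (by omega) (hzero ((fun q => Q.step q b)^[j] ⁻¹' T)
        ((hpre (hbit j) T).trans hT) (by
          rw [Set.mem_preimage]
          convert hq
          exact Fin.ext (by rw [hval, hs0, hqj, zero_add])))
      rwa [Set.image_preimage_eq _ (Finite.injective_iff_surjective.1 (hbit j))] at this
    intro i hi
    have htn := t.2
    by_cases hpar : (1 + t.val) % 2 = i
    · rw [← hpar]
      exact hshift _ S hk ⟨t, ht, (Nat.mod_eq_of_lt htn).symm⟩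
    by_cases hodd : n % 2 = 1
    · have := hshift (t.val + n) S hk ⟨t, ht, by
        rw [Nat.add_mod_right, Nat.mod_eq_of_lt htn]⟩
      rwa [show (1 + (t.val + n)) % 2 = i by omega] at this
    -- For even `n`, hence `n ≥ 4`, parity is broken at state `3`: the letter `a` fixes it in the
    -- second component and takes the first one from `0` to `1`.
    · have hthree : ∀ T : Set (Fin n), T.ncard = k → ⟨3, by omega⟩ ∈ T →
          P.MulReachableAt Q 1 T := by
        intro T hT h3
        have h3a : Q.step ⟨3, by omega⟩ a = ⟨3, by omega⟩ := Fin.ext (by rw [ha'.val_step]; rfl)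
        have := (hshift 3 ((fun q => Q.step q a) ⁻¹' T) ((hpre ha'.injective_step T).trans hT)
          ⟨⟨3, by omega⟩, by rw [Set.mem_preimage, h3a]; exact h3,
            (Nat.mod_eq_of_lt (by omega)).symm⟩).iterate hP ha ha'.mem 1 (by omega)
        rwa [Function.iterate_one, Set.image_preimage_eq _ hsurja] at this
      have := hrot (t.val + n - 3) 1 _ (by omega)
        (hthree ((fun q => Q.step q b)^[t.val + n - 3] ⁻¹' S) ((hpre (hbit _) S).trans hk) (by
          rw [Set.mem_preimage]
          convert ht
          refine Fin.ext ?_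
          rw [hval]
          simp only
          rw [show 3 + (t.val + n - 3) = t.val + n by omega, Nat.add_mod_right,
            Nat.mod_eq_of_lt htn]))
      rwa [Set.image_preimage_eq _ (Finite.injective_iff_surjective.1 (hbit _)),
        show (1 + (t.val + n - 3)) % 2 = i by omega] at this

theorem complexity_mul (hm : 3 ≤ m) (hn : 3 ≤ n) (hP : P.IsStandard) (hQ : Q.IsStandard)
    (ha : P.IsCycle a) (ha' : Q.IsSwap a) (hb : P.IsSwap b) (hb' : Q.IsCycle b)
    (hc : P.IsNeutral c) (hcQ : c ∉ Q.letters) (hd : Q.IsNeutral d) (hdP : d ∉ P.letters) :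
    complexity (P.lang * Q.lang) = ((m * 2 ^ n + 2 ^ (n - 1) : ℕ) : ℕ∞) := by
  have hPm := ha.isMinimal hP.mem_final
  have hQm := hb'.isMinimal hQ.mem_final
  refine le_antisymm (hPm.complexity_mul_le hm) ?_
  obtain ⟨f, hf, huniq⟩ := hP.exists_final hm
  rw [← encard_option_fin f Q.start]
  have hsmall := mulReachableAt_le_one hm hn hP hQ ha ha' hb hb'
  have hreach : ∀ x : Option (Fin m) × Set (Fin n), (x.1 = some f → Q.start ∈ x.2) →
      P.MulReachable Q x.1 x.2 := by
    rintro ⟨_ | p, S⟩ hx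
    · obtain ⟨p, -, hr⟩ := hsmall S 0 (by omega)
      have := hr.step_none hdP hd.mem
      simp only [hd.step_eq, Set.image_id'] at this
      exact this
    · exact mulReachable_of_le hP ha ha'.mem ha'.injective_step (i := 0) (by omega)
        (fun S => hsmall S 0 (by omega)) (Nat.zero_le _) fun hp => hx (congrArg some (huniq _ hp))
  -- The private letter `c` erases the second component, so after it `0` is present exactly if the
  -- first component is defined and final; a power of `a` first brings `p` there.
  have key : ∀ {v w : List α} {p : Fin m}, P.run? v = some p →
      (P.lang * Q.lang).leftQuotient v = (P.lang * Q.lang).leftQuotient w →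
      P.run? w = some p := by
    intro v w p hv h
    obtain ⟨k, hk⟩ := ha.exists_run_eq p f
    have heq := hb'.mulStates_append_eq hQ h (List.replicate k a ++ [c])
    simp only [← List.append_assoc] at heq
    have hmem : Q.start ∈ P.mulStates Q (v ++ List.replicate k a ++ [c]) := by
      rw [run?_eq_some_iff] at hv
      refine start_mem_mulStates hf ?_
      rw [← hc.step_eq f]
      refine run?_concat ?_ hc.mem
      rw [run?_eq_some_iff]
      exact ⟨append_mem_wordsOver.2 ⟨hv.1, ha.replicate_mem k⟩, by rw [run_append, hv.2, hk]⟩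
    rw [heq] at hmem
    rcases mem_mulStates_concat.1 hmem with ⟨h, -⟩ | ⟨-, hl⟩
    · exact absurd h hcQ
    · obtain ⟨hl1, hl2⟩ := hl
      rw [run_append, run_append, run_cons, run_nil, hc.step_eq] at hl2
      rw [run?_eq_some_iff]
      refine ⟨(append_mem_wordsOver.1 (append_mem_wordsOver.1 hl1).1).1, ha.injective_run k ?_⟩
      exact (huniq _ hl2).trans hk.symm
  refine le_complexity (fun x : Option (Fin m) × Set (Fin n) => P.mulLang Q x.1 x.2) _
    (fun x hx => ?_) fun x hx y hy h => ?_
  · obtain ⟨w, hw, h1, h2⟩ := hreach x hx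
    rw [alphabet_mul (ha.exists_mem_lang hP) (hb'.exists_mem_lang hQ), hPm.alphabet_lang,
      hQm.alphabet_lang]
    exact ⟨w, hw, by rw [leftQuotient_mul, h1, h2]⟩
  · obtain ⟨v, -, h1, h2⟩ := hreach x hx
    obtain ⟨w, -, h3, h4⟩ := hreach y hy
    have h' : (P.lang * Q.lang).leftQuotient v = (P.lang * Q.lang).leftQuotient w := by
      rw [leftQuotient_mul, leftQuotient_mul, h1, h2, h3, h4]
      exact h
    have hsets := hb'.mulStates_append_eq hQ h' []
    rw [List.append_nil, List.append_nil, h2, h4] at hsets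
    refine Prod.ext ?_ hsets
    rw [← h1, ← h3]
    cases hv : P.run? v with
    | some p => exact (key hv h').symm
    | none =>
      cases hw : P.run? w with
      | none => rfl
      | some p => rw [← hv, key hw h'.symm]

end Presentation

/-! ### Boolean operations: pair automaton, reachability and separation -/

theorem boolOp_or {α : Type*} (K L : Language α) : boolOp (fun p q => p ∨ q) K L = K ⊔ L := by
  ext w
  change (_ ∧ (w ∈ K ∨ w ∈ L)) ↔ (w ∈ K ∨ w ∈ L)
  refine and_iff_right_of_imp ?_
  rintro (h | h)
  · exact wordsOver_mono Set.subset_union_left (mem_wordsOver_alphabet h)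
  · exact wordsOver_mono Set.subset_union_right (mem_wordsOver_alphabet h)

theorem boolOp_and {α : Type*} (K L : Language α) : boolOp (fun p q => p ∧ q) K L = K ⊓ L := by
  ext w
  change (_ ∧ (w ∈ K ∧ w ∈ L)) ↔ (w ∈ K ∧ w ∈ L)
  exact and_iff_right_of_imp fun h =>
    wordsOver_mono Set.subset_union_left (mem_wordsOver_alphabet h.1)

theorem boolOp_and_not {α : Type*} (K L : Language α) :
    boolOp (fun p q => p ∧ ¬q) K L = K \ L := by
  ext w
  change (_ ∧ (w ∈ K ∧ w ∉ L)) ↔ (w ∈ K ∧ w ∉ L)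
  exact and_iff_right_of_imp fun h =>
    wordsOver_mono Set.subset_union_left (mem_wordsOver_alphabet h.1)

theorem boolOp_xor {α : Type*} (K L : Language α) :
    boolOp (fun p q => (p ∧ ¬q) ∨ (q ∧ ¬p)) K L = symmDiff K L := by
  ext w
  change (_ ∧ ((w ∈ K ∧ w ∉ L) ∨ (w ∈ L ∧ w ∉ K))) ↔ ((w ∈ K ∧ w ∉ L) ∨ (w ∈ L ∧ w ∉ K))
  refine and_iff_right_of_imp ?_
  rintro (h | h)
  · exact wordsOver_mono Set.subset_union_left (mem_wordsOver_alphabet h.1)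
  · exact wordsOver_mono Set.subset_union_right (mem_wordsOver_alphabet h.1)

theorem ProperBool.not_left {f : Prop → Prop → Prop} (hf : ProperBool f) :
    ¬((f True True ↔ f False True) ∧ (f True False ↔ f False False)) := by
  obtain ⟨⟨p, p', q, h⟩, -⟩ := hf
  rintro ⟨h1, h2⟩
  rcases Classical.propComplete p with rfl | rfl <;>
    rcases Classical.propComplete p' with rfl | rfl <;>
    rcases Classical.propComplete q with rfl | rfl <;> tauto

theorem ProperBool.not_right {f : Prop → Prop → Prop} (hf : ProperBool f) :
    ¬((f True True ↔ f True False) ∧ (f False True ↔ f False False)) := by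
  obtain ⟨-, p, q, q', h⟩ := hf
  rintro ⟨h1, h2⟩
  rcases Classical.propComplete p with rfl | rfl <;>
    rcases Classical.propComplete q with rfl | rfl <;>
    rcases Classical.propComplete q' with rfl | rfl <;> tauto

theorem properBool_and : ProperBool fun p q => p ∧ q :=
  ⟨⟨True, False, True, by simp⟩, True, True, False, by simp⟩

namespace Presentation

variable {α : Type*} {m n : ℕ} {P : Presentation α m} {Q : Presentation α n} {a b c d : α}
  {f : Prop → Prop → Prop}

/-- The words over the letters of `P` and `Q` whose acceptance from `p` and from `q` is related
by `f`. -/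
def boolLang (f : Prop → Prop → Prop) (P : Presentation α m) (Q : Presentation α n)
    (p : Option (Fin m)) (q : Option (Fin n)) : Language α :=
  {x | x ∈ wordsOver (P.letters ∪ Q.letters) ∧ f (x ∈ P.rightLang? p) (x ∈ Q.rightLang? q)}

theorem leftQuotient_boolOp (hP : P.IsMinimal) (hQ : Q.IsMinimal) {w : List α}
    (hw : w ∈ wordsOver (P.letters ∪ Q.letters)) :
    (boolOp f P.lang Q.lang).leftQuotient w = boolLang f P Q (P.run? w) (Q.run? w) := by
  ext x
  rw [Language.mem_leftQuotient]
  change (w ++ x ∈ wordsOver _ ∧ f (w ++ x ∈ P.lang) (w ++ x ∈ Q.lang)) ↔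
    (x ∈ wordsOver _ ∧ _)
  rw [append_mem_lang_iff, append_mem_lang_iff, hP.alphabet_lang, hQ.alphabet_lang,
    append_mem_wordsOver, and_iff_right hw]

theorem alphabet_boolOp_subset (hP : P.IsMinimal) (hQ : Q.IsMinimal) :
    alphabet (boolOp f P.lang Q.lang) ⊆ P.letters ∪ Q.letters := by
  rw [← hP.alphabet_lang, ← hQ.alphabet_lang]
  exact alphabet_subset fun _ h => h.1

theorem complexity_boolOp_le (hP : P.IsMinimal) (hQ : Q.IsMinimal) :
    complexity (boolOp f P.lang Q.lang) ≤ (((m + 1) * (n + 1) : ℕ) : ℕ∞) := by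
  have hc : (Set.univ : Set (Option (Fin m) × Option (Fin n))).encard
      = (((m + 1) * (n + 1) : ℕ) : ℕ∞) := by
    rw [Set.encard_univ, ENat.card_eq_coe_fintype_card]
    simp
  rw [← hc]
  refine complexity_le (fun x : Option (Fin m) × Option (Fin n) => boolLang f P Q x.1 x.2) _
    fun w hw => ⟨(P.run? w, Q.run? w), trivial, ?_⟩
  exact leftQuotient_boolOp hP hQ (wordsOver_mono (alphabet_boolOp_subset hP hQ) hw)

/-- If the result uses letters of the first operand only, as for a difference, the first component
is never `none`. -/
theorem complexity_boolOp_le_of_subset (hP : P.IsMinimal) (hQ : Q.IsMinimal)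
    (h : alphabet (boolOp f P.lang Q.lang) ⊆ P.letters) :
    complexity (boolOp f P.lang Q.lang) ≤ ((m * n + m : ℕ) : ℕ∞) := by
  have hc : (Set.univ : Set (Fin m × Option (Fin n))).encard = ((m * n + m : ℕ) : ℕ∞) := by
    rw [Set.encard_univ, ENat.card_eq_coe_fintype_card, Fintype.card_prod, Fintype.card_option,
      Fintype.card_fin, Fintype.card_fin, mul_add, mul_one]
  rw [← hc]
  refine complexity_le (fun x : Fin m × Option (Fin n) => boolLang f P Q (some x.1) x.2) _
    fun w hw => ⟨(P.run P.start w, Q.run? w), trivial, ?_⟩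
  replace hw := wordsOver_mono h hw
  rw [leftQuotient_boolOp hP hQ (wordsOver_mono Set.subset_union_left hw), run?_of_mem hw]

theorem complexity_boolOp_le_of_subset_inter (hP : P.IsMinimal) (hQ : Q.IsMinimal)
    (h : alphabet (boolOp f P.lang Q.lang) ⊆ P.letters ∩ Q.letters) :
    complexity (boolOp f P.lang Q.lang) ≤ ((m * n : ℕ) : ℕ∞) := by
  have hc : (Set.univ : Set (Fin m × Fin n)).encard = ((m * n : ℕ) : ℕ∞) := by
    rw [Set.encard_univ, ENat.card_eq_coe_fintype_card]
    simp
  rw [← hc]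
  refine complexity_le (fun x : Fin m × Fin n => boolLang f P Q (some x.1) (some x.2)) _
    fun w hw => ⟨(P.run P.start w, Q.run Q.start w), trivial, ?_⟩
  obtain ⟨hw1, hw2⟩ := mem_wordsOver_inter.1 (wordsOver_mono h hw)
  rw [leftQuotient_boolOp hP hQ (wordsOver_mono Set.subset_union_left hw1), run?_of_mem hw1,
    run?_of_mem hw2]

/-- The words over `A` lead from the pair `x` of states to the pair `y`. -/
def PairReachable (P : Presentation α m) (Q : Presentation α n) (A : Set α) (x y : Fin m × Fin n) :
    Prop :=
  ∃ w ∈ wordsOver A, P.run x.1 w = y.1 ∧ Q.run x.2 w = y.2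

theorem PairReachable.trans {A : Set α} {x y z : Fin m × Fin n} (h : PairReachable P Q A x y)
    (h' : PairReachable P Q A y z) : PairReachable P Q A x z := by
  obtain ⟨v, hv, h1, h2⟩ := h
  obtain ⟨w, hw, h3, h4⟩ := h'
  exact ⟨v ++ w, append_mem_wordsOver.2 ⟨hv, hw⟩, by rw [run_append, h1, h3],
    by rw [run_append, h2, h4]⟩

theorem injective_run_of_forall {A : Set α} (h : ∀ x ∈ A, Function.Injective fun q => P.step q x)
    {w : List α} (hw : w ∈ wordsOver A) : Function.Injective fun q => P.run q w := by
  induction w with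
  | nil => exact fun _ _ h => h
  | cons x w ih =>
    obtain ⟨hx, hw⟩ := cons_mem_wordsOver.1 hw
    exact (ih hw).comp (h x hx)

/-- When all letters act injectively, a word permutes the finite set of pairs, and the inverse
permutation is a power of it. -/
theorem PairReachable.symm {A : Set α} (hP : ∀ x ∈ A, Function.Injective fun q => P.step q x)
    (hQ : ∀ x ∈ A, Function.Injective fun q => Q.step q x) {x y : Fin m × Fin n}
    (h : PairReachable P Q A x y) : PairReachable P Q A y x := by
  obtain ⟨w, hw, h1, h2⟩ := h
  have hinj : Function.Injective fun z : Fin m × Fin n => (P.run z.1 w, Q.run z.2 w) := by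
    intro z z' h
    obtain ⟨h3, h4⟩ := Prod.mk.inj h
    exact Prod.ext (injective_run_of_forall hP hw h3) (injective_run_of_forall hQ hw h4)
  let σ : Equiv.Perm (Fin m × Fin n) :=
    Equiv.ofBijective _ (Finite.injective_iff_bijective.1 hinj)
  have hσ : ∀ k : ℕ, ∀ z, PairReachable P Q A z ((σ ^ k) z) := by
    intro k
    induction k with
    | zero => exact fun z => ⟨[], nil_mem_wordsOver, rfl, rfl⟩
    | succ k ih =>
      intro z
      refine (ih z).trans ?_
      rw [pow_succ', Equiv.Perm.mul_apply]
      exact ⟨w, hw, rfl, rfl⟩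
  have hxy : σ x = y := Prod.ext h1 h2
  have := hσ (orderOf σ - 1) y
  rwa [← hxy, ← Equiv.Perm.mul_apply, ← pow_succ, Nat.sub_add_cancel (orderOf_pos σ),
    pow_orderOf_eq_one, Equiv.Perm.one_apply, hxy] at this

/-- The letter `a` acts as a cycle and `b` as a transposition on the first component, and the
other way around on the second one. -/
structure IsCrossed (P : Presentation α m) (Q : Presentation α n) (a b : α) : Prop where
  left_standard : P.IsStandard
  right_standard : Q.IsStandard
  left_cycle : P.IsCycle a
  left_swap : P.IsSwap b
  right_cycle : Q.IsCycle b
  right_swap : Q.IsSwap a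

namespace IsCrossed

theorem symm (h : IsCrossed P Q a b) : IsCrossed Q P b a :=
  ⟨h.2, h.1, h.5, h.6, h.3, h.4⟩

theorem subset_letters (h : IsCrossed P Q a b) : {a, b} ⊆ P.letters :=
  Set.insert_subset h.left_cycle.mem (Set.singleton_subset_iff.2 h.left_swap.mem)

theorem left_isMinimal (h : IsCrossed P Q a b) : P.IsMinimal :=
  h.left_cycle.isMinimal h.left_standard.mem_final

theorem right_isMinimal (h : IsCrossed P Q a b) : Q.IsMinimal := h.symm.left_isMinimal

theorem injective_step (h : IsCrossed P Q a b) :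
    ∀ x ∈ ({a, b} : Set α), Function.Injective fun q => P.step q x := by
  rintro x (rfl | rfl)
  · exact h.left_cycle.injective_step
  · exact h.left_swap.injective_step

/-- Here `aa` advances the first component by `2` and fixes the second, and `bb` does the reverse.
This reaches all pairs of even residues; a single `a` or `b`, read where the other component is at a
suitable state, adjusts parities even if `m` or `n` is even. -/
theorem pairReachable_start (h : IsCrossed P Q a b) (hm : 3 ≤ m) (hn : 3 ≤ n)
    (x : Fin m × Fin n) : PairReachable P Q {a, b} (P.start, Q.start) x := by
  -- Coordinates are natural numbers read modulo `m` and `n`, so that parity arguments can go past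
  -- the end of a cycle.
  let R : ℕ → ℕ → Prop := fun i j => ∃ w ∈ wordsOver ({a, b} : Set α),
    (P.run P.start w).val = i % m ∧ (Q.run Q.start w).val = j % n
  have hA : a ∈ ({a, b} : Set α) := Or.inl rfl
  have hB : b ∈ ({a, b} : Set α) := Or.inr rfl
  have happ : ∀ {w v : List α}, w ∈ wordsOver ({a, b} : Set α) → v ∈ wordsOver ({a, b} : Set α) →
      w ++ v ∈ wordsOver ({a, b} : Set α) := fun h h' => append_mem_wordsOver.2 ⟨h, h'⟩
  have h00 : R 0 0 := ⟨[], nil_mem_wordsOver, by simp [h.left_standard.start_val],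
    by simp [h.right_standard.start_val]⟩
  have h20 : ∀ i j, R i j → R (i + 2) j := by
    rintro i j ⟨w, hw, h1, h2⟩
    refine ⟨w ++ [a, a], happ hw (cons_mem_wordsOver.2 ⟨hA, singleton_mem_wordsOver.2 hA⟩), ?_, ?_⟩
    · rw [run_append, run_cons, run_cons, run_nil, h.left_cycle.val_step, h.left_cycle.val_step, h1]
      simp [add_assoc]
    · rw [run_append, run_cons, run_cons, run_nil, h.right_swap.step_step, h2]
  have h02 : ∀ i j, R i j → R i (j + 2) := by
    rintro i j ⟨w, hw, h1, h2⟩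
    refine ⟨w ++ [b, b], happ hw (cons_mem_wordsOver.2 ⟨hB, singleton_mem_wordsOver.2 hB⟩), ?_, ?_⟩
    · rw [run_append, run_cons, run_cons, run_nil, h.left_swap.step_step, h1]
    · rw [run_append, run_cons, run_cons, run_nil, h.right_cycle.val_step, h.right_cycle.val_step,
        h2]
      simp [add_assoc]
  have h2k0 : ∀ k i j, R i j → R (i + 2 * k) j := by
    intro k i j hij
    induction k with
    | zero => exact hij
    | succ k ih => exact h20 _ _ ih
  have h02k : ∀ k i j, R i j → R i (j + 2 * k) := by
    intro k i j hij
    induction k with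
    | zero => exact hij
    | succ k ih => exact h02 _ _ ih
  have hmod : ∀ {i i' j j'}, R i j → i % m = i' % m → j % n = j' % n → R i' j' := by
    rintro i i' j j' ⟨w, hw, h1, h2⟩ hi hj
    exact ⟨w, hw, h1.trans hi, h2.trans hj⟩
  have hee : ∀ i j, R (2 * i) (2 * j) := by
    intro i j
    simpa using h02k j _ _ (h2k0 i _ _ h00)
  have hoe : ∀ i j, R (2 * i + 1) (2 * j) := by
    intro i j
    -- State `2` of the second component is fixed by its transposition `a`; from there, advancing by
    -- `2 * (j + n - 1)` wraps around to `2 * j`.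
    have h1 : R (2 * i + 1) 2 := by
      obtain ⟨w, hw, h1, h2⟩ := hee i 1
      refine ⟨w ++ [a], happ hw (singleton_mem_wordsOver.2 hA), ?_, ?_⟩
      · rw [run_append, run_cons, run_nil, h.left_cycle.val_step, h1, Nat.mod_add_mod]
      · rw [run_append, run_cons, run_nil, h.right_swap.val_step, h2, mul_one,
          Nat.mod_eq_of_lt (by omega)]
        rfl
    refine hmod (h02k (j + n - 1) _ _ h1) rfl ?_
    rw [show 2 + 2 * (j + n - 1) = 2 * j + n * 2 by omega, Nat.add_mul_mod_self_left]
  have heo : ∀ i j, R (2 * i) (2 * j + 1) := by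
    intro i j
    have h1 : R 2 (2 * j + 1) := by
      obtain ⟨w, hw, h1, h2⟩ := hee 1 j
      refine ⟨w ++ [b], happ hw (singleton_mem_wordsOver.2 hB), ?_, ?_⟩
      · rw [run_append, run_cons, run_nil, h.left_swap.val_step, h1, mul_one,
          Nat.mod_eq_of_lt (by omega)]
        rfl
      · rw [run_append, run_cons, run_nil, h.right_cycle.val_step, h2, Nat.mod_add_mod]
    refine hmod (h2k0 (i + m - 1) _ _ h1) ?_ rfl
    rw [show 2 + 2 * (i + m - 1) = 2 * i + m * 2 by omega, Nat.add_mul_mod_self_left]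
  have hoo : ∀ i j, R (2 * i + 1) (2 * j + 1) := by
    intro i j
    -- At `0` in the second component the letter `a` changes both parities at once.
    have h1 : R (2 * i + 1) 1 := by
      obtain ⟨w, hw, h1, h2⟩ := hee i 0
      refine ⟨w ++ [a], happ hw (singleton_mem_wordsOver.2 hA), ?_, ?_⟩
      · rw [run_append, run_cons, run_nil, h.left_cycle.val_step, h1, Nat.mod_add_mod]
      · rw [run_append, run_cons, run_nil, h.right_swap.val_step, h2, Nat.mod_eq_of_lt (by omega)]
        simp [Nat.mod_eq_of_lt (show 1 < n by omega)]
    have := h02k j _ _ h1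
    rwa [add_comm 1] at this
  have hall : ∀ i j, R i j := by
    intro i j
    rcases Nat.even_or_odd' i with ⟨i, rfl | rfl⟩ <;> rcases Nat.even_or_odd' j with ⟨j, rfl | rfl⟩
    · exact hee i j
    · exact heo i j
    · exact hoe i j
    · exact hoo i j
  obtain ⟨w, hw, h1, h2⟩ := hall x.1.val x.2.val
  exact ⟨w, hw, Fin.ext (h1.trans (Nat.mod_eq_of_lt x.1.2)),
    Fin.ext (h2.trans (Nat.mod_eq_of_lt x.2.2))⟩

theorem pairReachable (h : IsCrossed P Q a b) (hm : 3 ≤ m) (hn : 3 ≤ n) (x y : Fin m × Fin n) :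
    PairReachable P Q {a, b} x y :=
  ((h.pairReachable_start hm hn x).symm h.injective_step
    (by rw [Set.pair_comm]; exact h.symm.injective_step)).trans (h.pairReachable_start hm hn y)

/-- Distinct pairs of states are distinguished by every proper boolean operation. -/
theorem eq_of_forall (h : IsCrossed P Q a b) (hm : 3 ≤ m) (hn : 3 ≤ n) (hf : ProperBool f)
    {x y : Fin m × Fin n} (hxy : ∀ w ∈ wordsOver ({a, b} : Set α),
      (f (P.run x.1 w ∈ P.final) (Q.run x.2 w ∈ Q.final) ↔
        f (P.run y.1 w ∈ P.final) (Q.run y.2 w ∈ Q.final))) : x = y := by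
  obtain ⟨e, he, he'⟩ := h.left_standard.exists_final hm
  obtain ⟨g, hg, hg'⟩ := h.right_standard.exists_final hn
  have heval := (h.left_standard.mem_final e).1 he
  have hgval := (h.right_standard.mem_final g).1 hg
  have hPf : ∀ p, p ∈ P.final ↔ p = e := fun p => ⟨he' p, fun h => h ▸ he⟩
  have hQf : ∀ q, q ∈ Q.final ↔ q = g := fun q => ⟨hg' q, fun h => h ▸ hg⟩
  simp only [hPf, hQf] at hxy
  have hPinj : ∀ w ∈ wordsOver ({a, b} : Set α), Function.Injective fun q => P.run q w :=
    fun w hw => injective_run_of_forall h.injective_step hw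
  have hQinj : ∀ w ∈ wordsOver ({a, b} : Set α), Function.Injective fun q => Q.run q w := by
    rw [Set.pair_comm]
    exact fun w hw => injective_run_of_forall h.symm.injective_step hw
  have hmove : ∀ z : Fin m × Fin n, ∃ w ∈ wordsOver ({a, b} : Set α),
      P.run x.1 w = z.1 ∧ Q.run x.2 w = z.2 := fun z => h.pairReachable hm hn x z
  have hsP := h.left_standard.start_val
  have hsQ := h.right_standard.start_val
  have hse : P.start ≠ e := fun h => by rw [← h] at heval; omega
  have hsg : Q.start ≠ g := fun h => by rw [← h] at hgval; omega
  by_cases h1 : x.1 = y.1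
  · by_cases h2 : x.2 = y.2
    · exact Prod.ext h1 h2
    -- With a common first state, moving `x` to `(p, g)` shows that the second argument of `f` is
    -- irrelevant, for `p` final and for `p` not final.
    · have key : ∀ p : Fin m, (f (p = e) True ↔ f (p = e) False) := by
        intro p
        obtain ⟨w, hw, hw1, hw2⟩ := hmove (p, g)
        have hy : Q.run y.2 w ≠ g := fun hy => h2 (hQinj w hw (hw2.trans hy.symm))
        have := hxy w hw
        rwa [← h1, hw1, hw2, eq_self, eq_false hy] at this
      refine absurd ⟨?_, ?_⟩ hf.not_right
      · simpa using key e
      · simpa [hse] using key P.start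
  · by_cases h2 : x.2 = y.2
    · have key : ∀ q : Fin n, (f True (q = g) ↔ f False (q = g)) := by
        intro q
        obtain ⟨w, hw, hw1, hw2⟩ := hmove (e, q)
        have hy : P.run y.1 w ≠ e := fun hy => h1 (hPinj w hw (hw1.trans hy.symm))
        have := hxy w hw
        rwa [← h2, hw1, hw2, eq_self, eq_false hy] at this
      refine absurd ⟨?_, ?_⟩ hf.not_left
      · simpa using key g
      · simpa [hsg] using key Q.start
    · exfalso
      have hAD : f True True ↔ f False False := by
        obtain ⟨w, hw, hw1, hw2⟩ := hmove (e, g)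
        have hy : P.run y.1 w ≠ e := fun hy => h1 (hPinj w hw (hw1.trans hy.symm))
        have hy' : Q.run y.2 w ≠ g := fun hy => h2 (hQinj w hw (hw2.trans hy.symm))
        have := hxy w hw
        rwa [hw1, hw2, eq_self, eq_self, eq_false hy, eq_false hy'] at this
      have hC : (f False True ↔ f True False) ∨ (f False True ↔ f False False) := by
        obtain ⟨w, hw, hw1, hw2⟩ := hmove (P.start, g)
        have hy' : Q.run y.2 w ≠ g := fun hy => h2 (hQinj w hw (hw2.trans hy.symm))
        have := hxy w hw
        rw [hw1, hw2, eq_self, eq_false hse, eq_false hy'] at this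
        by_cases hy : P.run y.1 w = e
        · rw [eq_true hy] at this
          exact Or.inl this
        · rw [eq_false hy] at this
          exact Or.inr this
      -- Together with `hAD` and `hC`, a third test makes all four values of `f` agree. State `n -
      -- 2` is chosen so that, if `y` lands on `n - 1`, the word `bb` keeps the first components and
      -- moves the second ones to `0` and `1`, neither of them final.
      obtain ⟨w, hw, hw1, hw2⟩ := hmove (e, ⟨n - 2, by omega⟩)
      have hy : P.run y.1 w ≠ e := fun hy => h1 (hPinj w hw (hw1.trans hy.symm))
      have hne : (⟨n - 2, by omega⟩ : Fin n) ≠ g := fun h => by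
        rw [← h] at hgval
        simp at hgval
        omega
      have hB := hxy w hw
      rw [hw1, hw2, eq_self, eq_false hne, eq_false hy] at hB
      by_cases hy' : Q.run y.2 w = g
      · have hwb := hxy (w ++ [b, b]) (append_mem_wordsOver.2 ⟨hw, cons_mem_wordsOver.2
          ⟨Or.inr rfl, singleton_mem_wordsOver.2 (Or.inr rfl)⟩⟩)
        simp only [run_append, run_cons, run_nil, h.left_swap.step_step, hw1, hw2, hy'] at hwb
        have h3 : Q.step (Q.step ⟨n - 2, by omega⟩ b) b ≠ g := by
          intro h3
          have := h.right_cycle.val_step (Q.step ⟨n - 2, by omega⟩ b)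
          rw [h3, h.right_cycle.val_step, Nat.mod_add_mod, show n - 2 + 1 + 1 = n by omega,
            Nat.mod_self] at this
          omega
        have h4 : Q.step (Q.step g b) b ≠ g := by
          intro h4
          have := h.right_cycle.val_step (Q.step g b)
          rw [h4, h.right_cycle.val_step, hgval, Nat.mod_self, zero_add,
            Nat.mod_eq_of_lt (by omega)] at this
          omega
        rw [eq_false hy, eq_false h3, eq_false h4] at hwb
        rw [eq_true hy'] at hB
        exact hf.not_right ⟨hAD.trans hwb.symm, hB.symm.trans hwb⟩
      · rw [eq_false hy'] at hB
        rcases hC with hC | hC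
        · exact hf.not_right ⟨hAD.trans hB.symm, hC.trans hB⟩
        · exact hf.not_right ⟨hAD.trans hB.symm, hC⟩

end IsCrossed

end Presentation

theorem ProperBool.exists_true {f : Prop → Prop → Prop} (hf : ProperBool f) : ∃ p q, f p q := by
  by_contra! h
  exact hf.not_left ⟨by simp [h], by simp [h]⟩

/-! ### Orbits of pairs and coprimality -/

/-- A point whose orbit is everything and which is periodic has the number of points as its
minimal period. -/
theorem minimalPeriod_eq_of_forall {m : ℕ} {g : Fin m → Fin m} {s : Fin m}
    (h : ∀ p, ∃ k, g^[k] s = p) (hper : s ∈ Function.periodicPts g) :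
    Function.minimalPeriod g s = m := by
  have himg : (Finset.range (Function.minimalPeriod g s)).image (fun k => g^[k] s)
      = Finset.univ := by
    ext p
    simp only [Finset.mem_image, Finset.mem_range, Finset.mem_univ, iff_true]
    obtain ⟨k, rfl⟩ := h p
    exact ⟨k % Function.minimalPeriod g s,
      Nat.mod_lt _ (Function.minimalPeriod_pos_of_mem_periodicPts hper),
      Function.iterate_mod_minimalPeriod_eq⟩
  have := congrArg Finset.card himg
  rw [Finset.card_image_of_injOn] at this
  · simpa using this
  · intro i hi j hj hij
    exact Function.iterate_injOn_Iio_minimalPeriod (by simpa using hi) (by simpa using hj) hij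

/-- If the pairs `(g^[k] s, h^[k] t)` are all pairs, the numbers of points are coprime. -/
theorem coprime_of_forall_iterate {m n : ℕ} (hm : 2 ≤ m) (hn : 2 ≤ n) {g : Fin m → Fin m}
    {h : Fin n → Fin n} {s : Fin m} {t : Fin n}
    (H : ∀ p q, ∃ k, g^[k] s = p ∧ h^[k] t = q) : Nat.Coprime m n := by
  have : Nontrivial (Fin m) := Fin.nontrivial_iff_two_le.2 hm
  have : Nontrivial (Fin n) := Fin.nontrivial_iff_two_le.2 hn
  have hs : s ∈ Function.periodicPts g := by
    obtain ⟨q, hq⟩ := exists_ne t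
    obtain ⟨k, h1, h2⟩ := H s q
    refine ⟨k, Nat.pos_of_ne_zero ?_, h1⟩
    rintro rfl
    exact hq h2.symm
  have ht : t ∈ Function.periodicPts h := by
    obtain ⟨p, hp⟩ := exists_ne s
    obtain ⟨k, h1, h2⟩ := H p t
    refine ⟨k, Nat.pos_of_ne_zero ?_, h2⟩
    rintro rfl
    exact hp h1.symm
  have hgm := minimalPeriod_eq_of_forall (fun p => (H p t).imp fun _ h => h.1) hs
  have hhn := minimalPeriod_eq_of_forall (fun q => (H s q).imp fun _ h => h.2) ht
  obtain ⟨q, hq⟩ := exists_ne t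
  -- An exponent that fixes `s` and advances `t` by one is divisible by `m` and congruent to `1`
  -- modulo `n`.
  obtain ⟨k, h1, h2⟩ := H s (h t)
  have hmk : m ∣ k := by
    rw [← hgm]
    exact Function.IsPeriodicPt.minimalPeriod_dvd h1
  have hkn : k % n = 1 := by
    have h3 : h^[k % Function.minimalPeriod h t] t = h^[1] t := by
      rw [Function.iterate_mod_minimalPeriod_eq, h2, Function.iterate_one]
    rw [hhn] at h3
    exact Function.iterate_injOn_Iio_minimalPeriod
      (by rw [hhn]; exact Nat.mod_lt _ (by omega)) (by rw [hhn]; exact Set.mem_Iio.2 (by omega)) h3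
  have hd1 : Nat.gcd m n ∣ k := (Nat.gcd_dvd_left m n).trans hmk
  have hd2 : Nat.gcd m n ∣ 1 := by
    rw [← hkn]
    exact (Nat.dvd_mod_iff (Nat.gcd_dvd_right m n)).2 hd1
  exact Nat.dvd_one.1 hd2

/-! ### Exact complexity of boolean operations -/

namespace Presentation

variable {α : Type*} {m n : ℕ} {P : Presentation α m} {Q : Presentation α n} {a b c d : α}
  {f : Prop → Prop → Prop}

theorem mem_alphabet_boolOp (hP : P.IsMinimal) (hQ : Q.IsMinimal) {u v : List α} {x : α}
    (hw : u ++ x :: v ∈ wordsOver (P.letters ∪ Q.letters))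
    (h : f (u ++ x :: v ∈ P.lang) (u ++ x :: v ∈ Q.lang)) :
    x ∈ alphabet (boolOp f P.lang Q.lang) := by
  rw [← hP.alphabet_lang, ← hQ.alphabet_lang] at hw
  exact ⟨u ++ x :: v, ⟨hw, h⟩, by simp⟩

theorem lang_iff_of_run {w : List α} (hw : w ∈ wordsOver P.letters) :
    w ∈ P.lang ↔ P.run P.start w ∈ P.final := by
  rw [mem_lang, and_iff_right hw]

namespace IsCrossed

theorem subset_union (h : IsCrossed P Q a b) : {a, b} ⊆ P.letters ∪ Q.letters :=
  fun _ hx => Or.inl (h.subset_letters hx)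

theorem subset_right (h : IsCrossed P Q a b) : {a, b} ⊆ Q.letters := by
  rw [Set.pair_comm]
  exact h.symm.subset_letters

/-- After any first letter, some word leads to a pair of states at which `f` holds, so both `a` and
`b` occur in the result. -/
theorem subset_alphabet_boolOp (h : IsCrossed P Q a b) (hm : 3 ≤ m) (hn : 3 ≤ n)
    (hf : ∃ p q, f p q) : {a, b} ⊆ alphabet (boolOp f P.lang Q.lang) := by
  obtain ⟨e, he, -⟩ := h.left_standard.exists_final hm
  obtain ⟨g, hg, -⟩ := h.right_standard.exists_final hn
  have hse : P.start ∉ P.final := by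
    rw [h.left_standard.mem_final, h.left_standard.start_val]; omega
  have hsg : Q.start ∉ Q.final := by
    rw [h.right_standard.mem_final, h.right_standard.start_val]; omega
  obtain ⟨p, q, hpq⟩ := hf
  obtain ⟨z, hz⟩ : ∃ z : Fin m × Fin n, f (z.1 ∈ P.final) (z.2 ∈ Q.final) := by
    rcases Classical.propComplete p with rfl | rfl <;>
      rcases Classical.propComplete q with rfl | rfl
    · exact ⟨(e, g), by rwa [eq_true he, eq_true hg]⟩
    · exact ⟨(e, Q.start), by rwa [eq_true he, eq_false hsg]⟩
    · exact ⟨(P.start, g), by rwa [eq_false hse, eq_true hg]⟩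
    · exact ⟨(P.start, Q.start), by rwa [eq_false hse, eq_false hsg]⟩
  intro x hx
  obtain ⟨w, hw, h1, h2⟩ := h.pairReachable hm hn (P.step P.start x, Q.step Q.start x) z
  have hxw : [] ++ x :: w ∈ wordsOver ({a, b} : Set α) := cons_mem_wordsOver.2 ⟨hx, hw⟩
  refine mem_alphabet_boolOp h.left_isMinimal h.right_isMinimal (u := []) (v := w)
    (wordsOver_mono h.subset_union hxw) ?_
  rw [lang_iff_of_run (wordsOver_mono h.subset_letters hxw),
    lang_iff_of_run (wordsOver_mono h.subset_right hxw)]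
  simp only [List.nil_append, run_cons] at h1 h2 ⊢
  rwa [h1, h2]

theorem complexity_boolOp (h : IsCrossed P Q a b) (hm : 3 ≤ m) (hn : 3 ≤ n) (hf : ProperBool f)
    (hP : P.letters = {a, b}) (hQ : Q.letters = {a, b}) :
    complexity (boolOp f P.lang Q.lang) = ((m * n : ℕ) : ℕ∞) := by
  have hPm := h.left_isMinimal
  have hQm := h.right_isMinimal
  have hsub := alphabet_boolOp_subset (f := f) hPm hQm
  refine le_antisymm (complexity_boolOp_le_of_subset_inter hPm hQm ?_) ?_
  · rw [hP, hQ, Set.union_self] at hsub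
    rwa [hP, hQ, Set.inter_self]
  have hc : (Set.univ : Set (Fin m × Fin n)).encard = ((m * n : ℕ) : ℕ∞) := by
    rw [Set.encard_univ, ENat.card_eq_coe_fintype_card]
    simp
  rw [← hc]
  refine le_complexity (fun x : Fin m × Fin n => boolLang f P Q (some x.1) (some x.2)) _
    (fun x _ => ?_) fun x _ y _ hxy => ?_
  · obtain ⟨w, hw, h1, h2⟩ := h.pairReachable_start hm hn x
    refine ⟨w, wordsOver_mono (h.subset_alphabet_boolOp hm hn hf.exists_true) hw, ?_⟩
    rw [leftQuotient_boolOp hPm hQm (wordsOver_mono h.subset_union hw),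
      run?_eq_some_iff.2 ⟨wordsOver_mono h.subset_letters hw, h1⟩,
      run?_eq_some_iff.2 ⟨wordsOver_mono h.subset_right hw, h2⟩]
  · refine h.eq_of_forall hm hn hf fun w hw => ?_
    have hmem : ∀ z : Fin m × Fin n, w ∈ boolLang f P Q (some z.1) (some z.2) ↔
        f (P.run z.1 w ∈ P.final) (Q.run z.2 w ∈ Q.final) := by
      intro z
      change (_ ∧ f (_ ∧ _) (_ ∧ _)) ↔ _
      rw [and_iff_right (wordsOver_mono h.subset_union hw),
        eq_true (wordsOver_mono h.subset_letters hw), eq_true (wordsOver_mono h.subset_right hw),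
        true_and, true_and]
    rw [← hmem x, ← hmem y]
    simp only at hxy
    rw [hxy]

/-- A letter `c` that only the first component has, and which acts there as the identity,
reveals the state of the first component. -/
theorem fst_eq_of_boolLang_eq (h : IsCrossed P Q a b) (hc : P.IsNeutral c) (hcQ : c ∉ Q.letters)
    (hf1 : f True False) (hf0 : ¬f False False) {p p' : Option (Fin m)} {q q' : Option (Fin n)}
    (heq : boolLang f P Q p q = boolLang f P Q p' q') {r : Fin m} (hp : p = some r) :
    p' = some r := by
  have hw : [c] ++ List.replicate (m - 1 - r.val) a ∈ wordsOver P.letters :=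
    append_mem_wordsOver.2 ⟨singleton_mem_wordsOver.2 hc.mem, h.left_cycle.replicate_mem _⟩
  have hQ : ∀ q, [c] ++ List.replicate (m - 1 - r.val) a ∉ Q.rightLang? q := by
    rintro (_ | q)
    · exact Language.notMem_zero _
    · exact fun hm => hcQ (singleton_mem_wordsOver.1 (append_mem_wordsOver.1 hm.1).1)
  have hP : ∀ p, [c] ++ List.replicate (m - 1 - r.val) a ∈ P.rightLang? p ↔ p = some r := by
    rintro (_ | p)
    · simp [rightLang?]
    · change _ ∈ P.rightLang p ↔ _
      rw [append_mem_rightLang, and_iff_right (singleton_mem_wordsOver.2 hc.mem), run_cons, run_nil,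
        hc.step_eq, h.left_cycle.replicate_sub_mem_rightLang h.left_standard.mem_final,
        Option.some.injEq]
  have hmem : ∀ p q, [c] ++ List.replicate (m - 1 - r.val) a ∈ boolLang f P Q p q ↔
      p = some r := by
    intro p q
    change (_ ∧ f (_ ∈ _) (_ ∈ _)) ↔ _
    rw [and_iff_right (wordsOver_mono Set.subset_union_left hw), eq_false (hQ q), propext (hP p)]
    by_cases hpr : p = some r <;> simp [hpr, hf1, hf0]
  rw [← hmem p' q', ← heq, hmem]
  exact hp

theorem boolLang_swap (f : Prop → Prop → Prop) (p : Option (Fin m)) (q : Option (Fin n)) :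
    boolLang f P Q p q = boolLang (fun x y => f y x) Q P q p := by
  unfold boolLang
  rw [Set.union_comm]

theorem mem_alphabet_boolOp_of_neutral (h : IsCrossed P Q a b) (hm : 3 ≤ m) (hc : P.IsNeutral c)
    (hcQ : c ∉ Q.letters) (hf : f True False) : c ∈ alphabet (boolOp f P.lang Q.lang) := by
  obtain ⟨e, he, -⟩ := h.left_standard.exists_final hm
  obtain ⟨k, hk⟩ := h.left_cycle.exists_run_eq P.start e
  have hw : [] ++ c :: List.replicate k a ∈ wordsOver P.letters :=
    cons_mem_wordsOver.2 ⟨hc.mem, h.left_cycle.replicate_mem k⟩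
  refine mem_alphabet_boolOp h.left_isMinimal h.right_isMinimal (u := [])
    (wordsOver_mono Set.subset_union_left hw) ?_
  have h1 : [] ++ c :: List.replicate k a ∈ P.lang := by
    rw [lang_iff_of_run hw]
    simpa [hc.step_eq, hk] using he
  have h2 : [] ++ c :: List.replicate k a ∉ Q.lang := fun h =>
    hcQ (cons_mem_wordsOver.1 h.1).1
  rwa [eq_true h1, eq_false h2]

/-- The conditions on `f` hold for union and symmetric difference. The letter `c` makes the second
component undefined and keeps the first, `d` does the opposite, and each reveals the component it
keeps. -/
theorem complexity_boolOp_unrestricted (h : IsCrossed P Q a b) (hm : 3 ≤ m) (hn : 3 ≤ n)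
    (hc : P.IsNeutral c) (hcQ : c ∉ Q.letters) (hd : Q.IsNeutral d) (hdP : d ∉ P.letters)
    (hf1 : f True False) (hf2 : f False True) (hf0 : ¬f False False) :
    complexity (boolOp f P.lang Q.lang) = (((m + 1) * (n + 1) : ℕ) : ℕ∞) := by
  have hPm := h.left_isMinimal
  have hQm := h.right_isMinimal
  refine le_antisymm (complexity_boolOp_le hPm hQm) ?_
  have hcard : (Set.univ : Set (Option (Fin m) × Option (Fin n))).encard
      = (((m + 1) * (n + 1) : ℕ) : ℕ∞) := by
    rw [Set.encard_univ, ENat.card_eq_coe_fintype_card]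
    simp
  rw [← hcard]
  have hab := h.subset_alphabet_boolOp hm hn ⟨_, _, hf1⟩
  have hca := h.mem_alphabet_boolOp_of_neutral hm hc hcQ hf1
  have hda : d ∈ alphabet (boolOp f P.lang Q.lang) := by
    have := h.symm.mem_alphabet_boolOp_of_neutral (f := fun x y => f y x) hn hd hdP hf2
    convert this using 2
    unfold boolOp
    rw [Set.union_comm]
  have hreach : ∀ x : Option (Fin m) × Option (Fin n),
      ∃ w ∈ wordsOver (alphabet (boolOp f P.lang Q.lang)), P.run? w = x.1 ∧ Q.run? w = x.2 := by
    have hcw : ∀ w, Q.run? (w ++ [c]) = none := fun w =>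
      run?_append_of_notMem fun h => hcQ (singleton_mem_wordsOver.1 h)
    have hdw : ∀ w, P.run? (w ++ [d]) = none := fun w =>
      run?_append_of_notMem fun h => hdP (singleton_mem_wordsOver.1 h)
    have hpair : ∀ p q, ∃ w ∈ wordsOver (alphabet (boolOp f P.lang Q.lang)),
        P.run? w = some p ∧ Q.run? w = some q := by
      intro p q
      obtain ⟨w, hw, h1, h2⟩ := h.pairReachable_start hm hn (p, q)
      exact ⟨w, wordsOver_mono hab hw,
        run?_eq_some_iff.2 ⟨wordsOver_mono h.subset_letters hw, h1⟩,
        run?_eq_some_iff.2 ⟨wordsOver_mono h.subset_right hw, h2⟩⟩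
    rintro ⟨_ | p, _ | q⟩
    · refine ⟨[c] ++ [d], ?_, hdw [c], ?_⟩
      · exact cons_mem_wordsOver.2 ⟨hca, singleton_mem_wordsOver.2 hda⟩
      · exact run?_of_notMem fun h => hcQ (cons_mem_wordsOver.1 h).1
    · obtain ⟨w, hw, -, h2⟩ := hpair P.start q
      refine ⟨w ++ [d], append_mem_wordsOver.2 ⟨hw, singleton_mem_wordsOver.2 hda⟩, hdw w, ?_⟩
      rw [run?_concat h2 hd.mem, hd.step_eq]
    · obtain ⟨w, hw, h1, -⟩ := hpair p Q.start
      refine ⟨w ++ [c], append_mem_wordsOver.2 ⟨hw, singleton_mem_wordsOver.2 hca⟩, ?_, hcw w⟩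
      rw [run?_concat h1 hc.mem, hc.step_eq]
    · exact hpair p q
  refine le_complexity (fun x : Option (Fin m) × Option (Fin n) => boolLang f P Q x.1 x.2) _
    (fun x _ => ?_) fun x _ y _ hxy => ?_
  · obtain ⟨w, hw, h1, h2⟩ := hreach x
    exact ⟨w, hw, by
      rw [leftQuotient_boolOp hPm hQm (wordsOver_mono (alphabet_boolOp_subset hPm hQm) hw), h1, h2]⟩
  · simp only at hxy
    have hxy' := hxy
    rw [boolLang_swap f, boolLang_swap f] at hxy'
    refine Prod.ext ?_ ?_
    · exact Option.ext fun r => ⟨fun hr => h.fst_eq_of_boolLang_eq hc hcQ hf1 hf0 hxy hr,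
        fun hr => h.fst_eq_of_boolLang_eq hc hcQ hf1 hf0 hxy.symm hr⟩
    · exact Option.ext fun r => ⟨fun hr =>
          h.symm.fst_eq_of_boolLang_eq (f := fun p q => f q p) hd hdP hf2 hf0 hxy' hr,
        fun hr =>
          h.symm.fst_eq_of_boolLang_eq (f := fun p q => f q p) hd hdP hf2 hf0 hxy'.symm hr⟩

/-- The letter `c` reveals the first component. For the second one, lead the pair to two final
states: the word drops out of the difference, and since it permutes the states of `Q`, only the same
second state gives this. -/
theorem complexity_sdiff (h : IsCrossed P Q a b) (hm : 3 ≤ m) (hn : 3 ≤ n)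
    (hc : P.IsNeutral c) (hcQ : c ∉ Q.letters) :
    complexity (P.lang \ Q.lang) = ((m * n + m : ℕ) : ℕ∞) := by
  have hPm := h.left_isMinimal
  have hQm := h.right_isMinimal
  have hsub : alphabet (boolOp (fun p q => p ∧ ¬q) P.lang Q.lang) ⊆ P.letters :=
    alphabet_subset fun w hw => hw.2.1.1
  rw [← boolOp_and_not]
  refine le_antisymm (complexity_boolOp_le_of_subset hPm hQm hsub) ?_
  have hcard : (Set.univ : Set (Fin m × Option (Fin n))).encard = ((m * n + m : ℕ) : ℕ∞) := by
    rw [Set.encard_univ, ENat.card_eq_coe_fintype_card, Fintype.card_prod, Fintype.card_option,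
      Fintype.card_fin, Fintype.card_fin, mul_add, mul_one]
  rw [← hcard]
  have hf1 : True ∧ ¬False := by simp
  have hf0 : ¬(False ∧ ¬False) := by simp
  have hab := h.subset_alphabet_boolOp (f := fun p q => p ∧ ¬q) hm hn ⟨True, False, hf1⟩
  have hca := h.mem_alphabet_boolOp_of_neutral (f := fun p q => p ∧ ¬q) hm hc hcQ hf1
  refine le_complexity (fun x : Fin m × Option (Fin n) =>
    boolLang (fun p q => p ∧ ¬q) P Q (some x.1) x.2) _ (fun x _ => ?_) fun x _ y _ hxy => ?_
  · obtain ⟨w, hw, h1, h2⟩ : ∃ w ∈ wordsOver (alphabet (boolOp (fun p q => p ∧ ¬q) P.lang Q.lang)),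
        P.run? w = some x.1 ∧ Q.run? w = x.2 := by
      obtain ⟨p, _ | q⟩ := x
      · obtain ⟨w, hw, h1, -⟩ := h.pairReachable_start hm hn (p, Q.start)
        refine ⟨w ++ [c], append_mem_wordsOver.2 ⟨wordsOver_mono hab hw,
          singleton_mem_wordsOver.2 hca⟩, ?_, run?_append_of_notMem fun h =>
            hcQ (singleton_mem_wordsOver.1 h)⟩
        rw [run?_concat (run?_eq_some_iff.2 ⟨wordsOver_mono h.subset_letters hw, h1⟩) hc.mem,
          hc.step_eq]
      · obtain ⟨w, hw, h1, h2⟩ := h.pairReachable_start hm hn (p, q)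
        exact ⟨w, wordsOver_mono hab hw,
          run?_eq_some_iff.2 ⟨wordsOver_mono h.subset_letters hw, h1⟩,
          run?_eq_some_iff.2 ⟨wordsOver_mono h.subset_right hw, h2⟩⟩
    refine ⟨w, hw, ?_⟩
    rw [leftQuotient_boolOp hPm hQm (wordsOver_mono (alphabet_boolOp_subset hPm hQm) hw), h1, h2]
  · obtain ⟨p, q⟩ := x
    obtain ⟨p', q'⟩ := y
    simp only at hxy
    obtain rfl : p' = p := Option.some.inj
      (h.fst_eq_of_boolLang_eq hc hcQ hf1 hf0 hxy rfl)
    obtain ⟨e, he, -⟩ := h.left_standard.exists_final hm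
    obtain ⟨g, hg, hg'⟩ := h.right_standard.exists_final hn
    have key : ∀ {q q' : Option (Fin n)},
        boolLang (fun p q => p ∧ ¬q) P Q (some p') q =
          boolLang (fun p q => p ∧ ¬q) P Q (some p') q' →
        ∀ r, q = some r → q' = some r := by
      rintro q q' hqq r rfl
      obtain ⟨w, hw, h1, h2⟩ := h.pairReachable hm hn (p', r) (e, g)
      have hwP : w ∈ P.rightLang? (some p') :=
        ⟨wordsOver_mono h.subset_letters hw, by rw [h1]; exact he⟩
      have hwQ : w ∈ Q.rightLang? (some r) :=
        ⟨wordsOver_mono h.subset_right hw, by rw [h2]; exact hg⟩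
      have hwQ' : w ∈ Q.rightLang? q' := by
        by_contra hnot
        have : w ∈ boolLang (fun p q => p ∧ ¬q) P Q (some p') q' :=
          ⟨wordsOver_mono h.subset_union hw, hwP, hnot⟩
        rw [← hqq] at this
        exact this.2.2 hwQ
      cases q' with
      | none => exact absurd hwQ' (Language.notMem_zero _)
      | some t =>
        have hinj := injective_run_of_forall (P := Q) (A := {a, b})
          (by rw [Set.pair_comm]; exact h.symm.injective_step) hw
        exact congrArg some (hinj ((hg' _ hwQ'.2).trans h2.symm))
    exact Prod.ext rfl (Option.ext fun r => ⟨key hxy r, key hxy.symm r⟩)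

end IsCrossed

/-! ### Necessity of four letters -/

theorem eq_replicate_of_mem_wordsOver {A : Set α} (hA : A.Subsingleton) {x : α} (hx : x ∈ A)
    {w : List α} (hw : w ∈ wordsOver A) : w = List.replicate w.length x :=
  List.eq_replicate_of_mem fun _ hy => hA (hw _ hy) hx

theorem run_replicate (q : Fin m) (k : ℕ) (x : α) :
    P.run q (List.replicate k x) = (fun p => P.step p x)^[k] q := by
  induction k generalizing q with
  | zero => rfl
  | succ k ih => rw [List.replicate_succ, run_cons, ih, Function.iterate_succ_apply]

/-- The maximal complexity of a boolean operation is only attained if all pairs of states are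
reached. -/
theorem exists_run?_eq (hP : P.IsMinimal) (hQ : Q.IsMinimal)
    (h : complexity (boolOp f P.lang Q.lang) = (((m + 1) * (n + 1) : ℕ) : ℕ∞))
    (p : Option (Fin m)) (q : Option (Fin n)) :
    ∃ w ∈ wordsOver (P.letters ∪ Q.letters), P.run? w = p ∧ Q.run? w = q := by
  let R : Set (Option (Fin m) × Option (Fin n)) :=
    {x | ∃ w ∈ wordsOver (P.letters ∪ Q.letters), P.run? w = x.1 ∧ Q.run? w = x.2}
  have hR : R = Set.univ := by
    refine Set.Finite.eq_of_subset_of_encard_le (Set.toFinite _) (Set.subset_univ _) ?_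
    have hcard : (Set.univ : Set (Option (Fin m) × Option (Fin n))).encard
        = (((m + 1) * (n + 1) : ℕ) : ℕ∞) := by
      rw [Set.encard_univ, ENat.card_eq_coe_fintype_card]
      simp
    rw [hcard, ← h]
    refine complexity_le (fun x : Option (Fin m) × Option (Fin n) => boolLang f P Q x.1 x.2) R
      fun w hw => ?_
    replace hw := wordsOver_mono (alphabet_boolOp_subset hP hQ) hw
    exact ⟨(P.run? w, Q.run? w), ⟨w, hw, rfl, rfl⟩, leftQuotient_boolOp hP hQ hw⟩
  have : (p, q) ∈ R := hR ▸ trivial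
  exact this

theorem exists_mem_diff_of_run? {w : List α} {p : Fin m} (h1 : P.run? w = some p)
    (h2 : Q.run? w = none) : ∃ x ∈ P.letters, x ∉ Q.letters := by
  by_contra! h
  rw [run?_eq_some_iff] at h1
  rw [run?_of_mem (wordsOver_mono h h1.1)] at h2
  simp at h2

/-- Pairs with one undefined component force a private letter on each side. Pairs of defined states
are reached by common letters only: without any, just the initial pair is reached, and with a single
one, its powers reach all pairs only if `m` and `n` are coprime. -/
theorem four_le_encard_letters (hm : 3 ≤ m) (hn : 3 ≤ n) (hP : P.IsMinimal) (hQ : Q.IsMinimal)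
    (hmn : ¬Nat.Coprime m n)
    (h : complexity (boolOp f P.lang Q.lang) = (((m + 1) * (n + 1) : ℕ) : ℕ∞)) :
    4 ≤ (P.letters ∪ Q.letters).encard := by
  have hreach := exists_run?_eq hP hQ h
  obtain ⟨c, hcP, hcQ⟩ : ∃ x ∈ P.letters, x ∉ Q.letters := by
    obtain ⟨w, -, h1, h2⟩ := hreach (some P.start) none
    exact exists_mem_diff_of_run? h1 h2
  obtain ⟨d, hdQ, hdP⟩ : ∃ x ∈ Q.letters, x ∉ P.letters := by
    obtain ⟨w, -, h1, h2⟩ := hreach none (some Q.start)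
    exact exists_mem_diff_of_run? h2 h1
  have hcd : c ≠ d := by
    rintro rfl
    exact hcQ hdQ
  by_contra! hlt
  have hpair : ∀ p q, ∃ w ∈ wordsOver (P.letters ∩ Q.letters),
      P.run P.start w = p ∧ Q.run Q.start w = q := by
    intro p q
    obtain ⟨w, -, h1, h2⟩ := hreach (some p) (some q)
    rw [run?_eq_some_iff] at h1 h2
    exact ⟨w, mem_wordsOver_inter.2 ⟨h1.1, h2.1⟩, h1.2, h2.2⟩
  have hsub : (P.letters ∩ Q.letters).Subsingleton := by
    rw [← Set.encard_le_one_iff_subsingleton]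
    have hle : ({c, d} ∪ (P.letters ∩ Q.letters)).encard ≤ (P.letters ∪ Q.letters).encard := by
      refine Set.encard_le_encard ?_
      rintro x ((rfl | rfl) | hx)
      · exact Or.inl hcP
      · exact Or.inr hdQ
      · exact Or.inl hx.1
    rw [Set.encard_union_eq, Set.encard_pair hcd] at hle
    · have h3 := hle.trans_lt hlt
      by_contra! hgt
      have h2 : (2 : ℕ∞) ≤ (P.letters ∩ Q.letters).encard := Order.add_one_le_of_lt hgt
      have h4 : (2 : ℕ∞) + 2 ≤ 2 + (P.letters ∩ Q.letters).encard := by gcongr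
      exact absurd (h4.trans_lt h3) (by norm_num)
    · rw [Set.disjoint_left]
      rintro x (rfl | rfl) hx
      · exact hcQ hx.2
      · exact hdP hx.1
  rcases (P.letters ∩ Q.letters).eq_empty_or_nonempty with hE | ⟨x, hx⟩
  · have hone : ∀ p, P.start = p := by
      intro p
      obtain ⟨w, hw, h1, -⟩ := hpair p Q.start
      rw [hE] at hw
      obtain rfl : w = [] := List.eq_nil_iff_forall_not_mem.2 fun y hy => hw y hy
      exact h1
    have := (hone ⟨0, by omega⟩).symm.trans (hone ⟨1, by omega⟩)
    simp at this
  · refine hmn (coprime_of_forall_iterate (by omega) (by omega) (g := fun p => P.step p x)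
      (h := fun q => Q.step q x) (s := P.start) (t := Q.start) fun p q => ?_)
    obtain ⟨w, hw, h1, h2⟩ := hpair p q
    rw [eq_replicate_of_mem_wordsOver hsub hx hw, run_replicate] at h1 h2
    exact ⟨_, h1, h2⟩

end Presentation

/-! ### The dialects used as witnesses -/

theorem master_eq_lang (n : ℕ) (hn : 3 ≤ n) :
    master n hn = (masterPresentation n hn some).lang := by
  ext w
  change _ ↔ w ∈ Presentation.rightLang _ _
  rw [Presentation.mem_rightLang, run_masterPresentation rfl]
  exact (and_iff_right fun y _ => Option.some_ne_none y).symm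

/-- The inverse of the relabelling that defines `L_n(a)`. -/
def labelsA : Letter → Option Letter
  | .a => some .a
  | _ => none

/-- The inverse of the relabelling that defines `L_n(a, b)`. -/
def labelsAB : Letter → Option Letter
  | .a => some .a
  | .b => some .b
  | _ => none

/-- The inverse of the relabelling that defines `L_n(b, a)`. -/
def labelsBA : Letter → Option Letter
  | .a => some .b
  | .b => some .a
  | _ => none

/-- The inverse of the relabelling that defines `L_n(a, b, c)`. -/
def labelsABC : Letter → Option Letter
  | .a => some .a
  | .b => some .b
  | .c => some .c
  | .d => none

/-- The inverse of the relabelling that defines `L_n(a, b, -, c)`. -/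
def labelsABNoneC : Letter → Option Letter
  | .a => some .a
  | .b => some .b
  | .c => some .d
  | .d => none

/-- The inverse of the relabelling that defines `L_n(b, a, -, d)`. -/
def labelsBANoneD : Letter → Option Letter
  | .a => some .b
  | .b => some .a
  | .c => none
  | .d => some .d

section Stream

variable (n : ℕ) (hn : 3 ≤ n)

theorem stream_a : stream n hn (some .a) none none none =
    (masterPresentation n hn labelsA).lang :=
  dialect_master fun l y => by cases l <;> cases y <;> simp [labelsA]

theorem stream_ab : stream n hn (some .a) (some .b) none none =
    (masterPresentation n hn labelsAB).lang :=
  dialect_master fun l y => by cases l <;> cases y <;> simp [labelsAB]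

theorem stream_ba : stream n hn (some .b) (some .a) none none =
    (masterPresentation n hn labelsBA).lang :=
  dialect_master fun l y => by cases l <;> cases y <;> simp [labelsBA]

theorem stream_abc : stream n hn (some .a) (some .b) (some .c) none =
    (masterPresentation n hn labelsABC).lang :=
  dialect_master fun l y => by cases l <;> cases y <;> simp [labelsABC]

theorem stream_ab_none_c : stream n hn (some .a) (some .b) none (some .c) =
    (masterPresentation n hn labelsABNoneC).lang :=
  dialect_master fun l y => by cases l <;> cases y <;> simp [labelsABNoneC]

theorem stream_ba_none_d : stream n hn (some .b) (some .a) none (some .d) =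
    (masterPresentation n hn labelsBANoneD).lang :=
  dialect_master fun l y => by cases l <;> cases y <;> simp [labelsBANoneD]

theorem letters_ab : (masterPresentation n hn labelsAB).letters = {.a, .b} := by
  ext x
  cases x <;> simp [masterPresentation, labelsAB]

theorem letters_ba : (masterPresentation n hn labelsBA).letters = {.a, .b} := by
  ext x
  cases x <;> simp [masterPresentation, labelsBA]

theorem isMinimal_masterPresentation {n : ℕ} {hn : 3 ≤ n} {ρ : Letter → Option Letter}
    {x : Letter} (h : ρ x = some .a) : (masterPresentation n hn ρ).IsMinimal :=
  (isCycle_masterPresentation h).isMinimal isStandard_masterPresentation.mem_final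

theorem isCycle_abc : (masterPresentation n hn labelsABC).IsCycle .a :=
  isCycle_masterPresentation rfl

theorem isSwap_abc : (masterPresentation n hn labelsABC).IsSwap .b :=
  isSwap_masterPresentation rfl

theorem isMerge_abc : (masterPresentation n hn labelsABC).IsMerge .c :=
  isMerge_masterPresentation rfl

theorem isMinimal_abc : (masterPresentation n hn labelsABC).IsMinimal :=
  isMinimal_masterPresentation (x := .a) rfl

theorem isFull_abc : (masterPresentation n hn labelsABC).IsFull :=
  Presentation.exists_run_eq hn (isCycle_abc n hn) (isSwap_abc n hn) (isMerge_abc n hn)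

/-- No letter identifies the states `0` and `1`; `c` fixes both because `n ≥ 3`. This gives the
atoms the full alphabet. -/
theorem exists_step_ne_abc : ∀ x ∈ (masterPresentation n hn labelsABC).letters,
    ∃ p q, (masterPresentation n hn labelsABC).step p x ≠
      (masterPresentation n hn labelsABC).step q x := by
  intro x hx
  have h01 : (⟨0, by omega⟩ : Fin n) ≠ ⟨1, by omega⟩ := fun h => by simp at h
  refine ⟨⟨0, by omega⟩, ⟨1, by omega⟩, fun h => ?_⟩
  cases x with
  | a => exact h01 ((isCycle_abc n hn).injective_step h)
  | b => exact h01 ((isSwap_abc n hn).injective_step h)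
  | c =>
    have := congrArg Fin.val h
    rw [(isMerge_abc n hn).val_step, (isMerge_abc n hn).val_step] at this
    simp only at this
    split_ifs at this <;> omega
  | d => exact hx rfl

end Stream

/-- Two dialects in which the letters `a` and `b` play exchanged roles. -/
theorem isCrossed_masterPresentation {m n : ℕ} {hm : 3 ≤ m} {hn : 3 ≤ n}
    {ρ ρ' : Letter → Option Letter} (ha : ρ .a = some .a) (hb : ρ .b = some .b)
    (ha' : ρ' .a = some .b) (hb' : ρ' .b = some .a) :
    Presentation.IsCrossed (masterPresentation m hm ρ) (masterPresentation n hn ρ') .a .b where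
  left_standard := isStandard_masterPresentation
  right_standard := isStandard_masterPresentation
  left_cycle := isCycle_masterPresentation ha
  left_swap := isSwap_masterPresentation hb
  right_cycle := isCycle_masterPresentation hb'
  right_swap := isSwap_masterPresentation ha'

theorem isCrossed_ab_ba {m n : ℕ} (hm : 3 ≤ m) (hn : 3 ≤ n) :
    Presentation.IsCrossed (masterPresentation m hm labelsAB) (masterPresentation n hn labelsBA)
      .a .b :=
  isCrossed_masterPresentation rfl rfl rfl rfl

theorem isCrossed_ab_none_c_ba {m n : ℕ} (hm : 3 ≤ m) (hn : 3 ≤ n) :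
    Presentation.IsCrossed (masterPresentation m hm labelsABNoneC)
      (masterPresentation n hn labelsBA) .a .b :=
  isCrossed_masterPresentation rfl rfl rfl rfl

theorem isCrossed_ab_none_c_ba_none_d {m n : ℕ} (hm : 3 ≤ m) (hn : 3 ≤ n) :
    Presentation.IsCrossed (masterPresentation m hm labelsABNoneC)
      (masterPresentation n hn labelsBANoneD) .a .b :=
  isCrossed_masterPresentation rfl rfl rfl rfl

theorem isNeutral_ab_none_c (n : ℕ) (hn : 3 ≤ n) :
    (masterPresentation n hn labelsABNoneC).IsNeutral .c :=
  isNeutral_masterPresentation rfl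

theorem isNeutral_ba_none_d (n : ℕ) (hn : 3 ≤ n) :
    (masterPresentation n hn labelsBANoneD).IsNeutral .d :=
  isNeutral_masterPresentation rfl

theorem notMem_letters_masterPresentation {n : ℕ} {hn : 3 ≤ n} {ρ : Letter → Option Letter}
    {x : Letter} (h : ρ x = none) : x ∉ (masterPresentation n hn ρ).letters :=
  fun hx => hx h

end MostComplex

/-! ### The theorem: witnesses attain the bounds, presentations of arbitrary languages obey them -/

theorem theorem5 :
    -- the DFA is minimal, its language has complexity `n`, and so have the dialects used below
    (∀ (n : ℕ) (hn : 3 ≤ n),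
      IsMinimalDFA (masterDFA n hn) ∧
      RegularOfComplexity n (master n hn) ∧
      RegularOfComplexity n (stream n hn (some .a) none none none) ∧
      RegularOfComplexity n (stream n hn (some .a) (some .b) none none) ∧
      RegularOfComplexity n (stream n hn (some .b) (some .a) none none) ∧
      RegularOfComplexity n (stream n hn (some .a) (some .b) (some .c) none) ∧
      RegularOfComplexity n (stream n hn (some .a) (some .b) none (some .c)) ∧
      RegularOfComplexity n (stream n hn (some .b) (some .a) none (some .d))) ∧
    -- 1. syntactic semigroup
    (∀ (n : ℕ) (hn : 3 ≤ n),
      syntacticComplexity (stream n hn (some .a) (some .b) (some .c) none) = ((n ^ n : ℕ) : ℕ∞) ∧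
      ∀ (α : Type u) [Finite α] (L : Language α), RegularOfComplexity n L →
        syntacticComplexity L ≤ ((n ^ n : ℕ) : ℕ∞) ∧
        (syntacticComplexity L = ((n ^ n : ℕ) : ℕ∞) → 3 ≤ (alphabet L).encard)) ∧
    -- 2. quotients
    (∀ (n : ℕ) (hn : 3 ≤ n),
      (∀ K ∈ quotients (stream n hn (some .a) none none none), complexity K = n) ∧
      ∀ (α : Type u) [Finite α] (L : Language α), RegularOfComplexity n L →
        ∀ K ∈ quotients L, complexity K ≤ n) ∧
    -- 3. reversal and number of atoms
    (∀ (n : ℕ) (hn : 3 ≤ n),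
      complexity (stream n hn (some .a) (some .b) (some .c) none).reverse
        = ((2 ^ n : ℕ) : ℕ∞) ∧
      (atoms (stream n hn (some .a) (some .b) (some .c) none)).encard = ((2 ^ n : ℕ) : ℕ∞) ∧
      ∀ (α : Type u) [Finite α] (L : Language α), RegularOfComplexity n L →
        complexity L.reverse ≤ ((2 ^ n : ℕ) : ℕ∞) ∧
        (atoms L).encard ≤ ((2 ^ n : ℕ) : ℕ∞)) ∧
    -- 4. complexity of atoms
    (∀ (n : ℕ) (hn : 3 ≤ n),
      (∀ S A, IsAtomOf (stream n hn (some .a) (some .b) (some .c) none) S A →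
        complexity A = (atomBound n S.ncard : ℕ∞)) ∧
      ∀ (α : Type u) [Finite α] (L : Language α), RegularOfComplexity n L →
        ∀ S A, IsAtomOf L S A → complexity A ≤ (atomBound n S.ncard : ℕ∞)) ∧
    -- 5. star
    (∀ (n : ℕ) (hn : 3 ≤ n),
      complexity (stream n hn (some .a) (some .b) none none)∗
        = ((2 ^ (n - 1) + 2 ^ (n - 2) : ℕ) : ℕ∞) ∧
      ∀ (α : Type u) [Finite α] (L : Language α), RegularOfComplexity n L →
        complexity L∗ ≤ ((2 ^ (n - 1) + 2 ^ (n - 2) : ℕ) : ℕ∞)) ∧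
    -- 6. (a) restricted product
    (∀ (m n : ℕ) (hm : 3 ≤ m) (hn : 3 ≤ n),
      complexity (stream m hm (some .a) (some .b) (some .c) none *
          stream n hn (some .a) (some .b) (some .c) none)
        = ((m * 2 ^ n - 2 ^ (n - 1) : ℕ) : ℕ∞) ∧
      ∀ (α : Type u) [Finite α] (K L : Language α),
        RegularOfComplexity m K → RegularOfComplexity n L → alphabet K = alphabet L →
        complexity (K * L) ≤ ((m * 2 ^ n - 2 ^ (n - 1) : ℕ) : ℕ∞)) ∧
    -- 6. (b) unrestricted product
    (∀ (m n : ℕ) (hm : 3 ≤ m) (hn : 3 ≤ n),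
      complexity (stream m hm (some .a) (some .b) none (some .c) *
          stream n hn (some .b) (some .a) none (some .d))
        = ((m * 2 ^ n + 2 ^ (n - 1) : ℕ) : ℕ∞) ∧
      ∀ (α : Type u) [Finite α] (K L : Language α),
        RegularOfComplexity m K → RegularOfComplexity n L →
        complexity (K * L) ≤ ((m * 2 ^ n + 2 ^ (n - 1) : ℕ) : ℕ∞)) ∧
    -- 7. (a) restricted boolean operations
    (∀ (m n : ℕ) (hm : 3 ≤ m) (hn : 3 ≤ n) (f : Prop → Prop → Prop), ProperBool f →
      complexity (boolOp f (stream m hm (some .a) (some .b) none none)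
          (stream n hn (some .b) (some .a) none none))
        = ((m * n : ℕ) : ℕ∞) ∧
      ∀ (α : Type u) [Finite α] (K L : Language α),
        RegularOfComplexity m K → RegularOfComplexity n L → alphabet K = alphabet L →
        complexity (boolOp f K L) ≤ ((m * n : ℕ) : ℕ∞)) ∧
    -- 7. (b) unrestricted boolean operations
    (∀ (m n : ℕ) (hm : 3 ≤ m) (hn : 3 ≤ n),
      complexity (stream m hm (some .a) (some .b) none (some .c) ⊔
          stream n hn (some .b) (some .a) none (some .d))
        = (((m + 1) * (n + 1) : ℕ) : ℕ∞) ∧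
      complexity (symmDiff (stream m hm (some .a) (some .b) none (some .c))
          (stream n hn (some .b) (some .a) none (some .d)))
        = (((m + 1) * (n + 1) : ℕ) : ℕ∞) ∧
      complexity (stream m hm (some .a) (some .b) none (some .c) \
          stream n hn (some .b) (some .a) none none)
        = ((m * n + m : ℕ) : ℕ∞) ∧
      complexity (stream m hm (some .a) (some .b) none none ⊓
          stream n hn (some .b) (some .a) none none)
        = ((m * n : ℕ) : ℕ∞) ∧
      ∀ (α : Type u) [Finite α] (K L : Language α),
        RegularOfComplexity m K → RegularOfComplexity n L →
        complexity (K ⊔ L) ≤ (((m + 1) * (n + 1) : ℕ) : ℕ∞) ∧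
        complexity (symmDiff K L) ≤ (((m + 1) * (n + 1) : ℕ) : ℕ∞) ∧
        complexity (K \ L) ≤ ((m * n + m : ℕ) : ℕ∞) ∧
        complexity (K ⊓ L) ≤ ((m * n : ℕ) : ℕ∞) ∧
        -- four letters are necessary for union and symmetric difference
        (¬ Nat.Coprime m n →
          complexity (K ⊔ L) = (((m + 1) * (n + 1) : ℕ) : ℕ∞) ∨
          complexity (symmDiff K L) = (((m + 1) * (n + 1) : ℕ) : ℕ∞) →
          4 ≤ (alphabet K ∪ alphabet L).encard)) := by
  refine ⟨fun n hn => ?_, fun n hn => ?_, fun n hn => ?_, fun n hn => ?_, fun n hn => ?_,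
    fun n hn => ?_, fun m n hm hn => ?_, fun m n hm hn => ?_, fun m n hm hn f hf => ?_,
    fun m n hm hn => ?_⟩
  · rw [master_eq_lang, stream_a, stream_ab, stream_ba, stream_abc, stream_ab_none_c,
      stream_ba_none_d]
    have key : ∀ (ρ : Letter → Option Letter) (x : Letter), ρ x = some .a →
        RegularOfComplexity n (masterPresentation n hn ρ).lang :=
      fun ρ x h => (isMinimal_masterPresentation h).regularOfComplexity
    exact ⟨isMinimalDFA_masterDFA n hn, key some .a rfl, key labelsA .a rfl, key labelsAB .a rfl,
      key labelsBA .b rfl, key labelsABC .a rfl, key labelsABNoneC .a rfl,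
      key labelsBANoneD .b rfl⟩
  · rw [stream_abc]
    refine ⟨(isMinimal_abc n hn).syntacticComplexity_eq (isFull_abc n hn),
      fun α _ L hL => ?_⟩
    obtain ⟨P, hP, rfl⟩ := exists_presentation hL
    rw [hP.alphabet_lang]
    exact ⟨hP.syntacticComplexity_le, fun h =>
      Presentation.three_le_encard_letters hn (hP.exists_run_eq h)⟩
  · rw [stream_a]
    have ha : (masterPresentation n hn labelsA).IsCycle .a := isCycle_masterPresentation rfl
    refine ⟨fun K hK => ha.complexity_of_mem_quotients isStandard_masterPresentation.mem_final hK,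
      fun α _ L hL K hK => ?_⟩
    exact (complexity_le_of_mem_quotients hK).trans_eq hL.2
  · rw [stream_abc]
    refine ⟨(isMinimal_abc n hn).complexity_reverse hn isStandard_masterPresentation
      (isFull_abc n hn),
      (isMinimal_abc n hn).encard_atoms hn isStandard_masterPresentation (isFull_abc n hn),
      fun α _ L hL => ?_⟩
    obtain ⟨P, hP, rfl⟩ := exists_presentation hL
    exact ⟨hP.complexity_reverse_le, hP.encard_atoms_le⟩
  · rw [stream_abc]
    refine ⟨?_, fun α _ L hL => ?_⟩
    · rintro S A ⟨hS, rfl, -⟩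
      obtain ⟨T, -, hT, hc⟩ := (isMinimal_abc n hn).atomicIntersection_eq hS
      rw [hT, ← hc]
      exact (isFull_abc n hn).complexity_atom hn isStandard_masterPresentation
        (exists_step_ne_abc n hn) T
    · obtain ⟨P, hP, rfl⟩ := exists_presentation hL
      rintro S A ⟨hS, rfl, -⟩
      obtain ⟨T, -, hT, hc⟩ := hP.atomicIntersection_eq hS
      rw [hT, ← hc]
      exact Presentation.complexity_atom_le hn T
  · rw [stream_ab]
    -- Used only for the properties of its first component, the presentation of `L_n(a, b)`.
    have h := isCrossed_ab_ba hn hn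
    refine ⟨Presentation.complexity_kstar hn h.left_standard h.left_cycle h.left_swap,
      fun α _ L hL => ?_⟩
    obtain ⟨P, hP, rfl⟩ := exists_presentation hL
    exact hP.complexity_kstar_le hn
  · rw [stream_abc, stream_abc]
    refine ⟨Presentation.complexity_mul_of_letters_eq hm hn isStandard_masterPresentation
      isStandard_masterPresentation rfl
      (isCycle_abc m hm) (isCycle_abc n hn) (isSwap_abc m hm) (isSwap_abc n hn)
      (isMerge_abc m hm) (isMerge_abc n hn),
      fun α _ K L hK hL h => ?_⟩
    obtain ⟨P, hP, rfl⟩ := exists_presentation hK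
    obtain ⟨Q, hQ, rfl⟩ := exists_presentation hL
    rw [hP.alphabet_lang, hQ.alphabet_lang] at h
    exact hP.complexity_mul_le_of_letters_eq hm h
  · rw [stream_ab_none_c, stream_ba_none_d]
    have h := isCrossed_ab_none_c_ba_none_d hm hn
    refine ⟨Presentation.complexity_mul hm hn h.left_standard h.right_standard h.left_cycle
      h.right_swap h.left_swap h.right_cycle
      (isNeutral_ab_none_c m hm) (notMem_letters_masterPresentation rfl)
      (isNeutral_ba_none_d n hn) (notMem_letters_masterPresentation rfl),
      fun α _ K L hK hL => ?_⟩
    obtain ⟨P, hP, rfl⟩ := exists_presentation hK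
    obtain ⟨Q, hQ, rfl⟩ := exists_presentation hL
    exact hP.complexity_mul_le hm
  · rw [stream_ab, stream_ba]
    refine ⟨(isCrossed_ab_ba hm hn).complexity_boolOp hm hn hf
      (letters_ab m hm) (letters_ba n hn), fun α _ K L hK hL h => ?_⟩
    obtain ⟨P, hP, rfl⟩ := exists_presentation hK
    obtain ⟨Q, hQ, rfl⟩ := exists_presentation hL
    rw [hP.alphabet_lang, hQ.alphabet_lang] at h
    refine Presentation.complexity_boolOp_le_of_subset_inter hP hQ
      ((Presentation.alphabet_boolOp_subset hP hQ).trans ?_)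
    rw [h, Set.union_self, Set.inter_self]
  · rw [stream_ab_none_c, stream_ba_none_d, stream_ab, stream_ba]
    have key : ∀ f : Prop → Prop → Prop, f True False → f False True → ¬f False False →
        complexity (boolOp f (masterPresentation m hm labelsABNoneC).lang
          (masterPresentation n hn labelsBANoneD).lang) = (((m + 1) * (n + 1) : ℕ) : ℕ∞) :=
      fun f => (isCrossed_ab_none_c_ba_none_d hm hn).complexity_boolOp_unrestricted hm hn
        (isNeutral_ab_none_c m hm) (notMem_letters_masterPresentation rfl)
        (isNeutral_ba_none_d n hn) (notMem_letters_masterPresentation rfl)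
    refine ⟨?_, ?_, ?_, ?_, fun α _ K L hK hL => ?_⟩
    · rw [← boolOp_or]
      exact key _ (by simp) (by simp) (by simp)
    · rw [← boolOp_xor]
      exact key _ (by simp) (by simp) (by simp)
    · exact (isCrossed_ab_none_c_ba hm hn).complexity_sdiff hm hn (isNeutral_ab_none_c m hm)
        (notMem_letters_masterPresentation rfl)
    · rw [← boolOp_and]
      exact (isCrossed_ab_ba hm hn).complexity_boolOp hm hn
        properBool_and (letters_ab m hm) (letters_ba n hn)
    · obtain ⟨P, hP, rfl⟩ := exists_presentation hK
      obtain ⟨Q, hQ, rfl⟩ := exists_presentation hL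
      rw [hP.alphabet_lang, hQ.alphabet_lang, ← boolOp_or, ← boolOp_xor, ← boolOp_and_not,
        ← boolOp_and]
      refine ⟨Presentation.complexity_boolOp_le hP hQ, Presentation.complexity_boolOp_le hP hQ,
        Presentation.complexity_boolOp_le_of_subset hP hQ
          (alphabet_subset fun w hw => hw.2.1.1),
        Presentation.complexity_boolOp_le_of_subset_inter hP hQ
          (alphabet_subset fun w hw x hx => ⟨hw.2.1.1 x hx, hw.2.2.1 x hx⟩), fun hmn h => ?_⟩
      rcases h with h | h
      · exact Presentation.four_le_encard_letters hm hn hP hQ hmn h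
      · exact Presentation.four_le_encard_letters hm hn hP hQ hmn h
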